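/- Consider the sixth Painlevé equation $$y''=\tfrac12\Big(\tfrac1y+\tfrac1{y-1}+\tfrac1{y-x}\Big)y'^2-\Big(\tfrac1x+\tfrac1{x-1}+\tfrac1{y-x}\Big)y'+\tfrac{y(y-1)(y-x)}{x^2(x-1)^2}\Big\{\alpha-\beta\tfrac{x}{y^2}+\gamma\tfrac{x-1}{(y-1)^2}-\big(\delta-\tfrac12\big)\tfrac{x(x-1)}{(y-x)^2}\Big\}$$ in Hitchin's case $\alpha=\beta=\gamma=\delta=\tfrac18$. For integers $\alpha,\beta$ put $$\theta\big[{\textstyle{\alpha\atop\beta}}\big](z|\tau)=\sum_{k\in\mathbb Z}e^{\pi i(k+\alpha/2)^2\tau+2\pi i(k+\alpha/2)(z+\beta/2)},$$ $\theta_1=-\theta[{1\atop1}]$, $\theta_2=\theta[{1\atop0}]$, $\theta_3=\theta[{0\atop0}]$, $\theta_4=\theta[{0\atop1}]$, $\theta_1'=\partial\theta_1/\partial z$, $\vartheta_2(\tau)=\theta_2(0|\tau)$. Let $D=\mathbb C\setminus\big((-\infty,0]\cup[1,\infty)\big)$, and for $x\in D$ let $\sqrt x$ be the principal root, $K=K(\sqrt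 x)=\int_0^1\frac{d\lambda}{\sqrt{(1-\lambda^2)(1-x\lambda^2)}}$ and $K'=K'(\sqrt x)=K(\sqrt{1-x})$ (principal branches). For $A,B\in\mathbb C$ put $$y_{A,B}(x)=\frac{\sqrt x}{\theta_1^2}\left\{\frac{\pi\,\vartheta_2^2\,\theta_2\theta_3\theta_4}{\theta_1'+2\pi A\,\theta_1}-\theta_2^2\right\},$$ where $\theta_k,\theta_1'$ are taken at $\big(A\frac{K}{K'}+B\,\big|\,\frac{iK}{K'}\big)$ and $\vartheta_2$ at $\frac{iK}{K'}$. **Theorem 1.** The functions $y_{A,B}$ form the general solution of Hitchin's case. That is: (1) For all $A,B\in\mathbb C$ that are not of the form $A=\tfrac{im}{2}$, $B=\tfrac n2$ with $m,n\in\mathbb Z$ (for these a denominator of $y_{A,B}$ vanishes identically), $y_{A,B}$ is a meromorphic function on $D$, not identically $0$, $1$ or $x$, and solves the equation. (2) Conversely, let $U\subseteq D$ be a nonempty connected open set and $y$ a meromorphic solution on $U$ (not identically $0$, $1$ or $x$). Then $y=y_{A,B}$ on $U$, as meromorphic functions, for some pair $(A,B)$ as in (1), if and only if $y$ belongs to none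 of the four one-parameter families of Riccati solutions, i.e. satisfies none of $$x(x-1)y'=-\tfrac12y^2+xy-\tfrac12x,\qquad x(x-1)y'=\tfrac12y^2-y+\tfrac12x,$$ $$x(x-1)y'=\tfrac12y^2-\tfrac12x,\qquad x(x-1)y'=\tfrac12y^2+(x-1)y-\tfrac12x .$$ -/

import Mathlib

open Complex Filter Topology

noncomputable section

/-! ### Theta functions -/

/-- Theta series with integer characteristics `[α, β]`, for `Im τ > 0`. -/
def thetaChar (α β : ℤ) (z τ : ℂ) : ℂ :=
  ∑' k : ℤ, cexp (Real.pi * I * ((k : ℂ) + α / 2) ^ 2 * τ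
    + 2 * Real.pi * I * ((k : ℂ) + α / 2) * (z + β / 2))

def theta1 (z τ : ℂ) : ℂ := -thetaChar 1 1 z τ
def theta2 (z τ : ℂ) : ℂ := thetaChar 1 0 z τ
def theta3 (z τ : ℂ) : ℂ := thetaChar 0 0 z τ
def theta4 (z τ : ℂ) : ℂ := thetaChar 0 1 z τ

/-- The `z`-derivative of `theta1`, given by its series. -/
def dtheta1 (z τ : ℂ) : ℂ :=
  Real.pi * cexp (Real.pi * I * τ / 4) *
    ∑' k : ℤ, (-1 : ℂ) ^ k * (2 * (k : ℂ) + 1) * cexp (((k : ℂ) ^ 2 + k) * Real.pi * I * τ)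
      * cexp ((2 * (k : ℂ) + 1) * Real.pi * I * z)

/-! ### Complete elliptic integrals -/

/-- The plane cut along `(-∞, 0]` and `[1, ∞)`, on which the principal branches of `√x`,
`K(√x)` and `K'(√x)` are holomorphic. -/
def cutPlane : Set ℂ := {x | x ∈ slitPlane ∧ 1 - x ∈ slitPlane}

/-- The complete elliptic integral `K(√x)`, as a function of `x = k²`
(principal branch of the square root; holomorphic off `[1, ∞)`). -/
def ellK (x : ℂ) : ℂ :=
  ∫ t in (0 : ℝ)..1, 1 / ((1 - (t : ℂ) ^ 2) * (1 - x * (t : ℂ) ^ 2)) ^ (1 / 2 : ℂ)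

/-- The complementary integral `K'(√x) = K(√(1 - x))`. -/
def ellK' (x : ℂ) : ℂ := ellK (1 - x)

/-! ### The sixth Painlevé equation -/

/-- The right-hand side of the sixth Painlevé equation, at the point `x`, with `y = y(x)` and
`p = y'(x)`. -/
def painleveSixRHS (α β γ δ x y p : ℂ) : ℂ :=
  1 / 2 * (1 / y + 1 / (y - 1) + 1 / (y - x)) * p ^ 2
    - (1 / x + 1 / (x - 1) + 1 / (y - x)) * p
    + y * (y - 1) * (y - x) / (x ^ 2 * (x - 1) ^ 2)
      * (α - β * (x / y ^ 2) + γ * ((x - 1) / (y - 1) ^ 2)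
        - (δ - 1 / 2) * (x * (x - 1) / (y - x) ^ 2))

/-- `y` is a meromorphic solution on `U` of the sixth Painlevé equation: it is not locally
identically equal to `0`, `1` or `x` (where the equation makes no sense), and satisfies the
equation at every point where it is analytic with value different from `0`, `1`, `x`. -/
structure IsPainleveSixSolution (α β γ δ : ℂ) (U : Set ℂ) (y : ℂ → ℂ) : Prop where
  meromorphicOn : MeromorphicOn y U
  nondegenerate : ∀ x ∈ U, ∀ᶠ t in 𝓝[≠] x, y t ≠ 0 ∧ y t ≠ 1 ∧ y t ≠ t
  equation : ∀ x ∈ U, AnalyticAt ℂ y x → y x ≠ 0 → y x ≠ 1 → y x ≠ x →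
    deriv (deriv y) x = painleveSixRHS α β γ δ x (y x) (deriv y x)

/-- `y` satisfies on `U` (where it is analytic) the Riccati equation
`x (x - 1) y' = a y² + (b x + c) y + d x`. -/
def SatisfiesRiccati (a b c d : ℂ) (U : Set ℂ) (y : ℂ → ℂ) : Prop :=
  ∀ x ∈ U, AnalyticAt ℂ y x →
    x * (x - 1) * deriv y x = a * y x ^ 2 + (b * x + c) * y x + d * x

/-- The four classical one-parameter families of Riccati solutions of the sixth Painlevé equation
with `α = β = γ = δ = 1/8`. -/
def IsRiccatiSolution (U : Set ℂ) (y : ℂ → ℂ) : Prop :=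
  SatisfiesRiccati (-1 / 2) 1 0 (-1 / 2) U y ∨
  SatisfiesRiccati (1 / 2) 0 (-1) (1 / 2) U y ∨
  SatisfiesRiccati (1 / 2) 0 0 (-1 / 2) U y ∨
  SatisfiesRiccati (1 / 2) 1 (-1) (-1 / 2) U y

/-! ### The closed formula -/

/-- The expression in `x` with the free constants `A`, `B`. -/
def hitchinFormula (A B x : ℂ) : ℂ :=
  let τ : ℂ := I * ellK x / ellK' x
  let z : ℂ := A * (ellK x / ellK' x) + B
  x ^ (1 / 2 : ℂ) / theta1 z τ ^ 2 *
    (Real.pi * theta2 0 τ ^ 2 * (theta2 z τ * theta3 z τ * theta4 z τ)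
        / (dtheta1 z τ + 2 * Real.pi * A * theta1 z τ)
      - theta2 z τ ^ 2)

/-- The discrete set of constants `(A, B)` for which a denominator of the formula vanishes
identically in `x`: then `A K/K' + B` is a half-period `(m τ + n) / 2` for all `x`. -/
def IsExcludedPair (A B : ℂ) : Prop :=
  ∃ m n : ℤ, A = I * m / 2 ∧ B = n / 2

end

/-!
Write `τ = iK/K'`, `z = A K/K' + B = a τ + b` with `a = -iA`, `b = B`. The proof rests on a
Hamiltonian form of Hitchin's case: with a momentum `u`, the equation is equivalent to
`x (x - 1) y' = -y²/2 + x y - x/2 + u y (y - 1) (y - x)`,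
`x (x - 1) u' = -u² (3y² - 2(1 + x) y + x)/2 + u (y - x)`
(`deriv_deriv_eq_of_hamiltonian`, `isHamiltonianSolutionAt_conjugateMomentum`), and the four Riccati
families are the curves `u = 0`, `u y = 1`, `u (y - 1) = 1`, `u (y - x) = 1`.

With `ϑ_j = θ_j(0 | τ)`, let `h_j = ∂_z log (θ_j / θ₁)` for `j = 2, 3, 4` and
`P = θ₁'/θ₁ + 2πi a`. The products `h_j h_k` are
the differences `℘ - e_i`, so that `h₃ (h₂ - h₄) = e₁ - e₃ =: ω² = π² ϑ₃⁴` and `h₄ (h₂ - h₃) = x ω²`.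
The formula for `y_{A,B}` reads `y = -h₃ h₄ (P + h₂) / (ω² P)`, and its momentum is
`u = -ω² P / (h₂ h₃ h₄)` (`hitchinFormula_eq_hamiltonianY`). The heat equation, the Wronskians
`θ_j' θ₁ - θ_j θ₁' = -π ϑ_j² θ_k θ_l` (`theta12_wronskian` and its analogues) and
`(log θ₁)'' = ϑ_j''/ϑ_j - h_k h_l` (`second_log_deriv_theta3` and its analogues) give the derivatives
of `h_j` and `P` along `z = a τ + b`, and the Hamiltonian system in the variable `τ` becomes an
identity of rational functions. It passes to the variable `x` by the inversion
`√x = ϑ₄² / ϑ₃²`, `dx/dτ = ω² x (1 - x) / (πi)` (`sqrt_eq_theta_quotient`, `hasDerivAt_modulus`).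

All the facts on theta functions come from one product formula (`thetaD_mul`), which expresses
products at `τ` through theta functions at `2τ`: constants such as `θ₁'(0) / (ϑ₂ ϑ₃ ϑ₄)` are invariant
under `τ ↦ 2τ`, hence equal to their limits at `i∞`, and zeros of `θ₁` are moved by doubling into the
range where the leading term of the series dominates. The inversion of the modulus is proved on the
imaginary axis, by the substitution `u = sn` in the elliptic integral and Jacobi's imaginary
transformation, and extends to the cut plane by the identity theorem, as `Re (K / K') > 0` there.

For a pair `(A, B)` that is not excluded, the theta functions at `z` and `P` vanish only at isolated
`x` (`eventually_isGeneric`), and elsewhere the four quantities `u`, `u y - 1`, `u (y - 1) - 1`,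
`u (y - x) - 1` are finite and nonzero: `y_{A,B}` is a solution and not a Riccati solution.
Conversely a solution off the Riccati curves has, at a suitable point, initial values `(y₀, u₀)` for
which `y₀ - 1/u₀` is none of `0`, `1`, `x`. This number determines `θ₂(z)² / θ₁(z)²`, which takes
every value by Liouville's theorem, and then `u₀` determines `P`, i.e. `a` (`exists_isGeneric_eq`).
Uniqueness for the Hamiltonian system and the identity theorem conclude.
-/

/-! ### Theta series and their derivatives -/

/-- The summand of index `n` of the theta series with characteristics `[α, β]`. -/
noncomputable def thetaTerm (α β : ℤ) (z τ : ℂ) (n : ℤ) : ℂ :=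
  cexp (Real.pi * I * ((n : ℂ) + α / 2) ^ 2 * τ
    + 2 * Real.pi * I * ((n : ℂ) + α / 2) * (z + β / 2))

/-- The `k`-th `z`-derivative of the theta series with characteristics `[α, β]`, given by its
series. -/
noncomputable def thetaD (k : ℕ) (α β : ℤ) (z τ : ℂ) : ℂ :=
  ∑' n : ℤ, (2 * Real.pi * I * ((n : ℂ) + α / 2)) ^ k * thetaTerm α β z τ n

/-- A majorant of the terms of `thetaD k α β` on the region `|Im z| ≤ S`, `T ≤ Im τ`. -/
noncomputable def thetaBound (k : ℕ) (α : ℤ) (S T : ℝ) (n : ℤ) : ℝ :=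
  (2 * Real.pi) ^ k * Real.exp (Real.pi * (T * ((α : ℝ) / 2) ^ 2 + 2 * S * |(α : ℝ) / 2|)) *
    ((|(n : ℝ)| + |(α : ℝ) / 2|) ^ k * Real.exp (-Real.pi * (T / 2 * n ^ 2 - 2 * S * |(n : ℝ)|)))

lemma thetaChar_eq_thetaD (α β : ℤ) (z τ : ℂ) : thetaChar α β z τ = thetaD 0 α β z τ := by
  simp [thetaChar, thetaD, thetaTerm]

lemma summable_thetaBound (k : ℕ) (α : ℤ) (S : ℝ) {T : ℝ} (hT : 0 < T) :
    Summable (thetaBound k α S T) := by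
  unfold thetaBound
  refine Summable.mul_left _ ?_
  have h1 := summable_pow_mul_jacobiTheta₂_term_bound S (half_pos hT) k
  have h2 := summable_pow_mul_jacobiTheta₂_term_bound S (half_pos hT) 0
  refine Summable.of_nonneg_of_le (fun n => by positivity) (fun n => ?_)
    ((h1.mul_left (2 ^ (k - 1))).add (h2.mul_left (2 ^ (k - 1) * |(α : ℝ) / 2| ^ k)))
  have h3 := add_pow_le (abs_nonneg (n : ℝ)) (abs_nonneg ((α : ℝ) / 2)) k
  have h4 := mul_le_mul_of_nonneg_right h3
    (Real.exp_pos (-Real.pi * (T / 2 * n ^ 2 - 2 * S * |(n : ℝ)|))).le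
  push_cast
  refine h4.trans (le_of_eq ?_)
  ring

lemma norm_thetaTerm (α β : ℤ) (z τ : ℂ) (n : ℤ) :
    ‖thetaTerm α β z τ n‖ = Real.exp (-Real.pi * ((n : ℝ) + α / 2) ^ 2 * τ.im
      - 2 * Real.pi * ((n : ℝ) + α / 2) * z.im) := by
  have h : Real.pi * I * ((n : ℂ) + α / 2) ^ 2 * τ
    + 2 * Real.pi * I * ((n : ℂ) + α / 2) * (z + β / 2) =
    (Real.pi * ((n : ℝ) + α / 2) ^ 2 : ℝ) * τ * I
    + (2 * Real.pi * ((n : ℝ) + α / 2) : ℝ) * (z + (β / 2 : ℝ)) * I := by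
    push_cast; ring
  rw [thetaTerm, Complex.norm_exp, h, add_re, mul_I_re, mul_I_re, im_ofReal_mul, im_ofReal_mul,
    add_im, ofReal_im]
  ring_nf

lemma norm_thetaD_term_le {S T : ℝ} (hT : 0 < T) {z τ : ℂ} (hz : |z.im| ≤ S) (hτ : T ≤ τ.im)
    (k : ℕ) (α β n : ℤ) :
    ‖(2 * Real.pi * I * ((n : ℂ) + α / 2)) ^ k * thetaTerm α β z τ n‖ ≤ thetaBound k α S T n := by
  have hS : 0 ≤ S := (abs_nonneg _).trans hz
  have e1 : ‖(2 * Real.pi * I * ((n : ℂ) + α / 2))‖ = 2 * Real.pi * |(n : ℝ) + α / 2| := by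
    have : ((n : ℂ) + α / 2) = (((n : ℝ) + α / 2 : ℝ) : ℂ) := by push_cast; ring
    rw [this]
    simp [abs_of_pos Real.pi_pos, -ofReal_add]
  rw [norm_mul, norm_pow, e1, norm_thetaTerm, thetaBound, mul_pow, mul_mul_mul_comm]
  have h1 : |(n : ℝ) + α / 2| ≤ |(n : ℝ)| + |(α : ℝ) / 2| := abs_add_le _ _
  rw [← mul_assoc, mul_assoc (_ * _) (Real.exp _) (Real.exp _), ← Real.exp_add]
  gcongr
  set c : ℝ := (α : ℝ) / 2
  set m : ℝ := n + c
  have h2 : -(m * z.im) ≤ (|(n : ℝ)| + |c|) * S :=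
    (neg_le_abs _).trans (by rw [abs_mul]; gcongr)
  have h3 : (n : ℝ) ^ 2 / 2 - c ^ 2 ≤ m ^ 2 := by
    simp only [m]; nlinarith [sq_nonneg ((n : ℝ) + 2 * c)]
  have h4 : T * ((n : ℝ) ^ 2 / 2 - c ^ 2) ≤ m ^ 2 * τ.im :=
    (mul_le_mul_of_nonneg_left h3 hT.le).trans (by nlinarith [sq_nonneg m])
  nlinarith [Real.pi_pos]

lemma summable_norm_thetaD_term (k : ℕ) (α β : ℤ) (z : ℂ) {τ : ℂ} (hτ : 0 < τ.im) :
    Summable fun n : ℤ => ‖(2 * Real.pi * I * ((n : ℂ) + α / 2)) ^ k * thetaTerm α β z τ n‖ :=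
  Summable.of_nonneg_of_le (fun _ => norm_nonneg _)
    (fun n => norm_thetaD_term_le hτ le_rfl le_rfl k α β n) (summable_thetaBound k α _ hτ)

lemma summable_norm_thetaTerm (α β : ℤ) (z : ℂ) {τ : ℂ} (hτ : 0 < τ.im) :
    Summable fun n : ℤ => ‖thetaTerm α β z τ n‖ := by
  simpa using summable_norm_thetaD_term 0 α β z hτ

/-- The chain rule along an affine curve `s ↦ (a s + b, c s + d)`; the heat equation
`4πi ∂_τ θ = ∂_z² θ` is built in. -/
lemma hasDerivAt_thetaD (k : ℕ) (α β : ℤ) (a b c d : ℂ) {s₀ : ℂ} (h : 0 < (c * s₀ + d).im) :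
    HasDerivAt (fun s => thetaD k α β (a * s + b) (c * s + d))
      (a * thetaD (k + 1) α β (a * s₀ + b) (c * s₀ + d)
        + c / (4 * Real.pi * I) * thetaD (k + 2) α β (a * s₀ + b) (c * s₀ + d)) s₀ := by
  set T := (c * s₀ + d).im / 2 with hTdef
  set S := |(a * s₀ + b).im| + 1 with hSdef
  have hT : 0 < T := half_pos h
  have ev : ∀ᶠ s in 𝓝 s₀, T < (c * s + d).im ∧ |(a * s + b).im| < S := by
    refine (ContinuousAt.eventually_lt (f := fun _ => T) (g := fun s => (c * s + d).im)
      (by fun_prop) (by fun_prop) ?_).and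
      (ContinuousAt.eventually_lt (f := fun s => |(a * s + b).im|) (g := fun _ => S)
      (by fun_prop) (by fun_prop) ?_)
    · simp only [hTdef]; linarith
    · simp only [hSdef]; linarith
  obtain ⟨r, hr, hball⟩ := Metric.eventually_nhds_iff_ball.mp ev
  have hπ : (Real.pi : ℂ) ≠ 0 := by exact_mod_cast Real.pi_ne_zero
  have key : ∀ (n : ℤ) (s : ℂ), HasDerivAt
      (fun s => (2 * Real.pi * I * ((n : ℂ) + α / 2)) ^ k * thetaTerm α β (a * s + b) (c * s + d) n)
      (a * ((2 * Real.pi * I * ((n : ℂ) + α / 2)) ^ (k + 1)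
          * thetaTerm α β (a * s + b) (c * s + d) n)
        + c / (4 * Real.pi * I) * ((2 * Real.pi * I * ((n : ℂ) + α / 2)) ^ (k + 2)
          * thetaTerm α β (a * s + b) (c * s + d) n)) s := by
    intro n s
    unfold thetaTerm
    have h1 : HasDerivAt (fun s : ℂ => Real.pi * I * ((n : ℂ) + α / 2) ^ 2 * (c * s + d)
      + 2 * Real.pi * I * ((n : ℂ) + α / 2) * ((a * s + b) + β / 2))
      (Real.pi * I * ((n : ℂ) + α / 2) ^ 2 * (c * 1)
      + 2 * Real.pi * I * ((n : ℂ) + α / 2) * (a * 1)) s :=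
      ((((hasDerivAt_id s).const_mul c).add_const d).const_mul _).add
        (((((hasDerivAt_id s).const_mul a).add_const b).add_const _).const_mul _)
    refine (h1.cexp.const_mul ((2 * Real.pi * I * ((n : ℂ) + α / 2)) ^ k)).congr_deriv ?_
    have : (2 * Real.pi * I * ((n : ℂ) + α / 2)) ^ (k + 2) =
      (2 * Real.pi * I * ((n : ℂ) + α / 2)) ^ k *
        (4 * Real.pi * I) * (Real.pi * I * ((n : ℂ) + α / 2) ^ 2) := by ring
    rw [this]
    field_simp
    ring
  have hsum := fun k => summable_thetaBound k α S hT
  have main := hasDerivAt_tsum_of_isPreconnected (𝕜 := ℂ) (F := ℂ)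
    (((hsum (k + 1)).mul_left ‖a‖).add ((hsum (k + 2)).mul_left ‖c / (4 * Real.pi * I)‖))
    (Metric.isOpen_ball (x := s₀) (ε := r)) (convex_ball s₀ r).isPreconnected
    (fun n s _ => key n s) (fun n s hs => ?_) (Metric.mem_ball_self hr)
    (summable_norm_thetaD_term k α β (a * s₀ + b) h).of_norm (Metric.mem_ball_self hr)
  · refine main.congr_deriv ?_
    rw [Summable.tsum_add, tsum_mul_left, tsum_mul_left]
    · rfl
    · exact ((summable_norm_thetaD_term (k + 1) α β (a * s₀ + b) h).of_norm).mul_left _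
    · exact ((summable_norm_thetaD_term (k + 2) α β (a * s₀ + b) h).of_norm).mul_left _
  · obtain ⟨h1, h2⟩ := hball s hs
    refine (norm_add_le _ _).trans ?_
    rw [norm_mul a, norm_mul (c / _)]
    gcongr
    · exact norm_thetaD_term_le hT h2.le h1.le _ _ _ _
    · exact norm_thetaD_term_le hT h2.le h1.le _ _ _ _

lemma hasDerivAt_thetaD_fst (k : ℕ) (α β : ℤ) (z : ℂ) {τ : ℂ} (hτ : 0 < τ.im) :
    HasDerivAt (fun z => thetaD k α β z τ) (thetaD (k + 1) α β z τ) z := by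
  simpa using hasDerivAt_thetaD k α β 1 0 0 τ (s₀ := z) (by simpa using hτ)

lemma hasDerivAt_thetaD_curve (k : ℕ) (α β : ℤ) (a b : ℂ) {τ : ℂ} (hτ : 0 < τ.im) :
    HasDerivAt (fun τ => thetaD k α β (a * τ + b) τ)
      (a * thetaD (k + 1) α β (a * τ + b) τ
        + thetaD (k + 2) α β (a * τ + b) τ / (4 * Real.pi * I)) τ := by
  have := hasDerivAt_thetaD k α β a b 1 0 (s₀ := τ) (by simpa using hτ)
  simp only [one_mul, add_zero] at this
  convert this using 2
  ring

/-! ### Characteristics, parity, quasi-periods -/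

lemma thetaD_add_two_left (k : ℕ) (α β : ℤ) (z τ : ℂ) :
    thetaD k (α + 2) β z τ = thetaD k α β z τ := by
  unfold thetaD
  rw [← (Equiv.addRight (1 : ℤ)).tsum_eq (fun n : ℤ => (2 * Real.pi * I * ((n : ℂ) + α / 2)) ^ k
    * thetaTerm α β z τ n)]
  refine tsum_congr fun n => ?_
  simp only [Equiv.coe_addRight, thetaTerm]
  push_cast
  ring_nf

lemma exp_two_pi_I_half (α n : ℤ) :
    cexp (2 * Real.pi * I * ((n : ℂ) + α / 2)) = (-1) ^ α := by
  rw [← exp_pi_mul_I, ← exp_int_mul,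
    show (2 * Real.pi * I * ((n : ℂ) + α / 2)) = n * (2 * Real.pi * I) + α * (Real.pi * I) by ring,
    exp_add, exp_int_mul_two_pi_mul_I, one_mul]

lemma thetaTerm_add_one (α β : ℤ) (z τ : ℂ) (n : ℤ) :
    thetaTerm α β (z + 1) τ n = (-1) ^ α * thetaTerm α β z τ n := by
  rw [← exp_two_pi_I_half α n, thetaTerm, thetaTerm, ← exp_add]
  ring_nf

lemma thetaD_add_one (k : ℕ) (α β : ℤ) (z τ : ℂ) :
    thetaD k α β (z + 1) τ = (-1) ^ α * thetaD k α β z τ := by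
  simp only [thetaD, thetaTerm_add_one, mul_left_comm _ ((-1 : ℂ) ^ α), tsum_mul_left]

lemma thetaD_add_one_right (k : ℕ) (α β : ℤ) (z τ : ℂ) :
    thetaD k α (β + 1) z τ = thetaD k α β (z + 1 / 2) τ := by
  unfold thetaD thetaTerm
  refine tsum_congr fun n => ?_
  push_cast
  ring_nf

lemma thetaD_add_two_right (k : ℕ) (α β : ℤ) (z τ : ℂ) :
    thetaD k α (β + 2) z τ = (-1) ^ α * thetaD k α β z τ := by
  rw [show β + 2 = (β + 1) + 1 by ring, thetaD_add_one_right, thetaD_add_one_right,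
    ← thetaD_add_one]
  ring_nf

lemma thetaD_neg (k : ℕ) (α β : ℤ) (z τ : ℂ) :
    thetaD k α β (-z) τ = (-1) ^ k * (-1) ^ (α * β) * thetaD k α β z τ := by
  unfold thetaD
  rw [← ((Equiv.neg ℤ).trans (Equiv.subRight α)).tsum_eq, ← tsum_mul_left]
  refine tsum_congr fun n => ?_
  have h2 : (2 * Real.pi * I * (((-n - α : ℤ) : ℂ) + α / 2)) ^ k
      = (-1) ^ k * (2 * Real.pi * I * ((n : ℂ) + α / 2)) ^ k := by
    rw [← mul_pow]; congr 1; push_cast; ring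
  have h3 : thetaTerm α β (-z) τ (-n - α) = (-1) ^ (α * β) * thetaTerm α β z τ n := by
    have h4 : cexp (2 * Real.pi * I * ((n : ℂ) + α / 2)) ^ (-β) = (-1) ^ (α * β) := by
      rw [exp_two_pi_I_half, ← zpow_mul, mul_neg, zpow_neg, ← inv_zpow]
      norm_num
    rw [← h4, ← exp_int_mul, thetaTerm, thetaTerm, ← exp_add]
    push_cast
    ring_nf
  simp only [Equiv.trans_apply, Equiv.neg_apply, Equiv.subRight_apply]
  rw [h2, h3]
  ring

lemma thetaD_zero_add_tau (α β : ℤ) (z τ : ℂ) :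
    thetaD 0 α β (z + τ) τ =
      cexp (-Real.pi * I * τ - 2 * Real.pi * I * (z + β / 2)) * thetaD 0 α β z τ := by
  simp only [thetaD, pow_zero, one_mul]
  rw [← (Equiv.addRight (1 : ℤ)).tsum_eq (fun n : ℤ => thetaTerm α β z τ n), ← tsum_mul_left]
  refine tsum_congr fun n => ?_
  simp only [Equiv.coe_addRight, thetaTerm, ← exp_add]
  push_cast
  ring_nf

/-! ### The product formula -/

/-- `ℤ × ℤ` splits, through `(k, l) ↦ (k + l, k - l)`, into pairs of equal and of opposite
parity. -/
def parityEquiv : (ℤ × ℤ) ⊕ (ℤ × ℤ) ≃ ℤ × ℤ where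
  toFun := Sum.elim (fun p => (p.1 + p.2, p.1 - p.2)) (fun p => (p.1 + p.2 + 1, p.1 - p.2))
  invFun p := if (p.1 + p.2) % 2 = 0 then Sum.inl ((p.1 + p.2) / 2, (p.1 - p.2) / 2)
    else Sum.inr ((p.1 + p.2) / 2, (p.1 - p.2) / 2)
  left_inv p := by
    rcases p with ⟨i, j⟩ | ⟨i, j⟩
    · change (if ((i + j) + (i - j)) % 2 = 0 then
        Sum.inl (((i + j) + (i - j)) / 2, ((i + j) - (i - j)) / 2) else _) = _
      rw [if_pos (by omega)]
      congr 2 <;> omega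
    · change (if ((i + j + 1) + (i - j)) % 2 = 0 then _ else
        Sum.inr (((i + j + 1) + (i - j)) / 2, ((i + j + 1) - (i - j)) / 2)) = _
      rw [if_neg (by omega)]
      congr 2 <;> omega
  right_inv p := by
    obtain ⟨i, j⟩ := p
    by_cases h : (i + j) % 2 = 0
    · simp only [if_pos h, Sum.elim_inl]
      ext <;> simp <;> omega
    · simp only [if_neg h, Sum.elim_inr]
      ext <;> simp <;> omega

/-- The product of two theta functions is bilinear in theta functions of twice the modulus. -/
lemma thetaD_mul (α β β' : ℤ) (z w : ℂ) {τ : ℂ} (hτ : 0 < τ.im) :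
    thetaD 0 α β (z + w) τ * thetaD 0 α β' (z - w) τ =
      thetaD 0 α (β + β') (2 * z) (2 * τ) * thetaD 0 0 (β - β') (2 * w) (2 * τ) +
      thetaD 0 (α + 1) (β + β') (2 * z) (2 * τ) * thetaD 0 1 (β - β') (2 * w) (2 * τ) := by
  have hτ2 : 0 < (2 * τ).im := by simpa using hτ
  simp only [thetaD, pow_zero, one_mul]
  have s1 := summable_norm_thetaTerm α β (z + w) hτ
  have s2 := summable_norm_thetaTerm α β' (z - w) hτ
  have s3 := summable_norm_thetaTerm α (β + β') (2 * z) hτ2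
  have s4 := summable_norm_thetaTerm 0 (β - β') (2 * w) hτ2
  have s5 := summable_norm_thetaTerm (α + 1) (β + β') (2 * z) hτ2
  have s6 := summable_norm_thetaTerm 1 (β - β') (2 * w) hτ2
  rw [tsum_mul_tsum_of_summable_norm s1 s2, tsum_mul_tsum_of_summable_norm s3 s4,
    tsum_mul_tsum_of_summable_norm s5 s6, ← parityEquiv.tsum_eq]
  refine HasSum.tsum_eq (HasSum.sum ?_ ?_)
  · convert (summable_mul_of_summable_norm s3 s4).hasSum using 1
    ext ⟨i, j⟩
    simp only [parityEquiv, Function.comp_apply, Equiv.coe_fn_mk, Sum.elim_inl, thetaTerm,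
      ← exp_add]
    push_cast
    ring_nf
  · convert (summable_mul_of_summable_norm s5 s6).hasSum using 1
    ext ⟨i, j⟩
    simp only [parityEquiv, Function.comp_apply, Equiv.coe_fn_mk, Sum.elim_inr, thetaTerm,
      ← exp_add]
    push_cast
    ring_nf

/-! ### The four theta functions and the doubling of the modulus -/

/-- The `k`-th `z`-derivative of `theta1`. -/
noncomputable def theta1D (k : ℕ) (z τ : ℂ) : ℂ := -thetaD k 1 1 z τ
/-- The `k`-th `z`-derivative of `theta2`. -/
noncomputable def theta2D (k : ℕ) (z τ : ℂ) : ℂ := thetaD k 1 0 z τ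
/-- The `k`-th `z`-derivative of `theta3`. -/
noncomputable def theta3D (k : ℕ) (z τ : ℂ) : ℂ := thetaD k 0 0 z τ
/-- The `k`-th `z`-derivative of `theta4`. -/
noncomputable def theta4D (k : ℕ) (z τ : ℂ) : ℂ := thetaD k 0 1 z τ

lemma theta1_eq (z τ : ℂ) : theta1 z τ = theta1D 0 z τ := by
  rw [theta1, theta1D, thetaChar_eq_thetaD]
lemma theta2_eq (z τ : ℂ) : theta2 z τ = theta2D 0 z τ := thetaChar_eq_thetaD _ _ _ _
lemma theta3_eq (z τ : ℂ) : theta3 z τ = theta3D 0 z τ := thetaChar_eq_thetaD _ _ _ _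
lemma theta4_eq (z τ : ℂ) : theta4 z τ = theta4D 0 z τ := thetaChar_eq_thetaD _ _ _ _

lemma dtheta1_eq (z τ : ℂ) : dtheta1 z τ = theta1D 1 z τ := by
  rw [dtheta1, theta1D, thetaD, ← tsum_neg, ← tsum_mul_left]
  refine tsum_congr fun n => ?_
  have h1 : thetaTerm 1 1 z τ n = cexp (Real.pi * I * τ / 4)
      * cexp (((n : ℂ) ^ 2 + n) * Real.pi * I * τ) * cexp ((2 * (n : ℂ) + 1) * Real.pi * I * z)
      * (I * (-1) ^ n) := by
    have hI : I * (-1 : ℂ) ^ n = cexp (Real.pi / 2 * I + n * (Real.pi * I)) := by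
      rw [exp_add, exp_int_mul, exp_pi_mul_I, exp_pi_div_two_mul_I]
    rw [hI, ← exp_add, ← exp_add, ← exp_add, thetaTerm]
    push_cast
    ring_nf
  rw [h1]
  push_cast
  linear_combination (Real.pi * (2 * n + 1) * (cexp (Real.pi * I * τ / 4)
      * cexp (((n : ℂ) ^ 2 + n) * Real.pi * I * τ) * cexp ((2 * (n : ℂ) + 1) * Real.pi * I * z)
      * (-1) ^ n)) * I_sq

section parity
variable (k : ℕ) (z τ : ℂ)
lemma theta1D_neg : theta1D k (-z) τ = (-1) ^ (k + 1) * theta1D k z τ := by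
  simp only [theta1D, thetaD_neg, pow_succ]; norm_num
lemma theta2D_neg : theta2D k (-z) τ = (-1) ^ k * theta2D k z τ := by
  simp only [theta2D, thetaD_neg]; norm_num
lemma theta3D_neg : theta3D k (-z) τ = (-1) ^ k * theta3D k z τ := by
  simp only [theta3D, thetaD_neg]; norm_num
lemma theta4D_neg : theta4D k (-z) τ = (-1) ^ k * theta4D k z τ := by
  simp only [theta4D, thetaD_neg]; norm_num
lemma theta1D_zero_zero : theta1D 0 0 τ = 0 := by
  have := theta1D_neg 0 0 τ
  simp only [neg_zero, zero_add, pow_one, neg_mul, one_mul] at this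
  exact self_eq_neg.mp this
lemma theta2D_one_zero : theta2D 1 0 τ = 0 := by
  have := theta2D_neg 1 0 τ
  simp only [neg_zero, pow_one, neg_mul, one_mul] at this
  exact self_eq_neg.mp this
lemma theta3D_one_zero : theta3D 1 0 τ = 0 := by
  have := theta3D_neg 1 0 τ
  simp only [neg_zero, pow_one, neg_mul, one_mul] at this
  exact self_eq_neg.mp this
lemma theta4D_one_zero : theta4D 1 0 τ = 0 := by
  have := theta4D_neg 1 0 τ
  simp only [neg_zero, pow_one, neg_mul, one_mul] at this
  exact self_eq_neg.mp this
lemma theta1D_add_one : theta1D k (z + 1) τ = -theta1D k z τ := by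
  simp [theta1D, thetaD_add_one]
lemma theta2D_add_one : theta2D k (z + 1) τ = -theta2D k z τ := by
  simp [theta2D, thetaD_add_one]
lemma theta1D_add_half : theta1D k (z + 1 / 2) τ = theta2D k z τ := by
  rw [theta1D, theta2D, ← thetaD_add_one_right, show (1 : ℤ) + 1 = 0 + 2 by norm_num,
    thetaD_add_two_right]
  simp
lemma theta3D_add_half : theta3D k (z + 1 / 2) τ = theta4D k z τ := by
  rw [theta3D, theta4D, ← thetaD_add_one_right, zero_add]
lemma theta4D_add_half : theta4D k (z + 1 / 2) τ = theta3D k z τ := by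
  rw [theta3D, theta4D, ← thetaD_add_one_right, show (1 : ℤ) + 1 = 0 + 2 by norm_num,
    thetaD_add_two_right]
  simp
lemma theta1D_zero_add_tau : theta1D 0 (z + τ) τ =
    -cexp (-Real.pi * I * τ - 2 * Real.pi * I * z) * theta1D 0 z τ := by
  rw [theta1D, thetaD_zero_add_tau, theta1D, ← mul_neg]
  congr 1
  rw [← exp_add_pi_mul_I, exp_eq_exp_iff_exists_int]
  exact ⟨-1, by push_cast; ring⟩
lemma theta2D_zero_add_tau : theta2D 0 (z + τ) τ =
    cexp (-Real.pi * I * τ - 2 * Real.pi * I * z) * theta2D 0 z τ := by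
  rw [theta2D, thetaD_zero_add_tau, theta2D]
  simp
end parity

section doubling
variable (z w : ℂ) {τ : ℂ} (hτ : 0 < τ.im)
include hτ

lemma theta1D_mul_theta2D : theta1D 0 (z + w) τ * theta2D 0 (z - w) τ =
    theta1D 0 (2 * z) (2 * τ) * theta4D 0 (2 * w) (2 * τ)
    + theta4D 0 (2 * z) (2 * τ) * theta1D 0 (2 * w) (2 * τ) := by
  have h := thetaD_mul 1 1 0 z w hτ
  rw [show (1 : ℤ) + 1 = 0 + 2 by norm_num, thetaD_add_two_left] at h
  norm_num at h
  simp only [theta1D, theta2D, theta4D]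
  linear_combination -h

lemma theta3D_mul_theta4D : theta3D 0 (z + w) τ * theta4D 0 (z - w) τ =
    theta4D 0 (2 * z) (2 * τ) * theta4D 0 (2 * w) (2 * τ)
    - theta1D 0 (2 * z) (2 * τ) * theta1D 0 (2 * w) (2 * τ) := by
  have h := thetaD_mul 0 0 1 z w hτ
  have h1 := thetaD_add_two_right 0 0 (-1) (2 * w) (2 * τ)
  have h2 := thetaD_add_two_right 0 1 (-1) (2 * w) (2 * τ)
  norm_num at h h1 h2
  simp only [theta1D, theta3D, theta4D]
  rw [h, h1, h2]
  ring

lemma theta1D_mul_theta1D : theta1D 0 (z + w) τ * theta1D 0 (z - w) τ =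
    theta3D 0 (2 * z) (2 * τ) * theta2D 0 (2 * w) (2 * τ)
    - theta2D 0 (2 * z) (2 * τ) * theta3D 0 (2 * w) (2 * τ) := by
  have h := thetaD_mul 1 1 1 z w hτ
  have h1 := thetaD_add_two_right 0 1 0 (2 * z) (2 * τ)
  have h2 := thetaD_add_two_right 0 0 0 (2 * z) (2 * τ)
  have h3 := thetaD_add_two_left 0 0 2 (2 * z) (2 * τ)
  norm_num at h h1 h2 h3
  simp only [theta1D, theta2D, theta3D]
  rw [neg_mul_neg, h, h1, h3, h2]
  ring

lemma theta2D_mul_theta2D : theta2D 0 (z + w) τ * theta2D 0 (z - w) τ =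
    theta3D 0 (2 * z) (2 * τ) * theta2D 0 (2 * w) (2 * τ)
    + theta2D 0 (2 * z) (2 * τ) * theta3D 0 (2 * w) (2 * τ) := by
  have h := thetaD_mul 1 0 0 z w hτ
  have h3 := thetaD_add_two_left 0 0 0 (2 * z) (2 * τ)
  norm_num at h h3
  simp only [theta2D, theta3D]
  rw [h, h3]
  ring

lemma theta3D_mul_theta3D : theta3D 0 (z + w) τ * theta3D 0 (z - w) τ =
    theta3D 0 (2 * z) (2 * τ) * theta3D 0 (2 * w) (2 * τ)
    + theta2D 0 (2 * z) (2 * τ) * theta2D 0 (2 * w) (2 * τ) := by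
  have h := thetaD_mul 0 0 0 z w hτ
  norm_num at h
  exact h

lemma theta4D_mul_theta4D : theta4D 0 (z + w) τ * theta4D 0 (z - w) τ =
    theta3D 0 (2 * z) (2 * τ) * theta3D 0 (2 * w) (2 * τ)
    - theta2D 0 (2 * z) (2 * τ) * theta2D 0 (2 * w) (2 * τ) := by
  have h := thetaD_mul 0 1 1 z w hτ
  have h1 := thetaD_add_two_right 0 1 0 (2 * z) (2 * τ)
  have h2 := thetaD_add_two_right 0 0 0 (2 * z) (2 * τ)
  norm_num at h h1 h2
  simp only [theta2D, theta3D, theta4D]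
  rw [h, h1, h2]
  ring

omit hτ in
lemma theta1D_sq (hτ : 0 < τ.im) : theta1D 0 z τ ^ 2 =
    theta3D 0 (2 * z) (2 * τ) * theta2D 0 0 (2 * τ)
    - theta2D 0 (2 * z) (2 * τ) * theta3D 0 0 (2 * τ) := by
  simpa [sq] using theta1D_mul_theta1D z 0 hτ
lemma theta2D_sq : theta2D 0 z τ ^ 2 =
    theta3D 0 (2 * z) (2 * τ) * theta2D 0 0 (2 * τ)
    + theta2D 0 (2 * z) (2 * τ) * theta3D 0 0 (2 * τ) := by
  simpa [sq] using theta2D_mul_theta2D z 0 hτ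
lemma theta3D_sq : theta3D 0 z τ ^ 2 =
    theta3D 0 (2 * z) (2 * τ) * theta3D 0 0 (2 * τ)
    + theta2D 0 (2 * z) (2 * τ) * theta2D 0 0 (2 * τ) := by
  simpa [sq] using theta3D_mul_theta3D z 0 hτ
lemma theta4D_sq : theta4D 0 z τ ^ 2 =
    theta3D 0 (2 * z) (2 * τ) * theta3D 0 0 (2 * τ)
    - theta2D 0 (2 * z) (2 * τ) * theta2D 0 0 (2 * τ) := by
  simpa [sq] using theta4D_mul_theta4D z 0 hτ
lemma theta2D_zero_sq : theta2D 0 0 τ ^ 2 =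
    2 * theta2D 0 0 (2 * τ) * theta3D 0 0 (2 * τ) := by
  have := theta2D_sq 0 hτ
  rw [mul_zero] at this
  rw [this]; ring
lemma theta3D_zero_sq : theta3D 0 0 τ ^ 2 =
    theta3D 0 0 (2 * τ) ^ 2 + theta2D 0 0 (2 * τ) ^ 2 := by
  have := theta3D_sq 0 hτ
  rw [mul_zero] at this
  rw [this]; ring
lemma theta4D_zero_sq : theta4D 0 0 τ ^ 2 =
    theta3D 0 0 (2 * τ) ^ 2 - theta2D 0 0 (2 * τ) ^ 2 := by
  have := theta4D_sq 0 hτ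
  rw [mul_zero] at this
  rw [this]; ring
lemma theta1D_mul_theta2D_self : theta1D 0 z τ * theta2D 0 z τ =
    theta1D 0 (2 * z) (2 * τ) * theta4D 0 0 (2 * τ) := by
  simpa [theta1D_zero_zero] using theta1D_mul_theta2D z 0 hτ
lemma theta3D_mul_theta4D_self : theta3D 0 z τ * theta4D 0 z τ =
    theta4D 0 (2 * z) (2 * τ) * theta4D 0 0 (2 * τ) := by
  simpa [theta1D_zero_zero] using theta3D_mul_theta4D z 0 hτ

/-! ### Relations between the squares, addition formulas -/

/-- With `theta3D_sq_relation`, the linear relations between the squares of the theta functions; they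
follow by expressing all squares through theta functions of modulus `2τ`. -/
lemma theta4D_sq_relation :
    theta2D 0 0 τ ^ 2 * theta4D 0 z τ ^ 2 - theta4D 0 0 τ ^ 2 * theta2D 0 z τ ^ 2
      = theta3D 0 0 τ ^ 2 * theta1D 0 z τ ^ 2 := by
  rw [theta2D_zero_sq hτ, theta3D_zero_sq hτ, theta4D_zero_sq hτ, theta1D_sq z hτ, theta2D_sq z hτ,
    theta4D_sq z hτ]
  ring
lemma theta3D_sq_relation :
    theta2D 0 0 τ ^ 2 * theta3D 0 z τ ^ 2 - theta3D 0 0 τ ^ 2 * theta2D 0 z τ ^ 2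
      = theta4D 0 0 τ ^ 2 * theta1D 0 z τ ^ 2 := by
  rw [theta2D_zero_sq hτ, theta3D_zero_sq hτ, theta4D_zero_sq hτ, theta1D_sq z hτ, theta2D_sq z hτ,
    theta3D_sq z hτ]
  ring
lemma jacobi_quartic :
    theta3D 0 0 τ ^ 4 = theta2D 0 0 τ ^ 4 + theta4D 0 0 τ ^ 4 := by
  linear_combination (theta3D 0 0 τ ^ 2 + theta3D 0 0 (2 * τ) ^ 2 + theta2D 0 0 (2 * τ) ^ 2)
    * theta3D_zero_sq hτ
    - (theta4D 0 0 τ ^ 2 + theta3D 0 0 (2 * τ) ^ 2 - theta2D 0 0 (2 * τ) ^ 2) * theta4D_zero_sq hτ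
    - (theta2D 0 0 τ ^ 2 + 2 * theta2D 0 0 (2 * τ) * theta3D 0 0 (2 * τ)) * theta2D_zero_sq hτ

lemma theta1D_addition_theta2D :
    theta1D 0 (z + w) τ * theta1D 0 (z - w) τ * theta2D 0 0 τ ^ 2
      = theta1D 0 z τ ^ 2 * theta2D 0 w τ ^ 2 - theta2D 0 z τ ^ 2 * theta1D 0 w τ ^ 2 := by
  rw [theta1D_mul_theta1D z w hτ, theta2D_zero_sq hτ, theta1D_sq z hτ, theta1D_sq w hτ,
    theta2D_sq z hτ, theta2D_sq w hτ]
  ring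
lemma theta1D_addition_theta3D :
    theta1D 0 (z + w) τ * theta1D 0 (z - w) τ * theta3D 0 0 τ ^ 2
      = theta1D 0 z τ ^ 2 * theta3D 0 w τ ^ 2 - theta3D 0 z τ ^ 2 * theta1D 0 w τ ^ 2 := by
  rw [theta1D_mul_theta1D z w hτ, theta3D_zero_sq hτ, theta1D_sq z hτ, theta1D_sq w hτ,
    theta3D_sq z hτ, theta3D_sq w hτ]
  ring
lemma theta1D_addition_theta4D :
    theta1D 0 (z + w) τ * theta1D 0 (z - w) τ * theta4D 0 0 τ ^ 2
      = theta1D 0 z τ ^ 2 * theta4D 0 w τ ^ 2 - theta4D 0 z τ ^ 2 * theta1D 0 w τ ^ 2 := by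
  rw [theta1D_mul_theta1D z w hτ, theta4D_zero_sq hτ, theta1D_sq z hτ, theta1D_sq w hτ,
    theta4D_sq z hτ, theta4D_sq w hτ]
  ring
end doubling

section derivatives
variable (k : ℕ) (z : ℂ) {τ : ℂ} (hτ : 0 < τ.im)
include hτ
lemma hasDerivAt_theta1D : HasDerivAt (fun z => theta1D k z τ) (theta1D (k + 1) z τ) z :=
  (hasDerivAt_thetaD_fst k 1 1 z hτ).neg
lemma hasDerivAt_theta2D : HasDerivAt (fun z => theta2D k z τ) (theta2D (k + 1) z τ) z :=
  hasDerivAt_thetaD_fst k 1 0 z hτ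
lemma hasDerivAt_theta3D : HasDerivAt (fun z => theta3D k z τ) (theta3D (k + 1) z τ) z :=
  hasDerivAt_thetaD_fst k 0 0 z hτ
lemma hasDerivAt_theta4D : HasDerivAt (fun z => theta4D k z τ) (theta4D (k + 1) z τ) z :=
  hasDerivAt_thetaD_fst k 0 1 z hτ
end derivatives

/-! ### Limits along `τ, 2τ, 4τ, …` and nonvanishing of the theta constants -/

/-- As `N → ∞`, only the terms with `e n = 0` survive in `∑ c(n) exp (πi e(n) 2^N τ)`. -/
lemma tendsto_tsum_exp_two_pow (c : ℤ → ℂ) (e : ℤ → ℤ) (he : ∀ n, 0 ≤ e n) {τ : ℂ}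
    (hτ : 0 < τ.im) (hs : Summable fun n => ‖c n * cexp (e n * Real.pi * I * τ)‖) :
    Tendsto (fun N : ℕ => ∑' n, c n * cexp (e n * Real.pi * I * (2 ^ N * τ))) atTop
      (𝓝 (∑' n, if e n = 0 then c n else 0)) := by
  have hnorm : ∀ (n : ℤ) (N : ℕ), ‖cexp (e n * Real.pi * I * (2 ^ N * τ))‖
      = Real.exp (-(e n * Real.pi * τ.im * 2 ^ N)) := by
    intro n N
    rw [Complex.norm_exp, show (e n * Real.pi * I * (2 ^ N * τ) : ℂ)
      = ((e n * Real.pi * 2 ^ N : ℝ) : ℂ) * τ * I by push_cast; ring, mul_I_re, im_ofReal_mul]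
    ring_nf
  refine tendsto_tsum_of_dominated_convergence hs (fun n => ?_) (Eventually.of_forall fun N n => ?_)
  · by_cases h : e n = 0
    · simp [h]
    · rw [if_neg h]
      have h1 : 0 < (e n : ℝ) := by
        exact_mod_cast lt_of_le_of_ne (he n) (Ne.symm h)
      have h2 : 0 < e n * Real.pi * τ.im := by have := Real.pi_pos; positivity
      rw [tendsto_zero_iff_norm_tendsto_zero]
      simp only [norm_mul, hnorm]
      rw [← mul_zero ‖c n‖]
      refine Tendsto.const_mul _ (Real.tendsto_exp_neg_atTop_nhds_zero.comp ?_)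
      exact (tendsto_pow_atTop_atTop_of_one_lt one_lt_two).const_mul_atTop h2
  · have h0 := hnorm n 0
    simp only [pow_zero, one_mul, mul_one] at h0
    rw [norm_mul, norm_mul, hnorm, h0]
    refine mul_le_mul_of_nonneg_left (Real.exp_le_exp.mpr (neg_le_neg ?_)) (norm_nonneg _)
    have h1 : 0 ≤ (e n : ℝ) := by exact_mod_cast he n
    have h2 : 0 ≤ e n * Real.pi * τ.im := by have := Real.pi_pos; positivity
    have h3 : (1 : ℝ) ≤ 2 ^ N := one_le_pow₀ one_le_two
    nlinarith

lemma two_pow_mul_im_pos (N : ℕ) {τ : ℂ} (hτ : 0 < τ.im) : 0 < (2 ^ N * τ).im := by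
  rw [show (2 ^ N * τ : ℂ) = ((2 ^ N : ℝ) : ℂ) * τ by push_cast; rfl, im_ofReal_mul]
  positivity

lemma int_mul_add_one_eq_zero (n : ℤ) : n ^ 2 + n = 0 ↔ n ∈ ({0, -1} : Finset ℤ) := by
  rw [show n ^ 2 + n = n * (n + 1) by ring, mul_eq_zero]
  simp [eq_neg_iff_add_eq_zero]

section limits
variable {τ : ℂ} (hτ : 0 < τ.im)
include hτ

lemma tendsto_theta3D_zero : Tendsto (fun N : ℕ => theta3D 0 0 (2 ^ N * τ)) atTop (𝓝 1) := by
  have h := tendsto_tsum_exp_two_pow (fun _ => 1) (fun n => n ^ 2) (fun n => sq_nonneg n) hτ ?_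
  · rw [tsum_eq_single 0 (by simp +contextual)] at h
    refine Tendsto.congr (fun N => ?_) (by simpa using h)
    rw [theta3D, thetaD]
    refine tsum_congr fun n => ?_
    simp only [thetaTerm]
    push_cast
    ring_nf
  · refine (summable_norm_thetaTerm 0 0 0 hτ).congr fun n => ?_
    simp only [thetaTerm]
    push_cast
    ring_nf

lemma tendsto_theta4D_zero : Tendsto (fun N : ℕ => theta4D 0 0 (2 ^ N * τ)) atTop (𝓝 1) := by
  have h4 : ∀ (σ : ℂ) (n : ℤ), thetaTerm 0 1 0 σ n
      = (-1) ^ n * cexp (((n ^ 2 : ℤ) : ℂ) * Real.pi * I * σ) := by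
    intro σ n
    rw [← exp_pi_mul_I, ← exp_int_mul, ← exp_add, thetaTerm]
    push_cast
    ring_nf
  have h := tendsto_tsum_exp_two_pow (fun n => (-1) ^ n) (fun n => n ^ 2)
    (fun n => sq_nonneg n) hτ ?_
  · rw [tsum_eq_single 0 (by simp +contextual)] at h
    refine Tendsto.congr (fun N => ?_) (by simpa using h)
    simp only [theta4D, thetaD, pow_zero, one_mul, h4]
    push_cast
    rfl
  · simpa only [h4] using summable_norm_thetaTerm 0 1 0 hτ

lemma tendsto_theta2D_zero : Tendsto (fun N : ℕ => theta2D 0 0 (2 ^ N * τ) /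
    cexp (Real.pi * I * (2 ^ N * τ) / 4)) atTop (𝓝 2) := by
  have h4 : ∀ (σ : ℂ) (n : ℤ), thetaTerm 1 0 0 σ n
      = cexp (Real.pi * I * σ / 4) * cexp (((n ^ 2 + n : ℤ) : ℂ) * Real.pi * I * σ) := by
    intro σ n
    rw [← exp_add, thetaTerm]
    push_cast
    ring_nf
  have h := tendsto_tsum_exp_two_pow (fun n => 1) (fun n => n ^ 2 + n)
    (fun n => by rcases le_or_gt 0 n with h | h <;> nlinarith) hτ ?_
  · simp only [int_mul_add_one_eq_zero] at h
    rw [tsum_eq_sum (s := {0, -1}) (fun b hb => if_neg hb), Finset.sum_pair (by norm_num)] at h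
    refine Tendsto.congr (fun N => ?_) (le_trans h (le_of_eq (congrArg 𝓝
      (show _ = (2 : ℂ) by norm_num))))
    simp only [theta2D, thetaD, pow_zero, one_mul, h4, tsum_mul_left]
    rw [mul_div_cancel_left₀ _ (exp_ne_zero _)]
  · have := (summable_norm_thetaTerm 1 0 0 hτ).mul_left ‖cexp (Real.pi * I * τ / 4)‖⁻¹
    refine this.congr fun n => ?_
    rw [h4, norm_mul, inv_mul_cancel_left₀ (norm_ne_zero_iff.mpr (exp_ne_zero _)), one_mul]

lemma tendsto_theta1D_one_zero : Tendsto (fun N : ℕ => theta1D 1 0 (2 ^ N * τ) /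
    cexp (Real.pi * I * (2 ^ N * τ) / 4)) atTop (𝓝 (2 * Real.pi)) := by
  have hπ : (Real.pi : ℂ) ≠ 0 := by exact_mod_cast Real.pi_ne_zero
  have h := tendsto_tsum_exp_two_pow (fun n => (-1) ^ n * (2 * (n : ℂ) + 1)) (fun n => n ^ 2 + n)
    (fun n => by rcases le_or_gt 0 n with h | h <;> nlinarith) hτ ?_
  · simp only [int_mul_add_one_eq_zero] at h
    rw [tsum_eq_sum (s := {0, -1}) (fun b hb => if_neg hb), Finset.sum_pair (by norm_num)] at h
    refine Tendsto.congr (fun N => ?_) (le_trans (h.const_mul (Real.pi : ℂ))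
      (le_of_eq (congrArg 𝓝 (show _ = (2 * Real.pi : ℂ) by norm_num [mul_comm]))))
    rw [← dtheta1_eq, dtheta1]
    simp only [mul_zero, exp_zero, mul_one]
    rw [mul_assoc, mul_div_assoc, mul_div_cancel_left₀ _ (exp_ne_zero _)]
    push_cast
    rfl
  · have := (summable_norm_thetaD_term 1 1 1 0 hτ).mul_left
      (‖cexp (Real.pi * I * τ / 4)‖⁻¹ * Real.pi⁻¹)
    refine this.congr fun n => ?_
    have h1 : thetaTerm 1 1 0 τ n = cexp (Real.pi * I * τ / 4)
        * cexp (((n ^ 2 + n : ℤ) : ℂ) * Real.pi * I * τ) * (I * (-1) ^ n) := by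
      have hI : I * (-1 : ℂ) ^ n = cexp (Real.pi / 2 * I + n * (Real.pi * I)) := by
        rw [exp_add, exp_int_mul, exp_pi_mul_I, exp_pi_div_two_mul_I]
      rw [hI, ← exp_add, ← exp_add, thetaTerm]
      push_cast
      ring_nf
    have h2 : (2 * Real.pi * I * ((n : ℂ) + (1 : ℤ) / 2)) ^ 1 = Real.pi * I * (2 * n + 1) := by
      push_cast; ring
    have h3 : ‖cexp (Real.pi * I * τ / 4)‖ ≠ 0 := norm_ne_zero_iff.mpr (exp_ne_zero _)
    have h5 := Real.pi_pos
    rw [h1, h2]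
    simp only [norm_mul, norm_I, norm_real, Real.norm_of_nonneg h5.le]
    field_simp

lemma theta4D_zero_two_mul_eq (h : theta3D 0 0 τ * theta4D 0 0 τ = 0) :
    theta4D 0 0 (2 * τ) = 0 := by
  have := theta3D_mul_theta4D_self 0 hτ
  rw [h, mul_zero] at this
  exact mul_self_eq_zero.mp this.symm

/-- As `ϑ₃(τ) ϑ₄(τ) = ϑ₄(2τ)²`, a zero at `τ` would propagate to all `2^N τ`. -/
lemma theta3D_mul_theta4D_zero_ne_zero : theta3D 0 0 τ * theta4D 0 0 τ ≠ 0 := by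
  intro h
  have h1 : ∀ N : ℕ, theta4D 0 0 (2 ^ (N + 1) * τ) = 0 := by
    intro N
    induction N with
    | zero => simpa using theta4D_zero_two_mul_eq hτ h
    | succ N ih =>
      rw [pow_succ', mul_assoc]
      exact theta4D_zero_two_mul_eq (two_pow_mul_im_pos _ hτ) (by rw [ih, mul_zero])
  have h2 := (tendsto_theta4D_zero hτ).comp (tendsto_add_atTop_nat 1)
  simp only [Function.comp_def, h1] at h2
  exact zero_ne_one (tendsto_nhds_unique tendsto_const_nhds h2)

lemma theta3D_zero_ne_zero : theta3D 0 0 τ ≠ 0 :=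
  left_ne_zero_of_mul (theta3D_mul_theta4D_zero_ne_zero hτ)

lemma theta4D_zero_ne_zero : theta4D 0 0 τ ≠ 0 :=
  right_ne_zero_of_mul (theta3D_mul_theta4D_zero_ne_zero hτ)

lemma theta2D_zero_ne_zero : theta2D 0 0 τ ≠ 0 := by
  intro h
  have h1 : ∀ N : ℕ, theta2D 0 0 (2 ^ N * τ) = 0 := by
    intro N
    induction N with
    | zero => simpa using h
    | succ N ih =>
      have h2 := theta2D_zero_sq (two_pow_mul_im_pos N hτ)
      rw [← mul_assoc, ← pow_succ'] at h2
      have h3 := theta3D_zero_ne_zero (two_pow_mul_im_pos (N + 1) hτ)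
      rw [ih] at h2
      simpa [h3] using h2.symm
  have h2 := tendsto_theta2D_zero hτ
  simp only [h1, zero_div] at h2
  exact two_ne_zero (tendsto_nhds_unique h2 tendsto_const_nhds)

/-! ### Jacobi's derivative formula and the Wronskians of the theta functions -/

/-- The Wronskian of `θ₁` and `θ₂`, up to the evaluation of the constant. -/
lemma theta12_wronskian_aux (z : ℂ) :
    (theta1D 1 z τ * theta2D 0 z τ - theta1D 0 z τ * theta2D 1 z τ) * theta4D 0 0 (2 * τ)
      = 2 * theta1D 1 0 (2 * τ) * (theta3D 0 z τ * theta4D 0 z τ) := by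
  have hτ2 : 0 < (2 * τ).im := by simpa using hτ
  have e1 : HasDerivAt (fun w => theta1D 0 (z + w) τ * theta2D 0 (z - w) τ)
      (theta1D 1 z τ * theta2D 0 z τ - theta1D 0 z τ * theta2D 1 z τ) 0 := by
    have h1 := (hasDerivAt_theta1D 0 (z + 0) hτ).comp_const_add z 0
    have h2 : HasDerivAt (fun w => theta2D 0 (z - w) τ) _ (0 : ℂ) :=
      (hasDerivAt_theta2D 0 (z - 0) hτ).comp_const_sub z 0
    refine (h1.mul h2).congr_deriv ?_
    simp only [add_zero, sub_zero]
    ring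
  have e2 : HasDerivAt (fun w => theta1D 0 (2 * z) (2 * τ) * theta4D 0 (2 * w) (2 * τ)
      + theta4D 0 (2 * z) (2 * τ) * theta1D 0 (2 * w) (2 * τ))
      (theta4D 0 (2 * z) (2 * τ) * (2 * theta1D 1 0 (2 * τ))) 0 := by
    have h1 := HasDerivAt.scomp (0 : ℂ) (hasDerivAt_theta4D 0 (2 * 0) hτ2)
      ((hasDerivAt_id (0 : ℂ)).const_mul 2)
    have h2 := HasDerivAt.scomp (0 : ℂ) (hasDerivAt_theta1D 0 (2 * 0) hτ2)
      ((hasDerivAt_id (0 : ℂ)).const_mul 2)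
    refine ((h1.const_mul (theta1D 0 (2 * z) (2 * τ))).add
      (h2.const_mul (theta4D 0 (2 * z) (2 * τ)))).congr_deriv ?_
    simp only [mul_zero, zero_add, theta4D_one_zero, smul_eq_mul]
    ring
  simp only [← theta1D_mul_theta2D z _ hτ] at e2
  rw [e1.unique e2, theta3D_mul_theta4D_self z hτ]
  ring

lemma theta1D_one_zero_two_mul :
    theta1D 1 0 (2 * τ) / (theta2D 0 0 (2 * τ) * theta3D 0 0 (2 * τ) * theta4D 0 0 (2 * τ))
      = theta1D 1 0 τ / (theta2D 0 0 τ * theta3D 0 0 τ * theta4D 0 0 τ) := by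
  have hτ2 : 0 < (2 * τ).im := by simpa using hτ
  have a2 := theta2D_zero_ne_zero hτ
  have a3 := theta3D_zero_ne_zero hτ
  have a4 := theta4D_zero_ne_zero hτ
  have b2 := theta2D_zero_ne_zero hτ2
  have b3 := theta3D_zero_ne_zero hτ2
  have b4 := theta4D_zero_ne_zero hτ2
  have h := theta12_wronskian_aux hτ 0
  rw [theta1D_zero_zero, zero_mul, sub_zero] at h
  rw [div_eq_div_iff (by positivity) (by positivity)]
  have h2 := theta2D_zero_sq hτ
  linear_combination (-(1 / 2) * theta2D 0 0 τ) * h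
    + (1 / 2) * theta1D 1 0 τ * theta4D 0 0 (2 * τ) * h2

/-- Jacobi's derivative formula. Both sides have the same behaviour under `τ ↦ 2τ`, so their
ratio is its limit at `i∞`. -/
lemma jacobi_derivative :
    theta1D 1 0 τ = Real.pi * (theta2D 0 0 τ * theta3D 0 0 τ * theta4D 0 0 τ) := by
  have h0 : ∀ N : ℕ, theta1D 1 0 (2 ^ N * τ) /
      (theta2D 0 0 (2 ^ N * τ) * theta3D 0 0 (2 ^ N * τ) * theta4D 0 0 (2 ^ N * τ))
      = theta1D 1 0 τ / (theta2D 0 0 τ * theta3D 0 0 τ * theta4D 0 0 τ) := by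
    intro N
    induction N with
    | zero => simp
    | succ N ih =>
      rw [← ih, ← theta1D_one_zero_two_mul (two_pow_mul_im_pos N hτ), ← mul_assoc, ← pow_succ']
  have h1 := (tendsto_theta1D_one_zero hτ).div (((tendsto_theta2D_zero hτ).mul
    (tendsto_theta3D_zero hτ)).mul (tendsto_theta4D_zero hτ)) (by norm_num)
  have h2 : (fun N : ℕ => theta1D 1 0 τ / (theta2D 0 0 τ * theta3D 0 0 τ * theta4D 0 0 τ)) =
      fun N : ℕ => (theta1D 1 0 (2 ^ N * τ) / cexp (Real.pi * I * (2 ^ N * τ) / 4)) /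
        (theta2D 0 0 (2 ^ N * τ) / cexp (Real.pi * I * (2 ^ N * τ) / 4) * theta3D 0 0 (2 ^ N * τ)
          * theta4D 0 0 (2 ^ N * τ)) := by
    ext N
    rw [← h0 N]
    have b2 := theta2D_zero_ne_zero (two_pow_mul_im_pos N hτ)
    have b3 := theta3D_zero_ne_zero (two_pow_mul_im_pos N hτ)
    have b4 := theta4D_zero_ne_zero (two_pow_mul_im_pos N hτ)
    field_simp
  have h3 := tendsto_nhds_unique (tendsto_const_nhds.congr (fun N => congrFun h2 N)) h1
  have a2 := theta2D_zero_ne_zero hτ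
  have a3 := theta3D_zero_ne_zero hτ
  have a4 := theta4D_zero_ne_zero hτ
  rw [div_eq_iff (by positivity)] at h3
  rw [h3]
  ring

lemma theta12_wronskian (z : ℂ) :
    theta2D 1 z τ * theta1D 0 z τ - theta2D 0 z τ * theta1D 1 z τ
      = -Real.pi * theta2D 0 0 τ ^ 2 * (theta3D 0 z τ * theta4D 0 z τ) := by
  have hτ2 : 0 < (2 * τ).im := by simpa using hτ
  have h := theta12_wronskian_aux hτ z
  rw [jacobi_derivative hτ2] at h
  have b4 := theta4D_zero_ne_zero hτ2
  refine mul_right_cancel₀ b4 ?_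
  rw [theta2D_zero_sq hτ]
  linear_combination -h

/-- Obtained from `theta12_wronskian` by differentiating the relation between the squares, which
introduces the factor `θ₄(z)`. -/
lemma theta14_wronskian {z : ℂ} (hz : theta4D 0 z τ ≠ 0) :
    theta4D 1 z τ * theta1D 0 z τ - theta4D 0 z τ * theta1D 1 z τ
      = -Real.pi * theta4D 0 0 τ ^ 2 * (theta2D 0 z τ * theta3D 0 z τ) := by
  have e1 := ((((hasDerivAt_theta4D 0 z hτ).pow 2).const_mul (theta2D 0 0 τ ^ 2)).sub
    (((hasDerivAt_theta2D 0 z hτ).pow 2).const_mul (theta4D 0 0 τ ^ 2))).sub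
    (((hasDerivAt_theta1D 0 z hτ).pow 2).const_mul (theta3D 0 0 τ ^ 2))
  have e2 := e1.unique ((hasDerivAt_const z (0 : ℂ)).congr_of_eventuallyEq
    (Eventually.of_forall fun z => by
      simp only [Pi.sub_apply, Pi.pow_apply]
      rw [theta4D_sq_relation z hτ, sub_self]))
  have a2 := theta2D_zero_ne_zero hτ
  have h12 := theta12_wronskian hτ z
  have hr := theta4D_sq_relation z hτ
  norm_num at e2
  refine mul_left_cancel₀ (mul_ne_zero (pow_ne_zero 2 a2) hz) ?_
  linear_combination (1 / 2 * theta1D 0 z τ) * e2 + theta4D 0 0 τ ^ 2 * theta2D 0 z τ * h12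
    - theta1D 1 z τ * hr

lemma theta13_wronskian {z : ℂ} (hz : theta3D 0 z τ ≠ 0) :
    theta3D 1 z τ * theta1D 0 z τ - theta3D 0 z τ * theta1D 1 z τ
      = -Real.pi * theta3D 0 0 τ ^ 2 * (theta2D 0 z τ * theta4D 0 z τ) := by
  have e1 := ((((hasDerivAt_theta3D 0 z hτ).pow 2).const_mul (theta2D 0 0 τ ^ 2)).sub
    (((hasDerivAt_theta2D 0 z hτ).pow 2).const_mul (theta3D 0 0 τ ^ 2))).sub
    (((hasDerivAt_theta1D 0 z hτ).pow 2).const_mul (theta4D 0 0 τ ^ 2))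
  have e2 := e1.unique ((hasDerivAt_const z (0 : ℂ)).congr_of_eventuallyEq
    (Eventually.of_forall fun z => by
      simp only [Pi.sub_apply, Pi.pow_apply]
      rw [theta3D_sq_relation z hτ, sub_self]))
  have a2 := theta2D_zero_ne_zero hτ
  have h12 := theta12_wronskian hτ z
  have hr := theta3D_sq_relation z hτ
  norm_num at e2
  refine mul_left_cancel₀ (mul_ne_zero (pow_ne_zero 2 a2) hz) ?_
  linear_combination (1 / 2 * theta1D 0 z τ) * e2 + theta3D 0 0 τ ^ 2 * theta2D 0 z τ * h12
    - theta1D 1 z τ * hr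
end limits

/-! ### The second logarithmic derivative of `θ₁` -/

section log_derivatives
variable {τ : ℂ} (hτ : 0 < τ.im)
include hτ

/-- Differentiating an addition formula `θ₁(z+w) θ₁(z-w) c² = θ₁(z)² g(w)² - g(z)² θ₁(w)²` twice
in `w` at `0`. -/
lemma theta1D_second_log_deriv_aux (g : ℕ → ℂ → ℂ)
    (hg : ∀ k z, HasDerivAt (g k) (g (k + 1) z) z) (hg1 : g 1 0 = 0) (z : ℂ)
    (hadd : ∀ w, theta1D 0 (z + w) τ * theta1D 0 (z - w) τ * g 0 0 ^ 2
      = theta1D 0 z τ ^ 2 * g 0 w ^ 2 - g 0 z ^ 2 * theta1D 0 w τ ^ 2) :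
    (theta1D 2 z τ * theta1D 0 z τ - theta1D 1 z τ ^ 2) * g 0 0 ^ 2
      = theta1D 0 z τ ^ 2 * (g 0 0 * g 2 0) - g 0 z ^ 2 * theta1D 1 0 τ ^ 2 := by
  have hp : ∀ k w, HasDerivAt (fun w => theta1D k (z + w) τ) (theta1D (k + 1) (z + w) τ) w :=
    fun k w => (hasDerivAt_theta1D k (z + w) hτ).comp_const_add z w
  have hm : ∀ k w, HasDerivAt (fun w => theta1D k (z - w) τ) (-theta1D (k + 1) (z - w) τ) w :=
    fun k w => (hasDerivAt_theta1D k (z - w) hτ).comp_const_sub z w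
  have h1 := fun w => hasDerivAt_theta1D 0 w hτ
  have h1' := fun w => hasDerivAt_theta1D 1 w hτ
  have first : ∀ w, (theta1D 1 (z + w) τ * theta1D 0 (z - w) τ
      - theta1D 0 (z + w) τ * theta1D 1 (z - w) τ) * g 0 0 ^ 2
      = theta1D 0 z τ ^ 2 * (2 * (g 0 w * g 1 w))
        - g 0 z ^ 2 * (2 * (theta1D 0 w τ * theta1D 1 w τ)) := by
    intro w
    have e1 := ((hp 0 w).mul (hm 0 w)).mul_const (g 0 0 ^ 2)
    have e2 := (((hg 0 w).pow 2).const_mul (theta1D 0 z τ ^ 2)).sub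
      (((h1 w).pow 2).const_mul (g 0 z ^ 2))
    have e3 := e1.unique (e2.congr_of_eventuallyEq (Eventually.of_forall fun w => hadd w))
    norm_num at e3
    linear_combination e3
  have e1 := (((hp 1 0).mul (hm 0 0)).sub ((hp 0 0).mul (hm 1 0))).mul_const (g 0 0 ^ 2)
  have e2 := ((((hg 0 0).mul (hg 1 0)).const_mul 2).const_mul (theta1D 0 z τ ^ 2)).sub
      ((((h1 0).mul (h1' 0)).const_mul 2).const_mul (g 0 z ^ 2))
  have e3 := e1.unique (e2.congr_of_eventuallyEq (Eventually.of_forall fun w => first w))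
  norm_num [theta1D_zero_zero, hg1] at e3
  linear_combination (1 / 2) * e3

lemma theta1D_second_log_deriv_theta2 (z : ℂ) :
    (theta1D 2 z τ * theta1D 0 z τ - theta1D 1 z τ ^ 2) * theta2D 0 0 τ ^ 2
      = theta1D 0 z τ ^ 2 * (theta2D 0 0 τ * theta2D 2 0 τ)
        - theta2D 0 z τ ^ 2 * theta1D 1 0 τ ^ 2 :=
  theta1D_second_log_deriv_aux hτ (fun k z => theta2D k z τ)
    (fun k z => hasDerivAt_theta2D k z hτ) (theta2D_one_zero τ) z
    (fun w => theta1D_addition_theta2D z w hτ)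

lemma theta1D_second_log_deriv_theta3 (z : ℂ) :
    (theta1D 2 z τ * theta1D 0 z τ - theta1D 1 z τ ^ 2) * theta3D 0 0 τ ^ 2
      = theta1D 0 z τ ^ 2 * (theta3D 0 0 τ * theta3D 2 0 τ)
        - theta3D 0 z τ ^ 2 * theta1D 1 0 τ ^ 2 :=
  theta1D_second_log_deriv_aux hτ (fun k z => theta3D k z τ)
    (fun k z => hasDerivAt_theta3D k z hτ) (theta3D_one_zero τ) z
    (fun w => theta1D_addition_theta3D z w hτ)

lemma theta1D_second_log_deriv_theta4 (z : ℂ) :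
    (theta1D 2 z τ * theta1D 0 z τ - theta1D 1 z τ ^ 2) * theta4D 0 0 τ ^ 2
      = theta1D 0 z τ ^ 2 * (theta4D 0 0 τ * theta4D 2 0 τ)
        - theta4D 0 z τ ^ 2 * theta1D 1 0 τ ^ 2 :=
  theta1D_second_log_deriv_aux hτ (fun k z => theta4D k z τ)
    (fun k z => hasDerivAt_theta4D k z hτ) (theta4D_one_zero τ) z
    (fun w => theta1D_addition_theta4D z w hτ)

/-- `ϑ₄''/ϑ₄ - ϑ₃''/ϑ₃ = π² ϑ₂⁴`; through the heat equation this is the `τ`-derivative of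
`log (ϑ₄/ϑ₃)`. -/
lemma theta4D_two_div_sub_theta3D_two_div :
    theta4D 2 0 τ / theta4D 0 0 τ - theta3D 2 0 τ / theta3D 0 0 τ
      = Real.pi ^ 2 * theta2D 0 0 τ ^ 4 := by
  have a2 := theta2D_zero_ne_zero hτ
  have a3 := theta3D_zero_ne_zero hτ
  have a4 := theta4D_zero_ne_zero hτ
  have hJ := jacobi_derivative hτ
  have hq := jacobi_quartic hτ
  have h3 := theta1D_second_log_deriv_theta3 hτ (1 / 2)
  have h4 := theta1D_second_log_deriv_theta4 hτ (1 / 2)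
  have s1 := fun k => theta1D_add_half k 0 τ
  have s3 := fun k => theta3D_add_half k 0 τ
  have s4 := fun k => theta4D_add_half k 0 τ
  simp only [zero_add] at s1 s3 s4
  simp only [s1, s3, s4, hJ, theta2D_one_zero] at h3 h4
  rw [div_sub_div _ _ a4 a3, div_eq_iff (by positivity)]
  have e3 : theta2D 2 0 τ * theta3D 0 0 τ = theta2D 0 0 τ * theta3D 2 0 τ
      - Real.pi ^ 2 * theta2D 0 0 τ * theta3D 0 0 τ * theta4D 0 0 τ ^ 4 := by
    refine mul_left_cancel₀ (mul_ne_zero a2 a3) ?_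
    linear_combination h3
  have e4 : theta2D 2 0 τ * theta4D 0 0 τ = theta2D 0 0 τ * theta4D 2 0 τ
      - Real.pi ^ 2 * theta2D 0 0 τ * theta4D 0 0 τ * theta3D 0 0 τ ^ 4 := by
    refine mul_left_cancel₀ (mul_ne_zero a2 a4) ?_
    linear_combination h4
  refine mul_left_cancel₀ a2 ?_
  linear_combination theta4D 0 0 τ * e3 - theta3D 0 0 τ * e4
    + Real.pi ^ 2 * theta2D 0 0 τ * theta3D 0 0 τ * theta4D 0 0 τ * hq
end log_derivatives

/-! ### Zeros of the theta functions -/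

lemma norm_cos_le_exp (w : ℂ) : ‖Complex.cos w‖ ≤ Real.exp |w.im| := by
  rw [Complex.cos, norm_div]
  have h1 : ‖cexp (w * I)‖ ≤ Real.exp |w.im| := by
    rw [Complex.norm_exp, mul_I_re]; exact Real.exp_le_exp.mpr (neg_le_abs _)
  have h2 : ‖cexp (-w * I)‖ ≤ Real.exp |w.im| := by
    rw [Complex.norm_exp, mul_I_re, neg_im, neg_neg]; exact Real.exp_le_exp.mpr (le_abs_self _)
  have h3 := norm_add_le (cexp (w * I)) (cexp (-w * I))
  rw [Complex.norm_two]
  linarith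

lemma norm_cos_odd_mul_le (v : ℂ) (n : ℕ) : ‖Complex.cos ((2 * n + 1) * v)‖ ≤
    (2 * n + 1) * Real.exp (2 * n * |v.im|) * ‖Complex.cos v‖ := by
  induction n with
  | zero => simp
  | succ n ih =>
    have h1 : Complex.cos ((2 * (n + 1 : ℕ) + 1) * v) =
        2 * Complex.cos ((2 * n + 2 : ℝ) * v) * Complex.cos v - Complex.cos ((2 * n + 1) * v) := by
      have e1 := Complex.cos_add ((2 * n + 2 : ℝ) * v) v
      have e2 := Complex.cos_sub ((2 * n + 2 : ℝ) * v) v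
      push_cast at *
      rw [show ((2 * n + 2) * v + v : ℂ) = (2 * (n + 1) + 1) * v by ring] at e1
      rw [show ((2 * n + 2) * v - v : ℂ) = (2 * n + 1) * v by ring] at e2
      rw [e1, e2]; ring
    have h2 := norm_cos_le_exp ((2 * n + 2 : ℝ) * v)
    rw [im_ofReal_mul, abs_mul, abs_of_nonneg (show (0 : ℝ) ≤ 2 * n + 2 by positivity)] at h2
    have h3 : Real.exp (2 * n * |v.im|) ≤ Real.exp ((2 * n + 2) * |v.im|) :=
      Real.exp_le_exp.mpr (by nlinarith [abs_nonneg v.im])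
    rw [h1]
    refine (norm_sub_le _ _).trans ?_
    rw [norm_mul, norm_mul]
    push_cast
    calc ‖(2 : ℂ)‖ * ‖Complex.cos ((2 * n + 2) * v)‖ * ‖Complex.cos v‖
          + ‖Complex.cos ((2 * n + 1) * v)‖
        ≤ 2 * Real.exp ((2 * n + 2) * |v.im|) * ‖Complex.cos v‖
          + (2 * n + 1) * Real.exp ((2 * n + 2) * |v.im|) * ‖Complex.cos v‖ := by
          refine add_le_add ?_ (ih.trans ?_)
          · rw [Complex.norm_two]
            push_cast at h2
            gcongr
          · gcongr
      _ = (2 * (n + 1) + 1) * Real.exp (2 * (n + 1) * |v.im|) * ‖Complex.cos v‖ := by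
          rw [show 2 * ((n : ℝ) + 1) = 2 * n + 2 by ring]; ring

/-- For `Im τ ≥ 1` and `|Im z| ≤ Im τ / 2` the first term of the sine series of `θ₁` dominates the
sum of the others, so that `θ₁` vanishes only where this term does. -/
lemma exists_int_of_theta1D_eq_zero_of_one_le {z τ : ℂ} (hτ : 1 ≤ τ.im) (hz : |z.im| ≤ τ.im / 2)
    (h : theta1D 0 z τ = 0) : ∃ n : ℤ, z = n := by
  have hτ0 : 0 < τ.im := by linarith
  set v : ℂ := Real.pi * (z + 1 / 2) with hv
  have hvim : |v.im| ≤ Real.pi * (τ.im / 2) := by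
    rw [hv, im_ofReal_mul, abs_mul, abs_of_pos Real.pi_pos]
    gcongr
    simpa using hz
  set g : ℕ → ℂ := fun n => 2 * cexp (Real.pi * I * (n + 1 / 2) ^ 2 * τ)
    * Complex.cos ((2 * n + 1) * v) with hg
  have hsum : HasSum g 0 := by
    have h1 := (summable_norm_thetaTerm 1 1 z hτ0).of_norm.hasSum
    have h2 : ∑' n, thetaTerm 1 1 z τ n = 0 := by
      have : -∑' n, thetaTerm 1 1 z τ n = 0 := by simpa [theta1D, thetaD] using h
      exact neg_eq_zero.mp this
    rw [h2] at h1
    refine h1.nat_add_neg_add_one.congr_fun fun n => ?_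
    simp only [hg, Complex.cos, thetaTerm]
    rw [mul_comm (2 : ℂ), mul_assoc, mul_div_cancel₀ _ two_ne_zero, mul_add, ← exp_add, ← exp_add]
    push_cast
    congr 2 <;> (rw [hv]; ring)
  have hnorm : ∀ n : ℕ, ‖g n‖ = 2 * Real.exp (-(Real.pi * (n + 1 / 2) ^ 2 * τ.im))
      * ‖Complex.cos ((2 * n + 1) * v)‖ := by
    intro n
    rw [hg]
    simp only [norm_mul, Complex.norm_two]
    congr 2
    rw [Complex.norm_exp, show (Real.pi * I * (n + 1 / 2) ^ 2 * τ : ℂ)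
      = ((Real.pi * (n + 1 / 2) ^ 2 : ℝ) : ℂ) * τ * I by push_cast; ring, mul_I_re, im_ofReal_mul]
  have hbound : ∀ n : ℕ, ‖g n‖ ≤ ‖g 0‖ * (1 / 4) ^ n := by
    intro n
    rw [hnorm, hnorm]
    have h1 := norm_cos_odd_mul_le v n
    have h2 : Real.exp (2 * n * |v.im|) ≤ Real.exp (n * (Real.pi * τ.im)) := by
      apply Real.exp_le_exp.mpr
      nlinarith [Nat.cast_nonneg (α := ℝ) n]
    have h3 : (2 * n + 1 : ℝ) ≤ 3 ^ n := by
      have := one_add_mul_le_pow (show (-2 : ℝ) ≤ 2 by norm_num) n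
      norm_num at this
      linarith
    have h4 : Real.exp (-(Real.pi * (n + 1 / 2) ^ 2 * τ.im)) * Real.exp (n * (Real.pi * τ.im))
        ≤ Real.exp (-(Real.pi * (0 + 1 / 2) ^ 2 * τ.im)) * (1 / 12) ^ n := by
      have e1 : (Real.exp (-3)) ^ n ≤ (1 / 12) ^ n := by
        gcongr
        rw [Real.exp_neg, one_div]
        gcongr
        have := Real.exp_one_gt_d9
        rw [show (3 : ℝ) = (3 : ℕ) * 1 by norm_num, Real.exp_nat_mul]
        calc (12 : ℝ) ≤ 2.7 ^ 3 := by norm_num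
          _ ≤ _ := by gcongr; linarith
      refine le_trans ?_ (mul_le_mul_of_nonneg_left e1 (Real.exp_pos _).le)
      rw [← Real.exp_nat_mul, ← Real.exp_add, ← Real.exp_add, Real.exp_le_exp]
      have h5 : (n : ℝ) ≤ n ^ 2 := by exact_mod_cast Nat.le_self_pow two_ne_zero n
      have h6 : 3 ≤ Real.pi * τ.im := by nlinarith [Real.pi_gt_three]
      have h7 : (0 : ℝ) ≤ n := Nat.cast_nonneg n
      nlinarith
    calc 2 * Real.exp (-(Real.pi * (n + 1 / 2) ^ 2 * τ.im)) * ‖Complex.cos ((2 * n + 1) * v)‖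
        ≤ 2 * Real.exp (-(Real.pi * (n + 1 / 2) ^ 2 * τ.im)) *
          (3 ^ n * Real.exp (n * (Real.pi * τ.im)) * ‖Complex.cos v‖) := by
          gcongr
          refine h1.trans ?_
          gcongr
      _ = 2 * (Real.exp (-(Real.pi * (n + 1 / 2) ^ 2 * τ.im)) * Real.exp (n * (Real.pi * τ.im)))
          * ‖Complex.cos v‖ * 3 ^ n := by ring
      _ ≤ 2 * (Real.exp (-(Real.pi * (0 + 1 / 2) ^ 2 * τ.im)) * (1 / 12) ^ n)
          * ‖Complex.cos v‖ * 3 ^ n := by gcongr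
      _ = _ := by
          rw [show (1 / 12 : ℝ) ^ n = (1 / 4) ^ n * (1 / 3) ^ n by rw [← mul_pow]; norm_num]
          have : (1 / 3 : ℝ) ^ n * 3 ^ n = 1 := by rw [← mul_pow]; norm_num
          simp only [Nat.cast_zero, mul_zero, zero_add, one_mul]
          linear_combination (2 * Real.exp (-(Real.pi * (1 / 2) ^ 2 * τ.im)) * (1 / 4) ^ n
            * ‖Complex.cos v‖) * this
  have hg0 : g 0 = 0 := by
    have h1 : HasSum (fun n => g (n + 1)) (-g 0) := by
      simpa using (hasSum_nat_add_iff' 1).mpr hsum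
    have h2 : HasSum (fun n : ℕ => ‖g 0‖ * (1 / 4 : ℝ) ^ (n + 1)) (‖g 0‖ * (1 / 3)) := by
      have := (hasSum_geometric_of_lt_one (r := (1 / 4 : ℝ)) (by norm_num) (by norm_num)).mul_left
        (‖g 0‖ * (1 / 4))
      rw [show ‖g 0‖ * (1 / 4) * (1 - 1 / 4)⁻¹ = ‖g 0‖ * (1 / 3) by ring] at this
      simpa only [pow_succ', mul_assoc] using this
    have h3 := h1.norm_le_of_bounded h2 (fun n => hbound (n + 1))
    rw [norm_neg] at h3
    have : ‖g 0‖ = 0 := by have := norm_nonneg (g 0); linarith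
    exact norm_eq_zero.mp this
  have hcos : Complex.cos v = 0 := by
    simpa [hg, exp_ne_zero] using hg0
  obtain ⟨k, hk⟩ := Complex.cos_eq_zero_iff.mp hcos
  refine ⟨k, ?_⟩
  have hπ : (Real.pi : ℂ) ≠ 0 := by exact_mod_cast Real.pi_ne_zero
  refine mul_left_cancel₀ hπ ?_
  rw [hv] at hk
  linear_combination hk

section zeros
variable {τ : ℂ}

lemma theta1D_add_lattice_eq_zero_iff (z : ℂ) (m n : ℤ) :
    theta1D 0 (z + (m * τ + n)) τ = 0 ↔ theta1D 0 z τ = 0 := by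
  have h1 : Function.Periodic (fun z => theta1D 0 z τ = 0) 1 := fun z => by
    simp [theta1D_add_one]
  have h2 : Function.Periodic (fun z => theta1D 0 z τ = 0) τ := fun z => by
    simp [theta1D_zero_add_tau, exp_ne_zero]
  have h3 := ((h2.int_mul m).add_period (h1.int_mul n)) z
  simpa using h3

variable (hτ : 0 < τ.im)
include hτ

lemma theta1D_two_mul_eq_zero {z : ℂ} (h : theta1D 0 z τ = 0) :
    theta1D 0 (2 * z) (2 * τ) = 0 := by
  have h1 := theta1D_mul_theta2D_self z hτ
  rw [h, zero_mul] at h1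
  exact (mul_eq_zero.mp h1.symm).resolve_right (theta4D_zero_ne_zero (by simpa using hτ))

lemma theta1D_two_pow_mul_eq_zero {z : ℂ} (h : theta1D 0 z τ = 0) (N : ℕ) :
    theta1D 0 (2 ^ N * z) (2 ^ N * τ) = 0 := by
  induction N with
  | zero => simpa using h
  | succ N ih =>
    rw [pow_succ', mul_assoc, mul_assoc]
    exact theta1D_two_mul_eq_zero (two_pow_mul_im_pos N hτ) ih

/-- The zeros of `θ₁(· | τ)` are mapped by `z ↦ 2z` to zeros of `θ₁(· | 2τ)`. Conversely a zero
`z ∈ ½ℤ` of `θ₁(· | τ)` is an integer, because `θ₁(1/2) = ϑ₂ ≠ 0`. -/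
lemma exists_int_of_theta1D_eq_zero_of_dyadic {z : ℂ} (h : theta1D 0 z τ = 0) (N : ℕ)
    (hN : ∃ n : ℤ, 2 ^ N * z = n) : ∃ n : ℤ, z = n := by
  induction N generalizing z τ with
  | zero => simpa using hN
  | succ N ih =>
    obtain ⟨m, hm⟩ := ih (τ := 2 * τ) (by simpa using hτ) (theta1D_two_mul_eq_zero hτ h)
      (by simpa only [← mul_assoc, ← pow_succ] using hN)
    obtain ⟨k, rfl | rfl⟩ := Int.even_or_odd' m
    · refine ⟨k, ?_⟩
      push_cast at hm
      linear_combination (1 / 2) * hm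
    · exfalso
      have hz : z = 1 / 2 + ((0 : ℤ) * τ + k) := by
        push_cast at hm ⊢
        linear_combination (1 / 2) * hm
      rw [hz, theta1D_add_lattice_eq_zero_iff] at h
      have h2 := theta1D_add_half 0 0 τ
      rw [zero_add, h] at h2
      exact theta2D_zero_ne_zero hτ h2.symm

/-- The zeros of `θ₁` are the points of the lattice `ℤτ + ℤ`. -/
lemma theta1D_eq_zero_iff {z : ℂ} : theta1D 0 z τ = 0 ↔ ∃ m n : ℤ, z = m * τ + n := by
  constructor
  · intro h
    -- translate `z` into the strip `|Im z| ≤ Im τ / 2`, then double until `Im τ ≥ 1`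
    set m : ℤ := round (z.im / τ.im) with hm
    set w : ℂ := z + ((-m : ℤ) * τ + (0 : ℤ)) with hw
    have hw0 : theta1D 0 w τ = 0 := by rw [hw, theta1D_add_lattice_eq_zero_iff, h]
    have hwim : |w.im| ≤ τ.im / 2 := by
      have h1 : w.im = (z.im / τ.im - m) * τ.im := by
        rw [hw]
        simp
        field_simp
        ring
      have h2 := abs_sub_round (z.im / τ.im)
      rw [h1, abs_mul, abs_of_pos hτ]
      nlinarith
    obtain ⟨N, hN⟩ := pow_unbounded_of_one_lt (1 / τ.im) (one_lt_two (α := ℝ))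
    have him : ∀ u : ℂ, (2 ^ N * u).im = 2 ^ N * u.im := fun u => by
      rw [show (2 ^ N * u : ℂ) = ((2 ^ N : ℝ) : ℂ) * u by push_cast; rfl, im_ofReal_mul]
    have h3 : ∃ n : ℤ, 2 ^ N * w = n := by
      refine exists_int_of_theta1D_eq_zero_of_one_le (τ := 2 ^ N * τ) ?_ ?_
        (theta1D_two_pow_mul_eq_zero hτ hw0 N)
      · rw [him]
        rw [div_lt_iff₀ hτ] at hN
        exact hN.le
      · rw [him, him, abs_mul, abs_of_pos (by positivity), mul_div_assoc]
        gcongr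
    obtain ⟨n, hn⟩ := exists_int_of_theta1D_eq_zero_of_dyadic hτ hw0 N h3
    refine ⟨m, n, ?_⟩
    rw [hw] at hn
    push_cast at hn
    linear_combination hn
  · rintro ⟨m, n, rfl⟩
    rw [← zero_add (_ + _), theta1D_add_lattice_eq_zero_iff, theta1D_zero_zero]

lemma theta_duplication (z : ℂ) :
    2 * (theta1D 0 z τ * theta2D 0 z τ * theta3D 0 z τ * theta4D 0 z τ)
      = theta4D 0 0 (2 * τ) ^ 2 * theta2D 0 0 τ * theta1D 0 (2 * z) τ := by
  have h1 := theta1D_mul_theta2D z z hτ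
  rw [sub_self, ← two_mul] at h1
  linear_combination (2 * theta3D 0 z τ * theta4D 0 z τ) * theta1D_mul_theta2D_self z hτ
    + 2 * theta1D 0 (2 * z) (2 * τ) * theta4D 0 0 (2 * τ) * theta3D_mul_theta4D_self z hτ
    - theta4D 0 0 (2 * τ) ^ 2 * h1

/-- By the duplication formula, the zeros of the four theta functions are the half-periods. -/
lemma theta_prod_eq_zero_iff {z : ℂ} :
    theta1D 0 z τ * theta2D 0 z τ * theta3D 0 z τ * theta4D 0 z τ = 0
      ↔ ∃ m n : ℤ, 2 * z = m * τ + n := by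
  have a2 := theta2D_zero_ne_zero hτ
  have a4 := theta4D_zero_ne_zero (τ := 2 * τ) (by simpa using hτ)
  rw [← theta1D_eq_zero_iff hτ]
  have h := theta_duplication hτ z
  constructor
  · intro h0
    rw [h0, mul_zero] at h
    simpa [a2, a4] using h.symm
  · intro h0
    rw [h0, mul_zero] at h
    simpa using h

/-- Liouville's theorem for elliptic functions. -/
lemma eq_of_doubly_periodic {f : ℂ → ℂ} (hf : Differentiable ℂ f) (h1 : Function.Periodic f 1)
    (h2 : Function.Periodic f τ) (z w : ℂ) : f z = f w := by
  refine hf.apply_eq_apply_of_bounded ?_ z w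
  have hc : IsCompact ((fun p : ℝ × ℝ => f (p.1 + p.2 * τ)) '' (Set.Icc 0 1 ×ˢ Set.Icc 0 1)) := by
    refine (isCompact_Icc.prod isCompact_Icc).image ?_
    exact hf.continuous.comp (by fun_prop)
  refine hc.isBounded.subset ?_
  rintro _ ⟨z, rfl⟩
  set v : ℝ := z.im / τ.im
  set u : ℝ := (z - v * τ).re
  refine ⟨(Int.fract u, Int.fract v), ⟨⟨Int.fract_nonneg _, (Int.fract_lt_one _).le⟩,
    ⟨Int.fract_nonneg _, (Int.fract_lt_one _).le⟩⟩, ?_⟩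
  have hz : z = u + v * τ := by
    apply Complex.ext
    · simp [u]
    · simp [v]
      field_simp
  have e1 := ((h2.int_mul ⌊v⌋).add_period (h1.int_mul ⌊u⌋)) (Int.fract u + Int.fract v * τ)
  simp only
  rw [← e1]
  congr 1
  conv_rhs => rw [hz]
  rw [Int.fract, Int.fract]
  push_cast
  ring

/-- The even elliptic function `(θ₂/θ₁)²` takes every value. -/
lemma exists_theta2D_sq_eq (c : ℂ) : ∃ z, theta1D 0 z τ ≠ 0 ∧
    theta2D 0 z τ ^ 2 = c * theta1D 0 z τ ^ 2 := by
  have key : ∃ z, theta2D 0 z τ ^ 2 - c * theta1D 0 z τ ^ 2 = 0 := by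
    -- otherwise `θ₁² / (θ₂² - c θ₁²)` would be entire, hence constant
    by_contra! hne
    have d1 : Differentiable ℂ fun z => theta1D 0 z τ :=
      fun z => (hasDerivAt_theta1D 0 z hτ).differentiableAt
    have d2 : Differentiable ℂ fun z => theta2D 0 z τ :=
      fun z => (hasDerivAt_theta2D 0 z hτ).differentiableAt
    have h0 := eq_of_doubly_periodic hτ (f := fun z => theta1D 0 z τ ^ 2 /
      (theta2D 0 z τ ^ 2 - c * theta1D 0 z τ ^ 2)) ((d1.pow 2).div ((d2.pow 2).sub
        ((d1.pow 2).const_mul c)) hne)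
      (fun z => by simp [theta1D_add_one, theta2D_add_one])
      (fun z => by
        simp only [theta1D_zero_add_tau, theta2D_zero_add_tau]
        have he := exp_ne_zero (-Real.pi * I * τ - 2 * Real.pi * I * z)
        have := hne z
        rw [neg_mul, neg_sq, mul_pow, mul_pow, mul_left_comm c, ← mul_sub,
          mul_div_mul_left _ _ (pow_ne_zero 2 he)]) (1 / 2) 0
    have s1 := theta1D_add_half 0 0 τ
    rw [zero_add] at s1
    have h3 := hne (1 / 2)
    simp only [theta1D_zero_zero, s1] at h0 h3
    rw [div_eq_iff h3] at h0
    exact theta2D_zero_ne_zero hτ (by simpa using h0)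
  obtain ⟨z, hz⟩ := key
  refine ⟨z, fun h1 => ?_, sub_eq_zero.mp hz⟩
  rw [h1] at hz
  obtain ⟨m, n, hmn⟩ := (theta1D_eq_zero_iff hτ).mp h1
  have h2 : theta1D 0 (z + 1 / 2) τ = 0 := by
    rw [theta1D_add_half]
    simpa using hz
  rw [hmn, add_comm, theta1D_add_lattice_eq_zero_iff] at h2
  have s1 := theta1D_add_half 0 0 τ
  rw [zero_add, h2] at s1
  exact theta2D_zero_ne_zero hτ s1.symm
end zeros

/-! ### The complete elliptic integral as a holomorphic function -/

/-- The integrable weight `1 / √(1 - t²)` on `[0, 1]`. -/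
noncomputable def chebyshevWeight (t : ℝ) : ℝ := 1 / √(1 - t ^ 2)

lemma measurable_chebyshevWeight : Measurable chebyshevWeight := by
  unfold chebyshevWeight; fun_prop

lemma chebyshevWeight_nonneg (t : ℝ) : 0 ≤ chebyshevWeight t := by
  unfold chebyshevWeight; positivity

lemma chebyshevWeight_pos {t : ℝ} (ht : t ∈ Set.Ioo (0 : ℝ) 1) : 0 < chebyshevWeight t := by
  have : 0 < 1 - t ^ 2 := by nlinarith [ht.1, ht.2]
  unfold chebyshevWeight; positivity

lemma intervalIntegrable_chebyshevWeight :
    IntervalIntegrable chebyshevWeight MeasureTheory.volume 0 1 := by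
  have h1 := ((intervalIntegral.intervalIntegrable_rpow' (a := 0) (b := 1)
    (show (-1 : ℝ) < -(1 / 2) by norm_num)).comp_sub_left 1).symm
  norm_num at h1
  refine h1.mono_fun' measurable_chebyshevWeight.aestronglyMeasurable ?_
  filter_upwards [MeasureTheory.ae_restrict_mem measurableSet_uIoc] with t ht
  rw [Set.uIoc_of_le zero_le_one] at ht
  rw [Real.norm_of_nonneg (chebyshevWeight_nonneg t), chebyshevWeight]
  rcases ht.2.eq_or_lt with rfl | h
  · norm_num
  · have h2 : 0 < 1 - t := by linarith
    rw [Real.rpow_neg h2.le, ← Real.sqrt_eq_rpow, one_div]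
    gcongr
    nlinarith [ht.1]

lemma one_sub_mul_sq_mem_slitPlane {x : ℂ} (hx : 1 - x ∈ slitPlane) {t : ℝ}
    (ht : t ∈ Set.Icc (0 : ℝ) 1) : 1 - x * (t : ℂ) ^ 2 ∈ slitPlane := by
  have h := starConvex_one_slitPlane.add_smul_mem (y := -x) (t := t ^ 2)
    (by simpa [sub_eq_add_neg] using hx) (sq_nonneg t) (by nlinarith [ht.1, ht.2])
  convert h using 1
  rw [real_smul]; push_cast; ring

lemma ofReal_mul_cpow_half {r : ℝ} (hr : 0 < r) {u : ℂ} (hu : u ≠ 0) :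
    ((r : ℂ) * u) ^ (1 / 2 : ℂ) = (√r : ℝ) * u ^ (1 / 2 : ℂ) := by
  have hr' : (r : ℂ) ≠ 0 := by exact_mod_cast hr.ne'
  rw [cpow_def_of_ne_zero (mul_ne_zero hr' hu), log_ofReal_mul hr hu, add_mul, exp_add,
    ← cpow_def_of_ne_zero hu, Real.sqrt_eq_rpow, ofReal_cpow hr.le, cpow_def_of_ne_zero hr',
    ofReal_log hr.le]
  norm_num

/-- The principal root of the product splits, as the factor `1 - t²` is nonnegative. -/
lemma ellK_eq {x : ℂ} (hx : 1 - x ∈ slitPlane) :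
    ellK x = ∫ t in (0 : ℝ)..1,
      (chebyshevWeight t : ℂ) * (1 - x * (t : ℂ) ^ 2) ^ (-(1 / 2) : ℂ) := by
  refine intervalIntegral.integral_congr fun t ht => ?_
  rw [Set.uIcc_of_le zero_le_one] at ht
  have hu := one_sub_mul_sq_mem_slitPlane hx ht
  set u := 1 - x * (t : ℂ) ^ 2
  have hu0 := slitPlane_ne_zero hu
  have h0 : (0 : ℝ) ≤ 1 - t ^ 2 := by nlinarith [ht.1, ht.2]
  simp only [chebyshevWeight]
  rw [show (1 - (t : ℂ) ^ 2) = ((1 - t ^ 2 : ℝ) : ℂ) by push_cast; ring]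
  rcases h0.eq_or_lt with h | h
  · rw [← h]; simp
  · rw [ofReal_mul_cpow_half h hu0, cpow_neg]
    push_cast
    simp only [one_div, mul_inv]

lemma intervalIntegrable_ellK {x : ℂ} (hx : 1 - x ∈ slitPlane) :
    IntervalIntegrable (fun t : ℝ => (chebyshevWeight t : ℂ) *
      (1 - x * (t : ℂ) ^ 2) ^ (-(1 / 2) : ℂ)) MeasureTheory.volume 0 1 := by
  refine IntervalIntegrable.mul_continuousOn (f := fun t => (chebyshevWeight t : ℂ))
    ⟨intervalIntegrable_chebyshevWeight.1.ofReal, intervalIntegrable_chebyshevWeight.2.ofReal⟩ ?_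
  refine ContinuousOn.cpow_const (by fun_prop) fun t ht => ?_
  rw [Set.uIcc_of_le zero_le_one] at ht
  exact one_sub_mul_sq_mem_slitPlane hx ht

lemma differentiableAt_ellK {x₀ : ℂ} (hx₀ : 1 - x₀ ∈ slitPlane) : DifferentiableAt ℂ ellK x₀ := by
  have hopen : IsOpen {x : ℂ | 1 - x ∈ slitPlane} :=
    isOpen_slitPlane.preimage (by fun_prop)
  obtain ⟨r, hr, hball⟩ := Metric.nhds_basis_closedBall.mem_iff.mp (hopen.mem_nhds hx₀)
  set G' : ℂ → ℝ → ℂ := fun x t => -(1 / 2) * (1 - x * (t : ℂ) ^ 2) ^ (-(1 / 2) - 1 : ℂ)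
    * (-(t : ℂ) ^ 2) with hG'
  have hcont : ContinuousOn (fun p : ℂ × ℝ => G' p.1 p.2)
      (Metric.closedBall x₀ r ×ˢ Set.Icc 0 1) := by
    refine ContinuousOn.mul (ContinuousOn.mul continuousOn_const ?_) (by fun_prop)
    refine ContinuousOn.cpow_const (by fun_prop) fun p hp => ?_
    exact one_sub_mul_sq_mem_slitPlane (hball hp.1) hp.2
  obtain ⟨C, hC⟩ := ((isCompact_closedBall x₀ r).prod isCompact_Icc).exists_bound_of_continuousOn
    hcont
  have main := intervalIntegral.hasDerivAt_integral_of_dominated_loc_of_deriv_le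
    (μ := MeasureTheory.volume) (a := 0) (b := 1)
    (F := fun (x : ℂ) (t : ℝ) => (chebyshevWeight t : ℂ) * (1 - x * (t : ℂ) ^ 2) ^ (-(1 / 2) : ℂ))
    (F' := fun x t => (chebyshevWeight t : ℂ) * G' x t) (x₀ := x₀)
    (bound := fun t => chebyshevWeight t * C)
    (Metric.closedBall_mem_nhds x₀ hr) ?_ (intervalIntegrable_ellK hx₀) ?_ ?_
    (intervalIntegrable_chebyshevWeight.mul_const C) ?_
  · refine (main.2.differentiableAt).congr_of_eventuallyEq ?_
    filter_upwards [hopen.mem_nhds hx₀] with x hx using ellK_eq hx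
  · filter_upwards [hopen.mem_nhds hx₀] with x hx
    exact (intervalIntegrable_iff.mp (intervalIntegrable_ellK hx)).aestronglyMeasurable
  · refine (Complex.measurable_ofReal.comp measurable_chebyshevWeight).aestronglyMeasurable.mul ?_
    rw [Set.uIoc_of_le zero_le_one]
    refine ContinuousOn.aestronglyMeasurable ?_ measurableSet_Ioc
    exact hcont.comp (f := fun t : ℝ => (x₀, t)) (by fun_prop)
      (fun t ht => ⟨Metric.mem_closedBall_self hr.le, Set.Ioc_subset_Icc_self ht⟩)
  · refine Eventually.of_forall fun t ht x hx => ?_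
    rw [Set.uIoc_of_le zero_le_one] at ht
    rw [norm_mul, norm_real, Real.norm_of_nonneg (chebyshevWeight_nonneg t)]
    exact mul_le_mul_of_nonneg_left (hC (x, t) ⟨hx, Set.Ioc_subset_Icc_self ht⟩)
      (chebyshevWeight_nonneg t)
  · refine Eventually.of_forall fun t ht x hx => ?_
    rw [Set.uIoc_of_le zero_le_one] at ht
    have h1 : HasDerivAt (fun x : ℂ => 1 - x * (t : ℂ) ^ 2) (-(t : ℂ) ^ 2) x := by
      simpa using ((hasDerivAt_id x).mul_const ((t : ℂ) ^ 2)).const_sub 1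
    exact (h1.cpow_const (one_sub_mul_sq_mem_slitPlane (hball hx)
      (Set.Ioc_subset_Icc_self ht))).const_mul _

/-! ### The ratio of the periods lies in the right half-plane -/

lemma cpow_half_sq (u : ℂ) : (u ^ (1 / 2 : ℂ)) ^ 2 = u := by
  simp [cpow_ofNat_inv_pow u 2]

lemma cpow_half_re_pos {u : ℂ} (hu : u ∈ slitPlane) : 0 < (u ^ (1 / 2 : ℂ)).re := by
  have hu0 := slitPlane_ne_zero hu
  rw [cpow_def_of_ne_zero hu0, exp_re]
  refine mul_pos (Real.exp_pos _) (Real.cos_pos_of_mem_Ioo ?_)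
  have h1 : (log u * (1 / 2)).im = arg u / 2 := by
    rw [show (1 / 2 : ℂ) = ((1 / 2 : ℝ) : ℂ) by norm_num, im_mul_ofReal, log_im]; ring
  have h2 := neg_pi_lt_arg u
  have h3 := lt_of_le_of_ne (arg_le_pi u) (mem_slitPlane_iff_arg.mp hu).1
  rw [h1]
  constructor <;> linarith

/-- If `u` is below and `v` above the real axis, with an angle less than `π` between them, the
principal roots are at an acute angle. -/
lemma re_cpow_half_mul_conj_pos {u v : ℂ} (hu : u ∈ slitPlane) (hv : v ∈ slitPlane)
    (hui : u.im ≤ 0) (hvi : 0 ≤ v.im) (h : 0 < (v * (starRingEnd ℂ) u).im ∨ (u.im = 0 ∧ v.im = 0)) :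
    0 < (u ^ (-(1 / 2) : ℂ) * (starRingEnd ℂ) (v ^ (-(1 / 2) : ℂ))).re := by
  have ha := cpow_half_re_pos hu
  have hb := cpow_half_re_pos hv
  have ha2 := cpow_half_sq u
  have hb2 := cpow_half_sq v
  rw [cpow_neg, cpow_neg]
  set a := u ^ (1 / 2 : ℂ)
  set b := v ^ (1 / 2 : ℂ)
  rw [← ha2] at hui h
  rw [← hb2] at hvi h
  simp only [sq, mul_im, mul_re, map_mul, conj_re, conj_im] at hui hvi h
  have hai : a.im ≤ 0 := by nlinarith
  have hbi : 0 ≤ b.im := by nlinarith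
  have key : 0 < a.re * b.re + a.im * b.im := by
    rcases h with h | ⟨h, -⟩
    · have h2 : 0 < 2 * (a.re * b.re + a.im * b.im) * (b.im * a.re - b.re * a.im) := by
        linarith
      have h3 : 0 ≤ b.im * a.re - b.re * a.im := by nlinarith
      by_contra! h4
      nlinarith
    · have : a.im = 0 := by
        have : a.re * a.im = 0 := by linarith
        exact (mul_eq_zero.mp this).resolve_left ha.ne'
      rw [this]; nlinarith
  rw [map_inv₀, ← mul_inv, inv_re]
  refine div_pos ?_ (normSq_pos.mpr (mul_ne_zero (fun h => ?_) (fun h => ?_)))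
  · simp only [mul_re, conj_re, conj_im]
    linarith
  · rw [h] at ha; simp at ha
  · rw [map_eq_zero] at h
    rw [h] at hb; simp at hb

/-- `Re (K conj K') > 0` follows from the positivity of the real part of the double integral. -/
lemma re_ellK_mul_conj_pos_of_pointwise {x : ℂ} (hx : x ∈ cutPlane)
    (h : ∀ t ∈ Set.Ioo (0 : ℝ) 1, ∀ s ∈ Set.Ioo (0 : ℝ) 1,
      0 < ((1 - x * (t : ℂ) ^ 2) ^ (-(1 / 2) : ℂ) *
        (starRingEnd ℂ) ((1 - (1 - x) * (s : ℂ) ^ 2) ^ (-(1 / 2) : ℂ))).re) :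
    0 < (ellK x * (starRingEnd ℂ) (ellK' x)).re := by
  have hx1 : 1 - (1 - x) ∈ slitPlane := by simpa using hx.1
  have key : ∀ (L : ℂ →L[ℝ] ℝ) (x : ℂ), 1 - x ∈ slitPlane →
      (∀ t ∈ Set.Ioo (0 : ℝ) 1, 0 < L ((1 - x * (t : ℂ) ^ 2) ^ (-(1 / 2) : ℂ))) →
      0 < L (ellK x) := by
    intro L x hx hL
    have hint := intervalIntegrable_ellK hx
    rw [ellK_eq hx, ← L.intervalIntegral_comp_comm hint]
    refine intervalIntegral.intervalIntegral_pos_of_pos_on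
      ⟨L.integrable_comp hint.1, L.integrable_comp hint.2⟩ (fun t ht => ?_) zero_lt_one
    rw [← real_smul, map_smul, smul_eq_mul]
    exact mul_pos (chebyshevWeight_pos ht) (hL t ht)
  have h1 : ∀ t ∈ Set.Ioo (0 : ℝ) 1,
      0 < ((1 - x * (t : ℂ) ^ 2) ^ (-(1 / 2) : ℂ) * (starRingEnd ℂ) (ellK' x)).re := by
    intro t ht
    exact key (reCLM.comp (((ContinuousLinearMap.mul ℝ ℂ)
      ((1 - x * (t : ℂ) ^ 2) ^ (-(1 / 2) : ℂ))).comp conjCLE.toContinuousLinearMap)) (1 - x) hx1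
      (fun s hs => by simpa using h t ht s hs)
  have h2 := key (reCLM.comp ((ContinuousLinearMap.mul ℝ ℂ).flip ((starRingEnd ℂ) (ellK' x)))) x
    hx.2 (fun t ht => by
      have := h1 t ht
      simp at this ⊢
      linarith)
  simp at h2 ⊢
  linarith

lemma re_ellK_mul_conj_pos_of_im_nonneg {x : ℂ} (hx : x ∈ cutPlane) (hi : 0 ≤ x.im) :
    0 < (ellK x * (starRingEnd ℂ) (ellK' x)).re := by
  refine re_ellK_mul_conj_pos_of_pointwise hx fun t ht s hs => ?_
  have hx1 : 1 - (1 - x) ∈ slitPlane := by simpa using hx.1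
  have ht2 : 0 < t ^ 2 := by have := ht.1; positivity
  have hs2 : 0 < s ^ 2 := by have := hs.1; positivity
  have hs3 : 0 < 1 - s ^ 2 := by nlinarith [hs.1, hs.2]
  have e1 : (1 - x * (t : ℂ) ^ 2).im = -(x.im * t ^ 2) := by
    rw [← ofReal_pow, sub_im, im_mul_ofReal]; simp
  have e2 : (1 - (1 - x) * (s : ℂ) ^ 2).im = x.im * s ^ 2 := by
    rw [← ofReal_pow, sub_im, im_mul_ofReal]; simp
  have r1 : (1 - x * (t : ℂ) ^ 2).re = 1 - x.re * t ^ 2 := by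
    rw [← ofReal_pow, sub_re, re_mul_ofReal]; simp
  have r2 : (1 - (1 - x) * (s : ℂ) ^ 2).re = 1 - (1 - x.re) * s ^ 2 := by
    rw [← ofReal_pow, sub_re, re_mul_ofReal]; simp
  refine re_cpow_half_mul_conj_pos
    (one_sub_mul_sq_mem_slitPlane hx.2 (Set.Ioo_subset_Icc_self ht))
    (one_sub_mul_sq_mem_slitPlane hx1 (Set.Ioo_subset_Icc_self hs)) ?_ ?_ ?_
  · rw [e1]; nlinarith
  · rw [e2]; nlinarith
  · rw [mul_im, conj_re, conj_im, e1, e2, r1, r2]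
    rcases hi.eq_or_lt with h | h
    · right; rw [← h]; simp
    · left
      have : 0 < x.im * (s ^ 2 + (1 - s ^ 2) * t ^ 2) := by positivity
      nlinarith

lemma one_sub_mem_cutPlane {x : ℂ} (hx : x ∈ cutPlane) : 1 - x ∈ cutPlane :=
  ⟨hx.2, by simpa using hx.1⟩

/-- `Re (K / K') > 0` on the cut plane; the half plane `Im x ≤ 0` is reduced to `Im x ≥ 0` by the
symmetry `x ↦ 1 - x`. -/
lemma re_ellK_mul_conj_pos {x : ℂ} (hx : x ∈ cutPlane) :
    0 < (ellK x * (starRingEnd ℂ) (ellK' x)).re := by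
  rcases le_total 0 x.im with h | h
  · exact re_ellK_mul_conj_pos_of_im_nonneg hx h
  · have h1 := re_ellK_mul_conj_pos_of_im_nonneg (one_sub_mem_cutPlane hx) (by simpa using h)
    rw [ellK', sub_sub_cancel] at h1
    rw [ellK']
    convert h1 using 1
    simp only [mul_re, conj_re, conj_im]
    ring

/-- The modulus `τ = i K / K'`. -/
noncomputable def modulus (x : ℂ) : ℂ := I * ellK x / ellK' x

lemma ellK'_ne_zero {x : ℂ} (hx : x ∈ cutPlane) : ellK' x ≠ 0 := by
  intro h
  have := re_ellK_mul_conj_pos hx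
  simp [h] at this

lemma modulus_im_pos {x : ℂ} (hx : x ∈ cutPlane) : 0 < (modulus x).im := by
  have h0 := ellK'_ne_zero hx
  have h1 : modulus x = ((normSq (ellK' x))⁻¹ : ℝ) *
      ((ellK x * (starRingEnd ℂ) (ellK' x)) * I) := by
    rw [modulus, div_eq_mul_inv, inv_def]; push_cast; ring
  rw [h1, im_ofReal_mul, mul_I_im]
  exact mul_pos (inv_pos.mpr (normSq_pos.mpr h0)) (re_ellK_mul_conj_pos hx)

lemma isOpen_cutPlane : IsOpen cutPlane :=
  isOpen_slitPlane.inter (isOpen_slitPlane.preimage (by fun_prop))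

lemma isPreconnected_cutPlane : IsPreconnected cutPlane := by
  have h : StarConvex ℝ (1 / 2 : ℂ) cutPlane := by
    have e : ((1 / 2 : ℝ) : ℂ) = 1 / 2 := by norm_num
    have h1 : StarConvex ℝ (1 / 2 : ℂ) slitPlane := e ▸ starConvex_ofReal_slitPlane one_half_pos
    rintro x ⟨hx, hx'⟩ a b ha hb hab
    refine ⟨h1 hx ha hb hab, ?_⟩
    convert h1 hx' ha hb hab using 1
    have : (a : ℂ) + b = 1 := by exact_mod_cast hab
    simp only [real_smul]
    linear_combination -this
  exact (h.isPathConnected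
    ⟨Or.inl (by norm_num), Or.inl (by norm_num)⟩).isConnected.isPreconnected

lemma differentiableAt_modulus {x : ℂ} (hx : x ∈ cutPlane) : DifferentiableAt ℂ modulus x := by
  have h1 : DifferentiableAt ℂ ellK' x :=
    DifferentiableAt.comp x (differentiableAt_ellK (by simpa using hx.1)) (by fun_prop)
  exact ((differentiableAt_ellK hx.2).const_mul I).div h1 (ellK'_ne_zero hx)

/-! ### Inversion of the modulus on the imaginary axis -/

lemma theta3D_eq_jacobiTheta₂ (z τ : ℂ) : theta3D 0 z τ = jacobiTheta₂ z τ := by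
  rw [theta3D, thetaD, jacobiTheta₂]
  refine tsum_congr fun n => ?_
  simp only [thetaTerm, jacobiTheta₂_term]
  push_cast
  ring_nf

lemma theta4D_zero_eq_jacobiTheta₂ (τ : ℂ) : theta4D 0 0 τ = jacobiTheta₂ (1 / 2) τ := by
  rw [← theta3D_eq_jacobiTheta₂, ← theta3D_add_half, zero_add]

lemma theta2D_zero_eq_jacobiTheta₂ (τ : ℂ) :
    theta2D 0 0 τ = cexp (Real.pi * I * τ / 4) * jacobiTheta₂ (τ / 2) τ := by
  rw [theta2D, thetaD, jacobiTheta₂, ← tsum_mul_left]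
  refine tsum_congr fun n => ?_
  simp only [thetaTerm, jacobiTheta₂_term, ← exp_add]
  push_cast
  ring_nf

lemma I_mul_im_pos {t : ℝ} (ht : 0 < t) : 0 < (I * t : ℂ).im := by simpa using ht

/-- Jacobi's imaginary transformation of `ϑ₃`. -/
lemma theta3D_zero_inversion {t : ℝ} (ht : 0 < t) :
    theta3D 0 0 (I * t) = (1 / √t : ℝ) * theta3D 0 0 (I * (1 / t : ℝ)) := by
  have ht' : (t : ℂ) ≠ 0 := by exact_mod_cast ht.ne'
  rw [theta3D_eq_jacobiTheta₂, theta3D_eq_jacobiTheta₂, jacobiTheta₂_functional_equation]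
  rw [show -I * (I * t) = (t : ℂ) by linear_combination (-t : ℂ) * I_sq,
    show (-1 / (I * t) : ℂ) = I * (1 / t : ℝ) by
      push_cast; field_simp; linear_combination -I_sq, Real.sqrt_eq_rpow]
  push_cast
  rw [ofReal_cpow ht.le]
  simp

lemma theta4D_zero_inversion {t : ℝ} (ht : 0 < t) :
    theta4D 0 0 (I * t) = (1 / √t : ℝ) * theta2D 0 0 (I * (1 / t : ℝ)) := by
  have ht' : (t : ℂ) ≠ 0 := by exact_mod_cast ht.ne'
  rw [theta4D_zero_eq_jacobiTheta₂, theta2D_zero_eq_jacobiTheta₂,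
    jacobiTheta₂_functional_equation, ← jacobiTheta₂_neg_left]
  rw [show -I * (I * t) = (t : ℂ) by linear_combination (-t : ℂ) * I_sq,
    show (-1 / (I * t) : ℂ) = I * (1 / t : ℝ) by
      push_cast; field_simp; linear_combination -I_sq,
    show (-(1 / 2 / (I * t)) : ℂ) = I * (1 / t : ℝ) / 2 by
      push_cast; field_simp; linear_combination -I_sq,
    show (-Real.pi * I * (1 / 2) ^ 2 / (I * t) : ℂ) = Real.pi * I * (I * (1 / t : ℝ)) / 4 by
      push_cast; field_simp; linear_combination -4 * I_sq, Real.sqrt_eq_rpow, mul_assoc]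
  push_cast
  rw [ofReal_cpow ht.le]
  simp

/-- At real points, theta functions of purely imaginary modulus are real. -/
lemma thetaD_zero_im_eq_zero (α β : ℤ) (z t : ℝ) : (thetaD 0 α β z (I * t)).im = 0 := by
  rw [← conj_eq_iff_im, thetaD, conj_tsum,
    ← ((Equiv.neg ℤ).trans (Equiv.subRight α)).tsum_eq]
  refine tsum_congr fun n => ?_
  simp only [Equiv.trans_apply, Equiv.neg_apply, Equiv.subRight_apply, pow_zero, one_mul, thetaTerm,
    ← exp_conj]
  simp only [map_add, map_mul, map_pow, map_div₀, conj_ofReal, conj_I, map_intCast, map_ofNat]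
  push_cast
  ring_nf

lemma theta1D_re (z t : ℝ) : ((theta1D 0 z (I * t)).re : ℂ) = theta1D 0 z (I * t) := by
  apply Complex.ext <;> simp [theta1D, thetaD_zero_im_eq_zero]
lemma theta2D_re (z t : ℝ) : ((theta2D 0 z (I * t)).re : ℂ) = theta2D 0 z (I * t) := by
  apply Complex.ext <;> simp [theta2D, thetaD_zero_im_eq_zero]
lemma theta3D_re (z t : ℝ) : ((theta3D 0 z (I * t)).re : ℂ) = theta3D 0 z (I * t) := by
  apply Complex.ext <;> simp [theta3D, thetaD_zero_im_eq_zero]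
lemma theta4D_re (z t : ℝ) : ((theta4D 0 z (I * t)).re : ℂ) = theta4D 0 z (I * t) := by
  apply Complex.ext <;> simp [theta4D, thetaD_zero_im_eq_zero]

lemma thetaD_zero_zero_re_pos (α : ℤ) {t : ℝ} (ht : 0 < t) : 0 < (thetaD 0 α 0 0 (I * t)).re := by
  have h : ∀ n : ℤ, (thetaTerm α 0 0 (I * t) n).re = Real.exp (-Real.pi * (n + α / 2) ^ 2 * t) := by
    intro n
    rw [thetaTerm, ← ofReal_re (Real.exp _)]
    congr 1
    push_cast
    congr 1
    linear_combination (Real.pi * (n + α / 2) ^ 2 * t : ℂ) * I_sq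
  have hs := (summable_norm_thetaTerm α 0 0 (I_mul_im_pos ht)).of_norm
  simp only [thetaD, pow_zero, one_mul]
  rw [re_tsum hs]
  refine Summable.tsum_pos (reCLM.summable hs) (fun n => ?_) 0 ?_
  · simp only [h]; positivity
  · simp only [h]; positivity

section imaginary_axis
variable {t : ℝ} (ht : 0 < t)
include ht

lemma theta2D_zero_re_pos : 0 < (theta2D 0 0 (I * t)).re := thetaD_zero_zero_re_pos 1 ht
lemma theta3D_zero_re_pos : 0 < (theta3D 0 0 (I * t)).re := thetaD_zero_zero_re_pos 0 ht
lemma theta4D_zero_re_pos : 0 < (theta4D 0 0 (I * t)).re := by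
  rw [theta4D_zero_inversion ht, re_ofReal_mul]
  exact mul_pos (by positivity) (theta2D_zero_re_pos (by positivity))

/-- Jacobi's `sn` on the real axis, for the modulus `it`, with the argument scaled so that the
quarter period is `1/2`. -/
noncomputable def jacobiSn (t z : ℝ) : ℝ :=
  ((theta3D 0 0 (I * t)) / (theta2D 0 0 (I * t)) * (theta1D 0 z (I * t) / theta4D 0 z (I * t))).re

omit ht in
lemma ofReal_jacobiSn (z : ℝ) : (jacobiSn t z : ℂ) =
    (theta3D 0 0 (I * t)) / (theta2D 0 0 (I * t)) * (theta1D 0 z (I * t) / theta4D 0 z (I * t)) := by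
  have h2 := theta2D_re 0 t
  have h3 := theta3D_re 0 t
  rw [ofReal_zero] at h2 h3
  rw [jacobiSn, ← theta1D_re, ← theta4D_re, ← h2, ← h3]
  norm_cast

lemma theta4D_real_ne_zero (z : ℝ) : theta4D 0 z (I * t) ≠ 0 := by
  intro h
  have hτ := I_mul_im_pos ht
  obtain ⟨m, n, hmn⟩ := (theta_prod_eq_zero_iff hτ).mp (show _ * _ = (0 : ℂ) by rw [h, mul_zero])
  -- comparing imaginary parts, `z` is a half-integer, where `θ₄` is `ϑ₄` or `ϑ₃`
  have hm : m = 0 := by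
    have := congrArg Complex.im hmn
    simpa [ht.ne'] using this
  rw [hm] at hmn
  have hper : Function.Periodic (fun z => theta4D 0 z (I * t)) 1 := fun z => by
    simp [theta4D, thetaD_add_one]
  obtain ⟨k, rfl | rfl⟩ := Int.even_or_odd' n
  · have hz : (z : ℂ) = 0 + k * 1 := by push_cast at hmn; linear_combination (1 / 2) * hmn
    rw [hz] at h
    exact theta4D_zero_ne_zero hτ ((hper.int_mul k 0).symm.trans h)
  · have hz : (z : ℂ) = 0 + 1 / 2 + k * 1 := by push_cast at hmn; linear_combination (1 / 2) * hmn
    rw [hz] at h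
    have h2 := (hper.int_mul k (0 + 1 / 2)).symm.trans h
    simp only [theta4D_add_half] at h2
    exact theta3D_zero_ne_zero hτ h2

lemma theta23D_real_ne_zero {z : ℝ} (hz : z ∈ Set.Ico (0 : ℝ) (1 / 2)) :
    theta2D 0 z (I * t) * theta3D 0 z (I * t) ≠ 0 := by
  intro h
  have hτ := I_mul_im_pos ht
  obtain ⟨m, n, hmn⟩ := (theta_prod_eq_zero_iff hτ).mp
    (show theta1D 0 z (I * t) * theta2D 0 z (I * t) * theta3D 0 z (I * t) * theta4D 0 z (I * t) = 0
      by linear_combination theta1D 0 z (I * t) * theta4D 0 z (I * t) * h)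
  have hm : m = 0 := by
    have := congrArg Complex.im hmn
    simpa [ht.ne'] using this
  rw [hm] at hmn
  have h2 : 2 * z = (n : ℝ) := by
    have : (2 * z : ℂ) = n := by simpa using hmn
    exact_mod_cast this
  have hn : n = 0 := by
    have h3 : (n : ℝ) < 1 := by linarith [hz.2]
    have h4 : (0 : ℝ) ≤ n := by linarith [hz.1]
    have h5 : n < 1 := by exact_mod_cast h3
    have h6 : 0 ≤ n := by exact_mod_cast h4
    omega
  have hz0 : z = 0 := by rw [hn] at h2; push_cast at h2; linarith
  rw [hz0, ofReal_zero] at h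
  exact mul_ne_zero (theta2D_zero_ne_zero hτ) (theta3D_zero_ne_zero hτ) h

/-- `θ₂ θ₃` is real on the real axis, positive at `0`, and does not vanish before `1/2`. -/
lemma theta23D_real_re_pos {z : ℝ} (hz : z ∈ Set.Ico (0 : ℝ) (1 / 2)) :
    0 < (theta2D 0 z (I * t) * theta3D 0 z (I * t)).re := by
  have hτ := I_mul_im_pos ht
  set f : ℝ → ℝ := fun z => (theta2D 0 z (I * t) * theta3D 0 z (I * t)).re with hf
  have hreal : ∀ z : ℝ, ((f z : ℝ) : ℂ) = theta2D 0 z (I * t) * theta3D 0 z (I * t) := fun z => by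
    simp only [hf]
    rw [← theta2D_re, ← theta3D_re]; norm_cast
  have hcont : Continuous f := by
    have c2 : Continuous fun z => theta2D 0 z (I * t) :=
      continuous_iff_continuousAt.mpr fun z => (hasDerivAt_theta2D 0 z hτ).continuousAt
    have c3 : Continuous fun z => theta3D 0 z (I * t) :=
      continuous_iff_continuousAt.mpr fun z => (hasDerivAt_theta3D 0 z hτ).continuousAt
    exact continuous_re.comp ((c2.comp continuous_ofReal).mul (c3.comp continuous_ofReal))
  have h0 : 0 < f 0 := by
    have h2 := theta2D_re 0 t
    have h3 := theta3D_re 0 t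
    rw [ofReal_zero] at h2 h3
    simp only [hf, ofReal_zero]
    rw [← h2, ← h3, ← ofReal_mul, ofReal_re]
    exact mul_pos (theta2D_zero_re_pos ht) (theta3D_zero_re_pos ht)
  by_contra! hneg
  obtain ⟨w, hw, hw0⟩ := intermediate_value_Icc' hz.1 hcont.continuousOn ⟨hneg, h0.le⟩
  refine theta23D_real_ne_zero ht (z := w) ⟨hw.1, hw.2.trans_lt hz.2⟩ ?_
  rw [← hreal, hw0, ofReal_zero]

lemma hasDerivAt_jacobiSn (z : ℝ) : HasDerivAt (jacobiSn t)
    ((theta3D 0 0 (I * t)).re / (theta2D 0 0 (I * t)).re * (Real.pi * (theta4D 0 0 (I * t)).re ^ 2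
      * (theta2D 0 z (I * t) * theta3D 0 z (I * t)).re / (theta4D 0 z (I * t)).re ^ 2)) z := by
  have hτ := I_mul_im_pos ht
  have h4 := theta4D_real_ne_zero ht z
  have h := (((hasDerivAt_theta1D 0 (z : ℂ) hτ).div (hasDerivAt_theta4D 0 (z : ℂ) hτ) h4).const_mul
    ((theta3D 0 0 (I * t)) / (theta2D 0 0 (I * t)))).real_of_complex
  refine h.congr_deriv ?_
  have hW := theta14_wronskian hτ h4
  have hW' : theta1D (0 + 1) z (I * t) * theta4D 0 z (I * t)
      - theta1D 0 z (I * t) * theta4D (0 + 1) z (I * t)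
      = Real.pi * theta4D 0 0 (I * t) ^ 2 * (theta2D 0 z (I * t) * theta3D 0 z (I * t)) := by
    rw [zero_add]; linear_combination -hW
  rw [hW']
  have e2 := theta2D_re 0 t
  have e3 := theta3D_re 0 t
  have e4 := theta4D_re 0 t
  rw [ofReal_zero] at e2 e3 e4
  rw [← e2, ← e3, ← e4, ← theta2D_re z, ← theta3D_re z, ← theta4D_re z]
  norm_cast

lemma jacobiSn_deriv_pos {z : ℝ} (hz : z ∈ Set.Ico (0 : ℝ) (1 / 2)) :
    0 < (theta3D 0 0 (I * t)).re / (theta2D 0 0 (I * t)).re * (Real.pi * (theta4D 0 0 (I * t)).re ^ 2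
      * (theta2D 0 z (I * t) * theta3D 0 z (I * t)).re / (theta4D 0 z (I * t)).re ^ 2) := by
  have h2 := theta2D_zero_re_pos ht
  have h3 := theta3D_zero_re_pos ht
  have h4 := theta4D_zero_re_pos ht
  have h23 := theta23D_real_re_pos ht hz
  have h40 : (theta4D 0 z (I * t)).re ≠ 0 := by
    have := theta4D_real_ne_zero ht z
    rw [← theta4D_re] at this
    exact_mod_cast this
  have := Real.pi_pos
  positivity

lemma jacobiSn_strictMonoOn : StrictMonoOn (jacobiSn t) (Set.Icc 0 (1 / 2)) := by
  refine strictMonoOn_of_deriv_pos (convex_Icc _ _)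
    (fun z _ => (hasDerivAt_jacobiSn ht z).continuousAt.continuousWithinAt) fun z hz => ?_
  rw [interior_Icc] at hz
  rw [(hasDerivAt_jacobiSn ht z).deriv]
  exact jacobiSn_deriv_pos ht (Set.Ioo_subset_Ico_self hz)

omit ht in
lemma jacobiSn_zero : jacobiSn t 0 = 0 := by
  simp [jacobiSn, theta1D_zero_zero]

lemma jacobiSn_half : jacobiSn t (1 / 2) = 1 := by
  have hτ := I_mul_im_pos ht
  have h := ofReal_jacobiSn (t := t) (1 / 2)
  have s1 := theta1D_add_half 0 0 (I * t)
  have s4 := theta4D_add_half 0 0 (I * t)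
  rw [zero_add] at s1 s4
  have a2 := theta2D_zero_ne_zero hτ
  have a3 := theta3D_zero_ne_zero hτ
  push_cast at h
  rw [s1, s4, div_mul_div_cancel₀ a2, div_self a3] at h
  exact_mod_cast h

lemma jacobiSn_image_Ioo : jacobiSn t '' Set.Ioo 0 (1 / 2) = Set.Ioo 0 1 := by
  have hm := jacobiSn_strictMonoOn ht
  have h0 := jacobiSn_zero (t := t)
  have h1 := jacobiSn_half ht
  apply Set.Subset.antisymm
  · rintro _ ⟨z, hz, rfl⟩
    have l := hm (Set.left_mem_Icc.mpr (by norm_num)) (Set.Ioo_subset_Icc_self hz) hz.1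
    have r := hm (Set.Ioo_subset_Icc_self hz) (Set.right_mem_Icc.mpr (by norm_num)) hz.2
    rw [h0] at l
    rw [h1] at r
    exact ⟨l, r⟩
  · have := intermediate_value_Ioo (show (0 : ℝ) ≤ 1 / 2 by norm_num) (f := jacobiSn t)
      (fun z _ => (hasDerivAt_jacobiSn ht z).continuousAt.continuousWithinAt)
    rwa [h0, h1] at this

/-- `∫₀¹ du / √((1 - u²)(1 - k² u²)) = π ϑ₃² / 2` for `k² = ϑ₂⁴ / ϑ₃⁴`, by the substitution
`u = sn`. -/
lemma ellK_theta_quotient :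
    ellK (theta2D 0 0 (I * t) ^ 4 / theta3D 0 0 (I * t) ^ 4)
      = Real.pi / 2 * theta3D 0 0 (I * t) ^ 2 := by
  have hτ := I_mul_im_pos ht
  have e2 := theta2D_re 0 t
  have e3 := theta3D_re 0 t
  have e4 := theta4D_re 0 t
  rw [ofReal_zero] at e2 e3 e4
  have a2 := theta2D_zero_ne_zero hτ
  have a3 := theta3D_zero_ne_zero hτ
  have hq := jacobi_quartic hτ
  rw [ellK, intervalIntegral.integral_of_le zero_le_one,
    MeasureTheory.integral_Ioc_eq_integral_Ioo, ← jacobiSn_image_Ioo ht,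
    MeasureTheory.integral_image_eq_integral_abs_deriv_smul measurableSet_Ioo
      (fun z _ => (hasDerivAt_jacobiSn ht z).hasDerivWithinAt)
      ((jacobiSn_strictMonoOn ht).injOn.mono Set.Ioo_subset_Icc_self),
    MeasureTheory.setIntegral_congr_fun (g := fun _ => Real.pi * theta3D 0 0 (I * t) ^ 2)
      measurableSet_Ioo ?_]
  · simp
    ring
  intro z hz
  simp only
  have hd := jacobiSn_deriv_pos ht (Set.Ioo_subset_Ico_self hz)
  rw [abs_of_pos hd]
  set d := (theta3D 0 0 (I * t)).re / (theta2D 0 0 (I * t)).re *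
    (Real.pi * (theta4D 0 0 (I * t)).re ^ 2
      * (theta2D 0 z (I * t) * theta3D 0 z (I * t)).re / (theta4D 0 z (I * t)).re ^ 2) with hdd
  set c : ℝ := Real.pi * (theta3D 0 0 (I * t)).re ^ 2 with hc
  have hcpos : 0 < c := by
    have := theta3D_zero_re_pos ht
    have := Real.pi_pos
    positivity
  have hcC : (c : ℂ) = Real.pi * theta3D 0 0 (I * t) ^ 2 := by
    rw [hc]; push_cast; rw [e3]
  have hdC : (d : ℂ) = theta3D 0 0 (I * t) / theta2D 0 0 (I * t) *
      (Real.pi * theta4D 0 0 (I * t) ^ 2 * (theta2D 0 z (I * t) * theta3D 0 z (I * t))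
        / theta4D 0 z (I * t) ^ 2) := by
    have e23 : ((theta2D 0 z (I * t) * theta3D 0 z (I * t)).re : ℂ) =
        theta2D 0 z (I * t) * theta3D 0 z (I * t) := by
      rw [← theta2D_re, ← theta3D_re]; norm_cast
    rw [hdd]
    push_cast
    rw [e2, e3, e4, e23, theta4D_re]
  have h4 := theta4D_real_ne_zero ht z
  have r4 := theta4D_sq_relation (z : ℂ) hτ
  have r3 := theta3D_sq_relation (z : ℂ) hτ
  have key : ((1 - (jacobiSn t z : ℂ) ^ 2) *
      (1 - theta2D 0 0 (I * t) ^ 4 / theta3D 0 0 (I * t) ^ 4 * (jacobiSn t z : ℂ) ^ 2))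
      = (((d / c) ^ 2 : ℝ) : ℂ) := by
    push_cast
    have hπ : (Real.pi : ℂ) ≠ 0 := by exact_mod_cast Real.pi_ne_zero
    rw [hcC, hdC, ofReal_jacobiSn]
    have k1 : 1 - (theta3D 0 0 (I * t) / theta2D 0 0 (I * t) *
        (theta1D 0 z (I * t) / theta4D 0 z (I * t))) ^ 2
        = theta4D 0 0 (I * t) ^ 2 * theta2D 0 z (I * t) ^ 2 /
          (theta2D 0 0 (I * t) ^ 2 * theta4D 0 z (I * t) ^ 2) := by
      field_simp
      linear_combination r4
    have k2 : 1 - theta2D 0 0 (I * t) ^ 4 / theta3D 0 0 (I * t) ^ 4 *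
        (theta3D 0 0 (I * t) / theta2D 0 0 (I * t) *
        (theta1D 0 z (I * t) / theta4D 0 z (I * t))) ^ 2
        = theta4D 0 0 (I * t) ^ 2 * theta3D 0 z (I * t) ^ 2 /
          (theta3D 0 0 (I * t) ^ 2 * theta4D 0 z (I * t) ^ 2) := by
      have : theta3D 0 0 (I * t) ^ 2 * theta4D 0 z (I * t) ^ 2
          - theta2D 0 0 (I * t) ^ 2 * theta1D 0 z (I * t) ^ 2
          = theta4D 0 0 (I * t) ^ 2 * theta3D 0 z (I * t) ^ 2 := by
        refine mul_left_cancel₀ (pow_ne_zero 2 a2) ?_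
        linear_combination theta3D 0 0 (I * t) ^ 2 * r4 - theta4D 0 0 (I * t) ^ 2 * r3
          + theta1D 0 z (I * t) ^ 2 * hq
      field_simp
      linear_combination this
    rw [k1, k2]
    field_simp
  have hsq : √((d / c) ^ 2) = d / c := Real.sqrt_sq (by positivity)
  have h1 := ofReal_mul_cpow_half (r := (d / c) ^ 2) (by positivity) (one_ne_zero (α := ℂ))
  rw [mul_one, one_cpow, mul_one, hsq] at h1
  have hdne : (d : ℂ) ≠ 0 := by exact_mod_cast hd.ne'
  have hcne : (c : ℂ) ≠ 0 := by exact_mod_cast hcpos.ne'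
  rw [key, h1, real_smul, ← hcC]
  push_cast
  field_simp
end imaginary_axis

/-- The `x`-coordinate `ϑ₄⁴ / ϑ₃⁴` at `τ = it`. -/
noncomputable def imaginaryPoint (t : ℝ) : ℂ :=
  theta4D 0 0 (I * t) ^ 4 / theta3D 0 0 (I * t) ^ 4

section imaginary_point
variable {t : ℝ} (ht : 0 < t)
include ht

lemma one_sub_imaginaryPoint :
    1 - imaginaryPoint t = theta2D 0 0 (I * t) ^ 4 / theta3D 0 0 (I * t) ^ 4 := by
  have hτ := I_mul_im_pos ht
  have a3 := theta3D_zero_ne_zero hτ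
  rw [imaginaryPoint]
  field_simp
  linear_combination jacobi_quartic hτ

lemma imaginaryPoint_mem_cutPlane : imaginaryPoint t ∈ cutPlane := by
  have e2 := theta2D_re 0 t
  have e3 := theta3D_re 0 t
  have e4 := theta4D_re 0 t
  rw [ofReal_zero] at e2 e3 e4
  have h2 := theta2D_zero_re_pos ht
  have h3 := theta3D_zero_re_pos ht
  have h4 := theta4D_zero_re_pos ht
  constructor
  · rw [imaginaryPoint, ← e3, ← e4]
    norm_cast
    left
    rw [ofReal_re]
    positivity
  · rw [one_sub_imaginaryPoint ht, ← e3, ← e2]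
    norm_cast
    left
    rw [ofReal_re]
    positivity

/-- `K'` at the point `imaginaryPoint t` is evaluated through the point with `1/t` instead of `t`,
using the imaginary transformation. -/
lemma modulus_imaginaryPoint : modulus (imaginaryPoint t) = I * t := by
  have hτ := I_mul_im_pos ht
  have ht' : 0 < 1 / t := by positivity
  have h1 := ellK_theta_quotient ht
  have h2 := ellK_theta_quotient ht'
  have hs : ((1 / √t : ℝ) : ℂ) ≠ 0 := by
    have : 0 < 1 / √t := by positivity
    exact_mod_cast this.ne'
  have a3 := theta3D_zero_ne_zero hτ
  have e : theta2D 0 0 (I * (1 / t : ℝ)) ^ 4 / theta3D 0 0 (I * (1 / t : ℝ)) ^ 4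
      = imaginaryPoint t := by
    rw [imaginaryPoint, theta3D_zero_inversion ht, theta4D_zero_inversion ht, mul_pow, mul_pow,
      mul_div_mul_left _ _ (pow_ne_zero 4 hs)]
  have e3 : theta3D 0 0 (I * (1 / t : ℝ)) ^ 2 = t * theta3D 0 0 (I * t) ^ 2 := by
    rw [theta3D_zero_inversion ht, mul_pow, ← mul_assoc, ← ofReal_pow, ← ofReal_mul, div_pow,
      one_pow, Real.sq_sqrt ht.le, mul_one_div_cancel ht.ne', ofReal_one, one_mul]
  rw [e, e3] at h2
  have hπ : (Real.pi : ℂ) ≠ 0 := by exact_mod_cast Real.pi_ne_zero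
  rw [modulus, ellK', one_sub_imaginaryPoint ht, h1, h2]
  field_simp

lemma sqrt_imaginaryPoint : imaginaryPoint t ^ (1 / 2 : ℂ) =
    theta4D 0 0 (I * t) ^ 2 / theta3D 0 0 (I * t) ^ 2 := by
  have e3 := theta3D_re 0 t
  have e4 := theta4D_re 0 t
  rw [ofReal_zero] at e3 e4
  have h3 := theta3D_zero_re_pos ht
  have h4 := theta4D_zero_re_pos ht
  set r : ℝ := (theta4D 0 0 (I * t)).re ^ 2 / (theta3D 0 0 (I * t)).re ^ 2 with hr
  have hrpos : 0 < r := by positivity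
  have hrC : (r : ℂ) = theta4D 0 0 (I * t) ^ 2 / theta3D 0 0 (I * t) ^ 2 := by
    rw [hr]; push_cast; rw [e3, e4]
  have hr2 : imaginaryPoint t = ((r ^ 2 : ℝ) : ℂ) := by
    rw [ofReal_pow, hrC, imaginaryPoint]; ring
  have h1 := ofReal_mul_cpow_half (r := r ^ 2) (by positivity) (one_ne_zero (α := ℂ))
  rw [mul_one, one_cpow, mul_one, Real.sqrt_sq hrpos.le] at h1
  rw [hr2, h1, hrC]
end imaginary_point

/-! ### Inversion of the modulus on the cut plane -/

lemma differentiableAt_theta_zero (α β : ℤ) {τ : ℂ} (hτ : 0 < τ.im) :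
    DifferentiableAt ℂ (fun τ => thetaD 0 α β 0 τ) τ := by
  have h := (hasDerivAt_thetaD_curve 0 α β 0 0 hτ).differentiableAt
  simpa using h

/-- `√x = ϑ₄² / ϑ₃²` at `τ = iK/K'`: both sides are holomorphic on the cut plane and agree on the
image of the imaginary axis. -/
lemma sqrt_eq_theta_quotient {x : ℂ} (hx : x ∈ cutPlane) :
    x ^ (1 / 2 : ℂ) = theta4D 0 0 (modulus x) ^ 2 / theta3D 0 0 (modulus x) ^ 2 := by
  have hmod : DifferentiableOn ℂ modulus cutPlane := fun x hx =>
    (differentiableAt_modulus hx).differentiableWithinAt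
  have hth : ∀ α β : ℤ, DifferentiableOn ℂ (fun x => thetaD 0 α β 0 (modulus x)) cutPlane :=
    fun α β x hx => ((differentiableAt_theta_zero α β (modulus_im_pos hx)).comp x
      (differentiableAt_modulus hx)).differentiableWithinAt
  have hf : DifferentiableOn ℂ (fun x : ℂ => x ^ (1 / 2 : ℂ)) cutPlane := fun x hx =>
    ((differentiableAt_id).cpow_const hx.1).differentiableWithinAt
  have hg : DifferentiableOn ℂ
      (fun x => theta4D 0 0 (modulus x) ^ 2 / theta3D 0 0 (modulus x) ^ 2) cutPlane :=
    ((hth 0 1).pow 2).div ((hth 0 0).pow 2)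
      (fun x hx => pow_ne_zero 2 (theta3D_zero_ne_zero (modulus_im_pos hx)))
  refine (hf.analyticOnNhd isOpen_cutPlane).eqOn_of_preconnected_of_frequently_eq
    (hg.analyticOnNhd isOpen_cutPlane) isPreconnected_cutPlane
    (imaginaryPoint_mem_cutPlane one_pos) ?_ hx
  -- the curve `t ↦ imaginaryPoint t` is continuous and injective
  have hcont : ContinuousAt imaginaryPoint 1 := by
    have hc : ∀ α β : ℤ, ContinuousAt (fun t : ℝ => thetaD 0 α β 0 (I * t)) 1 := fun α β =>
      ContinuousAt.comp (f := fun t : ℝ => I * (t : ℂ)) (g := fun τ => thetaD 0 α β 0 τ)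
        (differentiableAt_theta_zero α β (by simp)).continuousAt (by fun_prop)
    exact ((hc 0 1).pow 4).div ((hc 0 0).pow 4)
      (pow_ne_zero 4 (theta3D_zero_ne_zero (by simp)))
  have htend : Tendsto imaginaryPoint (𝓝[>] 1) (𝓝[≠] (imaginaryPoint 1)) := by
    refine tendsto_nhdsWithin_iff.mpr ⟨hcont.tendsto.mono_left nhdsWithin_le_nhds, ?_⟩
    filter_upwards [self_mem_nhdsWithin] with t ht h
    have ht1 : (1 : ℝ) < t := ht
    have h1 := modulus_imaginaryPoint (zero_lt_one.trans ht1)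
    have h2 := modulus_imaginaryPoint one_pos
    rw [h, h2] at h1
    have h3 := mul_left_cancel₀ I_ne_zero h1
    exact ht1.ne (by exact_mod_cast h3)
  refine htend.frequently (Eventually.frequently ?_)
  filter_upwards [self_mem_nhdsWithin] with t ht
  have ht0 : 0 < t := zero_lt_one.trans ht
  rw [sqrt_imaginaryPoint ht0, modulus_imaginaryPoint ht0]

lemma eq_theta_quotient {x : ℂ} (hx : x ∈ cutPlane) :
    x = theta4D 0 0 (modulus x) ^ 4 / theta3D 0 0 (modulus x) ^ 4 := by
  conv_lhs => rw [← cpow_half_sq x, sqrt_eq_theta_quotient hx]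
  ring

/-- `dτ/dx = πi / (π² ϑ₃⁴ x (1 - x))`. -/
lemma hasDerivAt_modulus {x : ℂ} (hx : x ∈ cutPlane) : HasDerivAt modulus
    (Real.pi * I / (Real.pi ^ 2 * theta3D 0 0 (modulus x) ^ 4 * (x * (1 - x)))) x := by
  have hτ := modulus_im_pos hx
  have hm := (differentiableAt_modulus hx).hasDerivAt
  have a3 := theta3D_zero_ne_zero hτ
  have a4 := theta4D_zero_ne_zero hτ
  have a2 := theta2D_zero_ne_zero hτ
  have hπ : (Real.pi : ℂ) ≠ 0 := by exact_mod_cast Real.pi_ne_zero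
  have d3 : HasDerivAt (fun τ => theta3D 0 0 τ) (theta3D 2 0 (modulus x) / (4 * Real.pi * I))
      (modulus x) := by
    have := hasDerivAt_thetaD_curve 0 0 0 0 0 hτ
    simpa [theta3D] using this
  have d4 : HasDerivAt (fun τ => theta4D 0 0 τ) (theta4D 2 0 (modulus x) / (4 * Real.pi * I))
      (modulus x) := by
    have := hasDerivAt_thetaD_curve 0 0 1 0 0 hτ
    simpa [theta4D] using this
  have dq := (((d4.pow 4).div (d3.pow 4) (pow_ne_zero 4 a3)).comp x hm)
  have did : HasDerivAt (fun x : ℂ => x) 1 x := hasDerivAt_id x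
  have heq := dq.unique (did.congr_of_eventuallyEq (by
    filter_upwards [isOpen_cutPlane.mem_nhds hx] with x hx
    exact (eq_theta_quotient hx).symm))
  have hn := theta4D_two_div_sub_theta3D_two_div hτ
  have hq := jacobi_quartic hτ
  have hxe := eq_theta_quotient hx
  refine hm.congr_deriv ?_
  have hx0 : x ≠ 0 := slitPlane_ne_zero hx.1
  have hx1 : 1 - x ≠ 0 := slitPlane_ne_zero hx.2
  set τ := modulus x
  have hx1' : 1 - x = theta2D 0 0 τ ^ 4 / theta3D 0 0 τ ^ 4 := by
    rw [hxe]; field_simp; linear_combination hq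
  rw [eq_div_iff (by positivity)]
  rw [hx1']
  have h4 : theta4D 2 0 τ * theta3D 0 0 τ - theta3D 2 0 τ * theta4D 0 0 τ =
      Real.pi ^ 2 * theta2D 0 0 τ ^ 4 * theta3D 0 0 τ * theta4D 0 0 τ := by
    field_simp at hn
    linear_combination hn
  have h5 : (4 * theta4D 0 0 τ ^ 3 * theta3D 0 0 τ ^ 3 / (4 * Real.pi * I) / theta3D 0 0 τ ^ 8) *
      (theta4D 2 0 τ * theta3D 0 0 τ - theta3D 2 0 τ * theta4D 0 0 τ) * deriv modulus x = 1 := by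
    rw [← heq]
    norm_num
    field_simp
    exact Or.inl trivial
  rw [h4] at h5
  generalize deriv modulus x = m' at h5 ⊢
  rw [hxe]
  have h6 := congrArg (fun w => Real.pi * I * w) h5
  simp only [mul_one] at h6
  rw [← h6]
  field_simp

/-! ### Theta quotients along a curve `z = a τ + b` -/

/-- The logarithmic `z`-derivative `h₂` of `θ₂ / θ₁`, in the form given by the Wronskian. In terms of
the Weierstrass function the products of two of the three functions `logDeriv21`, `logDeriv31`,
`logDeriv41` are the `℘ - e_i`. -/
noncomputable def logDeriv21 (z τ : ℂ) : ℂ :=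
  -Real.pi * theta2D 0 0 τ ^ 2 * (theta3D 0 z τ / theta1D 0 z τ * (theta4D 0 z τ / theta1D 0 z τ)
    / (theta2D 0 z τ / theta1D 0 z τ))

/-- The logarithmic `z`-derivative `h₃` of `θ₃ / θ₁`. -/
noncomputable def logDeriv31 (z τ : ℂ) : ℂ :=
  -Real.pi * theta3D 0 0 τ ^ 2 * (theta2D 0 z τ / theta1D 0 z τ * (theta4D 0 z τ / theta1D 0 z τ)
    / (theta3D 0 z τ / theta1D 0 z τ))

/-- The logarithmic `z`-derivative `h₄` of `θ₄ / θ₁`. -/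
noncomputable def logDeriv41 (z τ : ℂ) : ℂ :=
  -Real.pi * theta4D 0 0 τ ^ 2 * (theta2D 0 z τ / theta1D 0 z τ * (theta3D 0 z τ / theta1D 0 z τ)
    / (theta4D 0 z τ / theta1D 0 z τ))

/-- The function `θ₁'/θ₁ + 2πi a`, i.e. the logarithmic derivative of `e^{2πi a z} θ₁(z)`. -/
noncomputable def shiftedLogDeriv (a z τ : ℂ) : ℂ :=
  theta1D 1 z τ / theta1D 0 z τ + 2 * Real.pi * I * a

section nonzero
variable {z τ : ℂ} (hτ : 0 < τ.im) (h1 : theta1D 0 z τ ≠ 0) (h2 : theta2D 0 z τ ≠ 0)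
  (h3 : theta3D 0 z τ ≠ 0) (h4 : theta4D 0 z τ ≠ 0)
include hτ h1 h2 h3 h4

lemma logDeriv21_ne_zero : logDeriv21 z τ ≠ 0 := by
  have := theta2D_zero_ne_zero hτ
  have hπ : (Real.pi : ℂ) ≠ 0 := by exact_mod_cast Real.pi_ne_zero
  simp [logDeriv21, *]
lemma logDeriv31_ne_zero : logDeriv31 z τ ≠ 0 := by
  have := theta3D_zero_ne_zero hτ
  have hπ : (Real.pi : ℂ) ≠ 0 := by exact_mod_cast Real.pi_ne_zero
  simp [logDeriv31, *]
lemma logDeriv41_ne_zero : logDeriv41 z τ ≠ 0 := by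
  have := theta4D_zero_ne_zero hτ
  have hπ : (Real.pi : ℂ) ≠ 0 := by exact_mod_cast Real.pi_ne_zero
  simp [logDeriv41, *]

omit hτ in
lemma logDeriv31_mul_logDeriv41 : logDeriv31 z τ * logDeriv41 z τ =
    Real.pi ^ 2 * theta3D 0 0 τ ^ 2 * theta4D 0 0 τ ^ 2 * theta2D 0 z τ ^ 2 / theta1D 0 z τ ^ 2 := by
  rw [logDeriv31, logDeriv41]; field_simp
omit hτ in
lemma logDeriv21_mul_logDeriv41 : logDeriv21 z τ * logDeriv41 z τ =
    Real.pi ^ 2 * theta2D 0 0 τ ^ 2 * theta4D 0 0 τ ^ 2 * theta3D 0 z τ ^ 2 / theta1D 0 z τ ^ 2 := by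
  rw [logDeriv21, logDeriv41]; field_simp
omit hτ in
lemma logDeriv21_mul_logDeriv31 : logDeriv21 z τ * logDeriv31 z τ =
    Real.pi ^ 2 * theta2D 0 0 τ ^ 2 * theta3D 0 0 τ ^ 2 * theta4D 0 z τ ^ 2 / theta1D 0 z τ ^ 2 := by
  rw [logDeriv21, logDeriv31]; field_simp

/-- `e₁ - e₃ = π² ϑ₃⁴`. -/
lemma pi_sq_mul_theta3D_pow_four : Real.pi ^ 2 * theta3D 0 0 τ ^ 4 =
    logDeriv31 z τ * (logDeriv21 z τ - logDeriv41 z τ) := by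
  rw [mul_sub, logDeriv31_mul_logDeriv41 h1 h2 h3 h4, mul_comm,
    mul_comm (logDeriv31 z τ), logDeriv21_mul_logDeriv31 h1 h2 h3 h4]
  field_simp
  linear_combination -theta3D 0 0 τ ^ 2 * theta4D_sq_relation z hτ

/-- `e₁ - e₂ = π² ϑ₄⁴`. -/
lemma pi_sq_mul_theta4D_pow_four : Real.pi ^ 2 * theta4D 0 0 τ ^ 4 =
    logDeriv41 z τ * (logDeriv21 z τ - logDeriv31 z τ) := by
  rw [mul_sub, mul_comm _ (logDeriv31 z τ), logDeriv31_mul_logDeriv41 h1 h2 h3 h4,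
    mul_comm (logDeriv41 z τ), logDeriv21_mul_logDeriv41 h1 h2 h3 h4]
  field_simp
  linear_combination -theta4D 0 0 τ ^ 2 * theta3D_sq_relation z hτ

omit hτ h2 h3 h4 in
/-- Divided form of `theta1D_second_log_deriv_theta2` and its analogues, the constant `J = θ₁'(0)`
being rewritten by Jacobi's formula. -/
lemma second_log_deriv_div_aux {g : ℂ} (n c d J t : ℂ) (hg : g ≠ 0)
    (h : (theta1D 2 z τ * theta1D 0 z τ - theta1D 1 z τ ^ 2) * g ^ 2
      = theta1D 0 z τ ^ 2 * (g * n) - t ^ 2 * J ^ 2) (hJ : J = Real.pi * (c * g * d)) :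
    (theta1D 2 z τ * theta1D 0 z τ - theta1D 1 z τ ^ 2) / theta1D 0 z τ ^ 2 = n / g -
      Real.pi ^ 2 * c ^ 2 * d ^ 2 * t ^ 2 / theta1D 0 z τ ^ 2 := by
  rw [hJ] at h
  field_simp
  refine mul_left_cancel₀ hg ?_
  linear_combination h

/-- `(log θ₁)'' = ϑ₂''/ϑ₂ - h₃ h₄`. -/
lemma second_log_deriv_theta2 :
    (theta1D 2 z τ * theta1D 0 z τ - theta1D 1 z τ ^ 2) / theta1D 0 z τ ^ 2 =
      theta2D 2 0 τ / theta2D 0 0 τ - logDeriv31 z τ * logDeriv41 z τ := by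
  rw [logDeriv31_mul_logDeriv41 h1 h2 h3 h4]
  exact second_log_deriv_div_aux h1 _ _ _ _ _ (theta2D_zero_ne_zero hτ)
    (theta1D_second_log_deriv_theta2 hτ z) (by rw [jacobi_derivative hτ]; ring)

lemma second_log_deriv_theta3 :
    (theta1D 2 z τ * theta1D 0 z τ - theta1D 1 z τ ^ 2) / theta1D 0 z τ ^ 2 =
      theta3D 2 0 τ / theta3D 0 0 τ - logDeriv21 z τ * logDeriv41 z τ := by
  rw [logDeriv21_mul_logDeriv41 h1 h2 h3 h4]
  exact second_log_deriv_div_aux h1 _ _ _ _ _ (theta3D_zero_ne_zero hτ)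
    (theta1D_second_log_deriv_theta3 hτ z) (by rw [jacobi_derivative hτ])

lemma second_log_deriv_theta4 :
    (theta1D 2 z τ * theta1D 0 z τ - theta1D 1 z τ ^ 2) / theta1D 0 z τ ^ 2 =
      theta4D 2 0 τ / theta4D 0 0 τ - logDeriv21 z τ * logDeriv31 z τ := by
  rw [logDeriv21_mul_logDeriv31 h1 h2 h3 h4]
  exact second_log_deriv_div_aux h1 _ _ _ _ _ (theta4D_zero_ne_zero hτ)
    (theta1D_second_log_deriv_theta4 hτ z) (by rw [jacobi_derivative hτ]; ring)

omit h3 h4 in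
lemma theta2D_one_eq : theta2D 1 z τ =
    theta2D 0 z τ * (theta1D 1 z τ / theta1D 0 z τ + logDeriv21 z τ) := by
  rw [logDeriv21]
  field_simp
  linear_combination theta12_wronskian hτ z
omit h2 h4 in
lemma theta3D_one_eq : theta3D 1 z τ =
    theta3D 0 z τ * (theta1D 1 z τ / theta1D 0 z τ + logDeriv31 z τ) := by
  rw [logDeriv31]
  field_simp
  linear_combination theta13_wronskian hτ h3
omit h2 h3 in
lemma theta4D_one_eq : theta4D 1 z τ =
    theta4D 0 z τ * (theta1D 1 z τ / theta1D 0 z τ + logDeriv41 z τ) := by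
  rw [logDeriv41]
  field_simp
  linear_combination theta14_wronskian hτ h4
end nonzero

/-- Differentiating a Wronskian relation `g' f - g f' = c k l`. -/
lemma wronskian_deriv {f g k l : ℂ → ℂ} {f' f'' g' g'' : ℂ → ℂ} {k' l' c z : ℂ}
    (hf : ∀ z, HasDerivAt f (f' z) z) (hg : ∀ z, HasDerivAt g (g' z) z)
    (hf' : HasDerivAt f' (f'' z) z) (hg' : HasDerivAt g' (g'' z) z)
    (hk : HasDerivAt k k' z) (hl : HasDerivAt l l' z)
    (h : ∀ᶠ w in 𝓝 z, g' w * f w - g w * f' w = c * (k w * l w)) :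
    g'' z * f z - g z * f'' z = c * (k' * l z + k z * l') := by
  have e1 := (hg'.mul (hf z)).sub ((hg z).mul hf')
  have e2 := (hk.mul hl).const_mul c
  have e3 := e1.unique (e2.congr_of_eventuallyEq h)
  linear_combination e3

/-- The derivative of `g / f` along a curve, for solutions `f`, `g` of the heat equation whose
Wronskian is `c k l`. The `τ`-derivative along the curve is `a ∂_z + ∂_z² / κ`. -/
lemma theta_ratio_deriv {F G : ℂ → ℂ} {τ a κ f f' f'' g g' g'' k k' l l' c hg hk hl : ℂ}
    (hκ : κ ≠ 0) (hf0 : f ≠ 0) (hF : HasDerivAt F (a * f' + f'' / κ) τ)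
    (hG : HasDerivAt G (a * g' + g'' / κ) τ) (hFτ : F τ = f) (hGτ : G τ = g)
    (hW : g' * f - g * f' = c * (k * l)) (hW' : g'' * f - g * f'' = c * (k' * l + k * l'))
    (hk' : k' = k * (f' / f + hk)) (hl' : l' = l * (f' / f + hl))
    (hh : g' = g * (f' / f + hg)) :
    HasDerivAt (fun τ => G τ / F τ)
      (g / f * (hg * (hk + hl + 2 * (f' / f + κ * a / 2))) / κ) τ := by
  have hF0 : F τ ≠ 0 := by rw [hFτ]; exact hf0
  refine (hG.div hF hF0).congr_deriv ?_
  rw [hFτ, hGτ]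
  have hc : c * (k * l) = g * hg * f := by
    rw [← hW, hh]; field_simp; ring
  have e : (a * g' + g'' / κ) * f - g * (a * f' + f'' / κ)
      = a * (g' * f - g * f') + (g'' * f - g * f'') / κ := by ring
  rw [e, hW, hW', hk', hl']
  have e2 : c * (k * (f' / f + hk) * l + k * (l * (f' / f + hl)))
      = (c * (k * l)) * (2 * (f' / f) + hk + hl) := by ring
  rw [e2, hc]
  field_simp
  ring

section curve
variable {a b τ : ℂ} (hτ : 0 < τ.im) (h1 : theta1D 0 (a * τ + b) τ ≠ 0)
  (h2 : theta2D 0 (a * τ + b) τ ≠ 0) (h3 : theta3D 0 (a * τ + b) τ ≠ 0)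
  (h4 : theta4D 0 (a * τ + b) τ ≠ 0)

include hτ in
lemma hasDerivAt_theta1D_curve (k : ℕ) : HasDerivAt (fun τ => theta1D k (a * τ + b) τ)
    (a * theta1D (k + 1) (a * τ + b) τ + theta1D (k + 2) (a * τ + b) τ / (4 * Real.pi * I)) τ := by
  refine (hasDerivAt_thetaD_curve k 1 1 a b hτ).neg.congr_deriv ?_
  simp only [theta1D]; ring
include hτ in
lemma hasDerivAt_theta2D_curve (k : ℕ) : HasDerivAt (fun τ => theta2D k (a * τ + b) τ)
    (a * theta2D (k + 1) (a * τ + b) τ + theta2D (k + 2) (a * τ + b) τ / (4 * Real.pi * I)) τ :=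
  hasDerivAt_thetaD_curve k 1 0 a b hτ
include hτ in
lemma hasDerivAt_theta3D_curve (k : ℕ) : HasDerivAt (fun τ => theta3D k (a * τ + b) τ)
    (a * theta3D (k + 1) (a * τ + b) τ + theta3D (k + 2) (a * τ + b) τ / (4 * Real.pi * I)) τ :=
  hasDerivAt_thetaD_curve k 0 0 a b hτ
include hτ in
lemma hasDerivAt_theta4D_curve (k : ℕ) : HasDerivAt (fun τ => theta4D k (a * τ + b) τ)
    (a * theta4D (k + 1) (a * τ + b) τ + theta4D (k + 2) (a * τ + b) τ / (4 * Real.pi * I)) τ :=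
  hasDerivAt_thetaD_curve k 0 1 a b hτ

include hτ in
lemma hasDerivAt_theta2D_zero : HasDerivAt (fun τ => theta2D 0 0 τ)
    (theta2D 0 0 τ * (theta2D 2 0 τ / theta2D 0 0 τ) / (4 * Real.pi * I)) τ := by
  rw [mul_div_cancel₀ _ (theta2D_zero_ne_zero hτ)]
  simpa using hasDerivAt_theta2D_curve (a := 0) (b := 0) hτ 0
include hτ in
lemma hasDerivAt_theta3D_zero : HasDerivAt (fun τ => theta3D 0 0 τ)
    (theta3D 0 0 τ * (theta3D 2 0 τ / theta3D 0 0 τ) / (4 * Real.pi * I)) τ := by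
  rw [mul_div_cancel₀ _ (theta3D_zero_ne_zero hτ)]
  simpa using hasDerivAt_theta3D_curve (a := 0) (b := 0) hτ 0
include hτ in
lemma hasDerivAt_theta4D_zero : HasDerivAt (fun τ => theta4D 0 0 τ)
    (theta4D 0 0 τ * (theta4D 2 0 τ / theta4D 0 0 τ) / (4 * Real.pi * I)) τ := by
  rw [mul_div_cancel₀ _ (theta4D_zero_ne_zero hτ)]
  simpa using hasDerivAt_theta4D_curve (a := 0) (b := 0) hτ 0

lemma four_pi_I_ne_zero : (4 * Real.pi * I : ℂ) ≠ 0 := by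
  have hπ : (Real.pi : ℂ) ≠ 0 := by exact_mod_cast Real.pi_ne_zero
  simp [hπ]

include hτ h1 h2 h3 h4

/-- `4πi d/dτ log (θ₂/θ₁) = h₂ (h₃ + h₄ + 2 P)` along `z = a τ + b`. -/
lemma hasDerivAt_ratio21 : HasDerivAt
    (fun τ => theta2D 0 (a * τ + b) τ / theta1D 0 (a * τ + b) τ)
    (theta2D 0 (a * τ + b) τ / theta1D 0 (a * τ + b) τ * (logDeriv21 (a * τ + b) τ *
      (logDeriv31 (a * τ + b) τ + logDeriv41 (a * τ + b) τ
        + 2 * shiftedLogDeriv a (a * τ + b) τ)) / (4 * Real.pi * I)) τ := by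
  have hW := wronskian_deriv (f := fun z => theta1D 0 z τ) (f' := fun z => theta1D 1 z τ)
    (f'' := fun z => theta1D 2 z τ) (g := fun z => theta2D 0 z τ) (g' := fun z => theta2D 1 z τ)
    (g'' := fun z => theta2D 2 z τ)
    (fun z => hasDerivAt_theta1D 0 z hτ) (fun z => hasDerivAt_theta2D 0 z hτ)
    (hasDerivAt_theta1D 1 (a * τ + b) hτ) (hasDerivAt_theta2D 1 (a * τ + b) hτ)
    (hasDerivAt_theta3D 0 (a * τ + b) hτ) (hasDerivAt_theta4D 0 (a * τ + b) hτ)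
    (Eventually.of_forall fun w => theta12_wronskian hτ w)
  refine (theta_ratio_deriv four_pi_I_ne_zero h1 (hasDerivAt_theta1D_curve hτ 0)
    (hasDerivAt_theta2D_curve hτ 0) rfl rfl (theta12_wronskian hτ _) hW
    (theta3D_one_eq hτ h1 h3) (theta4D_one_eq hτ h1 h4)
    (theta2D_one_eq hτ h1 h2)).congr_deriv ?_
  rw [shiftedLogDeriv]
  ring_nf

lemma hasDerivAt_ratio31 : HasDerivAt
    (fun τ => theta3D 0 (a * τ + b) τ / theta1D 0 (a * τ + b) τ)
    (theta3D 0 (a * τ + b) τ / theta1D 0 (a * τ + b) τ * (logDeriv31 (a * τ + b) τ *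
      (logDeriv21 (a * τ + b) τ + logDeriv41 (a * τ + b) τ
        + 2 * shiftedLogDeriv a (a * τ + b) τ)) / (4 * Real.pi * I)) τ := by
  have hW := wronskian_deriv (f := fun z => theta1D 0 z τ) (f' := fun z => theta1D 1 z τ)
    (f'' := fun z => theta1D 2 z τ) (g := fun z => theta3D 0 z τ) (g' := fun z => theta3D 1 z τ)
    (g'' := fun z => theta3D 2 z τ)
    (fun z => hasDerivAt_theta1D 0 z hτ) (fun z => hasDerivAt_theta3D 0 z hτ)
    (hasDerivAt_theta1D 1 (a * τ + b) hτ) (hasDerivAt_theta3D 1 (a * τ + b) hτ)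
    (hasDerivAt_theta2D 0 (a * τ + b) hτ) (hasDerivAt_theta4D 0 (a * τ + b) hτ)
    (((hasDerivAt_theta3D 0 (a * τ + b) hτ).continuousAt.eventually_ne h3).mono
      fun w hw => theta13_wronskian hτ hw)
  refine (theta_ratio_deriv four_pi_I_ne_zero h1 (hasDerivAt_theta1D_curve hτ 0)
    (hasDerivAt_theta3D_curve hτ 0) rfl rfl (theta13_wronskian hτ h3) hW
    (theta2D_one_eq hτ h1 h2) (theta4D_one_eq hτ h1 h4)
    (theta3D_one_eq hτ h1 h3)).congr_deriv ?_
  rw [shiftedLogDeriv]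
  ring_nf

lemma hasDerivAt_ratio41 : HasDerivAt
    (fun τ => theta4D 0 (a * τ + b) τ / theta1D 0 (a * τ + b) τ)
    (theta4D 0 (a * τ + b) τ / theta1D 0 (a * τ + b) τ * (logDeriv41 (a * τ + b) τ *
      (logDeriv21 (a * τ + b) τ + logDeriv31 (a * τ + b) τ
        + 2 * shiftedLogDeriv a (a * τ + b) τ)) / (4 * Real.pi * I)) τ := by
  have hW := wronskian_deriv (f := fun z => theta1D 0 z τ) (f' := fun z => theta1D 1 z τ)
    (f'' := fun z => theta1D 2 z τ) (g := fun z => theta4D 0 z τ) (g' := fun z => theta4D 1 z τ)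
    (g'' := fun z => theta4D 2 z τ)
    (fun z => hasDerivAt_theta1D 0 z hτ) (fun z => hasDerivAt_theta4D 0 z hτ)
    (hasDerivAt_theta1D 1 (a * τ + b) hτ) (hasDerivAt_theta4D 1 (a * τ + b) hτ)
    (hasDerivAt_theta2D 0 (a * τ + b) hτ) (hasDerivAt_theta3D 0 (a * τ + b) hτ)
    (((hasDerivAt_theta4D 0 (a * τ + b) hτ).continuousAt.eventually_ne h4).mono
      fun w hw => theta14_wronskian hτ hw)
  refine (theta_ratio_deriv four_pi_I_ne_zero h1 (hasDerivAt_theta1D_curve hτ 0)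
    (hasDerivAt_theta4D_curve hτ 0) rfl rfl (theta14_wronskian hτ h4) hW
    (theta2D_one_eq hτ h1 h2) (theta3D_one_eq hτ h1 h3)
    (theta4D_one_eq hτ h1 h4)).congr_deriv ?_
  rw [shiftedLogDeriv]
  ring_nf

omit hτ h1 h2 h3 h4 in
/-- Logarithmic differentiation of `C c² r s / t`. -/
lemma hasDerivAt_const_mul_sq_mul_div {c r s t : ℂ → ℂ} {C n α β γ κ : ℂ} (ht : t τ ≠ 0)
    (hc : HasDerivAt c (c τ * n / κ) τ) (hr : HasDerivAt r (r τ * α / κ) τ)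
    (hs : HasDerivAt s (s τ * β / κ) τ) (htd : HasDerivAt t (t τ * γ / κ) τ) :
    HasDerivAt (fun τ => C * c τ ^ 2 * (r τ * s τ / t τ))
      (C * c τ ^ 2 * (r τ * s τ / t τ) * ((2 * n + α + β - γ) / κ)) τ := by
  refine (((hc.pow 2).const_mul C).mul ((hr.mul hs).div htd ht)).congr_deriv ?_
  simp only [Pi.mul_apply, Pi.div_apply, Pi.pow_apply]
  field_simp
  push_cast
  ring

/-- `4πi dh₂/dτ = h₂ (2 ϑ₂''/ϑ₂ + 2 h₃ h₄ + 2 P (h₃ + h₄ - h₂))` along `z = a τ + b`. -/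
lemma hasDerivAt_logDeriv21 : HasDerivAt (fun τ => logDeriv21 (a * τ + b) τ)
    (logDeriv21 (a * τ + b) τ * ((2 * (theta2D 2 0 τ / theta2D 0 0 τ)
      + 2 * (logDeriv31 (a * τ + b) τ * logDeriv41 (a * τ + b) τ)
      + 2 * shiftedLogDeriv a (a * τ + b) τ * (logDeriv31 (a * τ + b) τ
        + logDeriv41 (a * τ + b) τ - logDeriv21 (a * τ + b) τ)) / (4 * Real.pi * I))) τ := by
  refine (hasDerivAt_const_mul_sq_mul_div (τ := τ) (C := -Real.pi) (c := fun τ => theta2D 0 0 τ)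
    (r := fun τ => theta3D 0 (a * τ + b) τ / theta1D 0 (a * τ + b) τ)
    (s := fun τ => theta4D 0 (a * τ + b) τ / theta1D 0 (a * τ + b) τ)
    (t := fun τ => theta2D 0 (a * τ + b) τ / theta1D 0 (a * τ + b) τ) (div_ne_zero h2 h1)
    (hasDerivAt_theta2D_zero hτ)
    (hasDerivAt_ratio31 hτ h1 h2 h3 h4) (hasDerivAt_ratio41 hτ h1 h2 h3 h4)
    (hasDerivAt_ratio21 hτ h1 h2 h3 h4)).congr_deriv ?_
  rw [← logDeriv21]
  ring

lemma hasDerivAt_logDeriv31 : HasDerivAt (fun τ => logDeriv31 (a * τ + b) τ)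
    (logDeriv31 (a * τ + b) τ * ((2 * (theta3D 2 0 τ / theta3D 0 0 τ)
      + 2 * (logDeriv21 (a * τ + b) τ * logDeriv41 (a * τ + b) τ)
      + 2 * shiftedLogDeriv a (a * τ + b) τ * (logDeriv21 (a * τ + b) τ
        + logDeriv41 (a * τ + b) τ - logDeriv31 (a * τ + b) τ)) / (4 * Real.pi * I))) τ := by
  refine (hasDerivAt_const_mul_sq_mul_div (τ := τ) (C := -Real.pi) (c := fun τ => theta3D 0 0 τ)
    (r := fun τ => theta2D 0 (a * τ + b) τ / theta1D 0 (a * τ + b) τ)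
    (s := fun τ => theta4D 0 (a * τ + b) τ / theta1D 0 (a * τ + b) τ)
    (t := fun τ => theta3D 0 (a * τ + b) τ / theta1D 0 (a * τ + b) τ) (div_ne_zero h3 h1)
    (hasDerivAt_theta3D_zero hτ)
    (hasDerivAt_ratio21 hτ h1 h2 h3 h4) (hasDerivAt_ratio41 hτ h1 h2 h3 h4)
    (hasDerivAt_ratio31 hτ h1 h2 h3 h4)).congr_deriv ?_
  rw [← logDeriv31]
  ring

lemma hasDerivAt_logDeriv41 : HasDerivAt (fun τ => logDeriv41 (a * τ + b) τ)
    (logDeriv41 (a * τ + b) τ * ((2 * (theta4D 2 0 τ / theta4D 0 0 τ)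
      + 2 * (logDeriv21 (a * τ + b) τ * logDeriv31 (a * τ + b) τ)
      + 2 * shiftedLogDeriv a (a * τ + b) τ * (logDeriv21 (a * τ + b) τ
        + logDeriv31 (a * τ + b) τ - logDeriv41 (a * τ + b) τ)) / (4 * Real.pi * I))) τ := by
  refine (hasDerivAt_const_mul_sq_mul_div (τ := τ) (C := -Real.pi) (c := fun τ => theta4D 0 0 τ)
    (r := fun τ => theta2D 0 (a * τ + b) τ / theta1D 0 (a * τ + b) τ)
    (s := fun τ => theta3D 0 (a * τ + b) τ / theta1D 0 (a * τ + b) τ)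
    (t := fun τ => theta4D 0 (a * τ + b) τ / theta1D 0 (a * τ + b) τ) (div_ne_zero h4 h1)
    (hasDerivAt_theta4D_zero hτ)
    (hasDerivAt_ratio21 hτ h1 h2 h3 h4) (hasDerivAt_ratio31 hτ h1 h2 h3 h4)
    (hasDerivAt_ratio41 hτ h1 h2 h3 h4)).congr_deriv ?_
  rw [← logDeriv41]
  ring

/-- `4πi dP/dτ = -2 h₂ h₃ h₄ + 2 P (ϑ₃''/ϑ₃ - h₂ h₄)` along `z = a τ + b`. The third `z`-derivative
of `θ₁` is eliminated by differentiating the formula for `(log θ₁)''`. -/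
lemma hasDerivAt_shiftedLogDeriv : HasDerivAt (fun τ => shiftedLogDeriv a (a * τ + b) τ)
    ((-2 * (logDeriv21 (a * τ + b) τ * logDeriv31 (a * τ + b) τ * logDeriv41 (a * τ + b) τ)
      + 2 * shiftedLogDeriv a (a * τ + b) τ * (theta3D 2 0 τ / theta3D 0 0 τ
        - logDeriv21 (a * τ + b) τ * logDeriv41 (a * τ + b) τ)) / (4 * Real.pi * I)) τ := by
  set z := a * τ + b
  have hκ := four_pi_I_ne_zero
  have a3 := theta3D_zero_ne_zero hτ
  have e0 := ((((hasDerivAt_theta1D 2 z hτ).mul (hasDerivAt_theta1D 0 z hτ)).sub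
    ((hasDerivAt_theta1D 1 z hτ).pow 2)).mul_const (theta3D 0 0 τ ^ 2)).unique
    (((((hasDerivAt_theta1D 0 z hτ).pow 2).mul_const (theta3D 0 0 τ * theta3D 2 0 τ)).sub
      (((hasDerivAt_theta3D 0 z hτ).pow 2).mul_const (theta1D 1 0 τ ^ 2))).congr_of_eventuallyEq
      (Eventually.of_forall fun z => theta1D_second_log_deriv_theta3 hτ z))
  norm_num [theta3D_one_eq hτ h1 h3, jacobi_derivative hτ] at e0
  have e1 : (theta1D 3 z τ * theta1D 0 z τ - theta1D 1 z τ * theta1D 2 z τ) / theta1D 0 z τ ^ 2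
      = 2 * (theta1D 1 z τ / theta1D 0 z τ) * (theta3D 2 0 τ / theta3D 0 0 τ)
        - 2 * (logDeriv21 z τ * logDeriv41 z τ)
          * (theta1D 1 z τ / theta1D 0 z τ + logDeriv31 z τ) := by
    rw [logDeriv21_mul_logDeriv41 h1 h2 h3 h4]
    field_simp
    field_simp at e0
    linear_combination e0
  have e2 := second_log_deriv_theta3 hτ h1 h2 h3 h4
  have hd := ((hasDerivAt_theta1D_curve (a := a) (b := b) hτ 1).div
    (hasDerivAt_theta1D_curve hτ 0) h1).add_const (2 * Real.pi * I * a)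
  refine hd.congr_deriv ?_
  have e3 : ((a * theta1D (1 + 1) z τ + theta1D (1 + 2) z τ / (4 * Real.pi * I)) * theta1D 0 z τ
      - theta1D 1 z τ * (a * theta1D (0 + 1) z τ + theta1D (0 + 2) z τ / (4 * Real.pi * I)))
        / theta1D 0 z τ ^ 2
      = a * ((theta1D 2 z τ * theta1D 0 z τ - theta1D 1 z τ ^ 2) / theta1D 0 z τ ^ 2)
        + ((theta1D 3 z τ * theta1D 0 z τ - theta1D 1 z τ * theta1D 2 z τ) / theta1D 0 z τ ^ 2)
          / (4 * Real.pi * I) := by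
    norm_num
    ring
  rw [e3, e1, e2, shiftedLogDeriv]
  field_simp
  ring
end curve

/-! ### The Hamiltonian system in the variable `τ` -/

/-- The first equation, for quotients built from functions `F₂`, `F₃`, `F₄`, `P`, `W` with the
derivatives of `logDeriv21`, `logDeriv31`, `logDeriv41`, `shiftedLogDeriv` and `π² ϑ₃⁴`. -/
lemma hasDerivAt_hamiltonian_fst {F₂ F₃ F₄ P W : ℂ → ℂ} {τ h₂ h₃ h₄ p w n₂ n₃ n₄ x κ : ℂ}
    (e2 : F₂ τ = h₂) (e3 : F₃ τ = h₃) (e4 : F₄ τ = h₄) (eP : P τ = p) (eW : W τ = w)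
    (hh2 : h₂ ≠ 0) (hh3 : h₃ ≠ 0) (hh4 : h₄ ≠ 0) (hp : p ≠ 0) (hw : w ≠ 0) (hκ : κ ≠ 0)
    (w1 : w = h₃ * (h₂ - h₄)) (w2 : x * w = h₄ * (h₂ - h₃))
    (hn2 : n₂ = n₃ + h₃ * h₄ - h₂ * h₄) (hn4 : n₄ = n₃ + h₂ * h₃ - h₂ * h₄)
    (d2 : HasDerivAt F₂ (h₂ * ((2 * n₂ + 2 * (h₃ * h₄) + 2 * p * (h₃ + h₄ - h₂)) / κ)) τ)
    (d3 : HasDerivAt F₃ (h₃ * ((2 * n₃ + 2 * (h₂ * h₄) + 2 * p * (h₂ + h₄ - h₃)) / κ)) τ)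
    (d4 : HasDerivAt F₄ (h₄ * ((2 * n₄ + 2 * (h₂ * h₃) + 2 * p * (h₂ + h₃ - h₄)) / κ)) τ)
    (dP : HasDerivAt P ((-2 * (h₂ * h₃ * h₄) + 2 * p * (n₃ - h₂ * h₄)) / κ) τ)
    (dW : HasDerivAt W (w * (4 * n₃) / κ) τ)
    {y u : ℂ} (hy : y = -(h₃ * h₄ * (p + h₂)) / (w * p)) (hu : u = -(w * p) / (h₂ * h₃ * h₄)) :
    HasDerivAt (fun τ => -(F₃ τ * F₄ τ * (P τ + F₂ τ)) / (W τ * P τ))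
      (-(4 * w / κ) * (-1 / 2 * y ^ 2 + x * y - 1 / 2 * x + u * (y * (y - 1) * (y - x)))) τ := by
  have hx : x = h₄ * (h₂ - h₃) / w := by rw [← w2]; field_simp
  have h24 : h₂ - h₄ ≠ 0 := fun h => hw (by rw [w1, h, mul_zero])
  refine ((((d3.mul d4).mul (dP.add d2)).neg).div (dW.mul dP)
    (by simp [eW, eP, hw, hp])).congr_deriv ?_
  simp only [Pi.mul_apply, Pi.add_apply, Pi.neg_apply, e2, e3, e4, eP, eW]
  rw [hy, hu, hx, hn2, hn4, w1]
  field_simp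
  ring

/-- The second equation, under the same hypotheses. -/
lemma hasDerivAt_hamiltonian_snd {F₂ F₃ F₄ P W : ℂ → ℂ} {τ h₂ h₃ h₄ p w n₂ n₃ n₄ x κ : ℂ}
    (e2 : F₂ τ = h₂) (e3 : F₃ τ = h₃) (e4 : F₄ τ = h₄) (eP : P τ = p) (eW : W τ = w)
    (hh2 : h₂ ≠ 0) (hh3 : h₃ ≠ 0) (hh4 : h₄ ≠ 0) (hp : p ≠ 0) (hw : w ≠ 0) (hκ : κ ≠ 0)
    (w1 : w = h₃ * (h₂ - h₄)) (w2 : x * w = h₄ * (h₂ - h₃))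
    (hn2 : n₂ = n₃ + h₃ * h₄ - h₂ * h₄) (hn4 : n₄ = n₃ + h₂ * h₃ - h₂ * h₄)
    (d2 : HasDerivAt F₂ (h₂ * ((2 * n₂ + 2 * (h₃ * h₄) + 2 * p * (h₃ + h₄ - h₂)) / κ)) τ)
    (d3 : HasDerivAt F₃ (h₃ * ((2 * n₃ + 2 * (h₂ * h₄) + 2 * p * (h₂ + h₄ - h₃)) / κ)) τ)
    (d4 : HasDerivAt F₄ (h₄ * ((2 * n₄ + 2 * (h₂ * h₃) + 2 * p * (h₂ + h₃ - h₄)) / κ)) τ)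
    (dP : HasDerivAt P ((-2 * (h₂ * h₃ * h₄) + 2 * p * (n₃ - h₂ * h₄)) / κ) τ)
    (dW : HasDerivAt W (w * (4 * n₃) / κ) τ)
    {y u : ℂ} (hy : y = -(h₃ * h₄ * (p + h₂)) / (w * p)) (hu : u = -(w * p) / (h₂ * h₃ * h₄)) :
    HasDerivAt (fun τ => -(W τ * P τ) / (F₂ τ * F₃ τ * F₄ τ))
      (-(4 * w / κ) * (-1 / 2 * u ^ 2 * (3 * y ^ 2 - 2 * (1 + x) * y + x) + u * (y - x))) τ := by
  have hx : x = h₄ * (h₂ - h₃) / w := by rw [← w2]; field_simp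
  have h24 : h₂ - h₄ ≠ 0 := fun h => hw (by rw [w1, h, mul_zero])
  refine (((dW.mul dP).neg).div ((d2.mul d3).mul d4)
    (by simp [e2, e3, e4, hh2, hh3, hh4])).congr_deriv ?_
  simp only [Pi.mul_apply, Pi.neg_apply, e2, e3, e4, eP, eW]
  rw [hy, hu, hx, hn2, hn4, w1]
  field_simp
  ring

/-- Genericity of the point `z` for the parameter `a`: the theta functions at `z` and `θ₁' + 2πi a θ₁` do not vanish. -/
structure IsGeneric (a z τ : ℂ) : Prop where
  theta1_ne : theta1D 0 z τ ≠ 0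
  theta2_ne : theta2D 0 z τ ≠ 0
  theta3_ne : theta3D 0 z τ ≠ 0
  theta4_ne : theta4D 0 z τ ≠ 0
  logDeriv_ne : shiftedLogDeriv a z τ ≠ 0

/-- The solution `y_{A,B}` in terms of logarithmic derivatives of theta quotients. -/
noncomputable def hamiltonianY (a z τ : ℂ) : ℂ :=
  -(logDeriv31 z τ * logDeriv41 z τ * (shiftedLogDeriv a z τ + logDeriv21 z τ)) /
    (Real.pi ^ 2 * theta3D 0 0 τ ^ 4 * shiftedLogDeriv a z τ)

/-- The momentum conjugate to `hamiltonianY`. -/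
noncomputable def hamiltonianU (a z τ : ℂ) : ℂ :=
  -(Real.pi ^ 2 * theta3D 0 0 τ ^ 4 * shiftedLogDeriv a z τ) /
    (logDeriv21 z τ * logDeriv31 z τ * logDeriv41 z τ)

/-- The right-hand side of the equation for `x (x - 1) y'` in the Hamiltonian system. -/
noncomputable def hamiltonianRHS₁ (x y u : ℂ) : ℂ :=
  -1 / 2 * y ^ 2 + x * y - 1 / 2 * x + u * (y * (y - 1) * (y - x))

/-- The right-hand side of the equation for `x (x - 1) u'` in the Hamiltonian system. -/
noncomputable def hamiltonianRHS₂ (x y u : ℂ) : ℂ :=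
  -1 / 2 * u ^ 2 * (3 * y ^ 2 - 2 * (1 + x) * y + x) + u * (y - x)

lemma pi_sq_mul_theta3D_ne_zero {τ : ℂ} (hτ : 0 < τ.im) :
    (Real.pi ^ 2 * theta3D 0 0 τ ^ 4 : ℂ) ≠ 0 := by
  have := theta3D_zero_ne_zero hτ
  have hπ : (Real.pi : ℂ) ≠ 0 := by exact_mod_cast Real.pi_ne_zero
  simp [*]

lemma hasDerivAt_pi_sq_mul_theta3D {τ : ℂ} (hτ : 0 < τ.im) :
    HasDerivAt (fun τ => (Real.pi ^ 2 * theta3D 0 0 τ ^ 4 : ℂ))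
      (Real.pi ^ 2 * theta3D 0 0 τ ^ 4 * (4 * (theta3D 2 0 τ / theta3D 0 0 τ))
        / (4 * Real.pi * I)) τ := by
  refine (((hasDerivAt_theta3D_zero hτ).pow 4).const_mul _).congr_deriv ?_
  push_cast
  ring

/-- `x ω² = h₄ (h₂ - h₃)` for `x = ϑ₄⁴ / ϑ₃⁴`. -/
lemma modulus_mul_theta3D {x z τ : ℂ} (hτ : 0 < τ.im) (hx : x * theta3D 0 0 τ ^ 4 = theta4D 0 0 τ ^ 4)
    (h1 : theta1D 0 z τ ≠ 0) (h2 : theta2D 0 z τ ≠ 0) (h3 : theta3D 0 z τ ≠ 0)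
    (h4 : theta4D 0 z τ ≠ 0) :
    x * (Real.pi ^ 2 * theta3D 0 0 τ ^ 4) =
      logDeriv41 z τ * (logDeriv21 z τ - logDeriv31 z τ) := by
  rw [← pi_sq_mul_theta4D_pow_four hτ h1 h2 h3 h4, ← hx]
  ring

lemma hasDerivAt_hamiltonianY {a b τ x : ℂ} (hτ : 0 < τ.im)
    (hx : x * theta3D 0 0 τ ^ 4 = theta4D 0 0 τ ^ 4) (h : IsGeneric a (a * τ + b) τ) :
    HasDerivAt (fun τ => hamiltonianY a (a * τ + b) τ)
      (-(4 * (Real.pi ^ 2 * theta3D 0 0 τ ^ 4) / (4 * Real.pi * I)) * hamiltonianRHS₁ x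
        (hamiltonianY a (a * τ + b) τ) (hamiltonianU a (a * τ + b) τ)) τ := by
  obtain ⟨h1, h2, h3, h4, hP⟩ := h
  have s2 := second_log_deriv_theta2 hτ h1 h2 h3 h4
  have s3 := second_log_deriv_theta3 hτ h1 h2 h3 h4
  have s4 := second_log_deriv_theta4 hτ h1 h2 h3 h4
  exact hasDerivAt_hamiltonian_fst (F₂ := fun τ => logDeriv21 (a * τ + b) τ)
    (F₃ := fun τ => logDeriv31 (a * τ + b) τ) (F₄ := fun τ => logDeriv41 (a * τ + b) τ)
    (P := fun τ => shiftedLogDeriv a (a * τ + b) τ) (W := fun τ => Real.pi ^ 2 * theta3D 0 0 τ ^ 4)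
    rfl rfl rfl rfl rfl (logDeriv21_ne_zero hτ h1 h2 h3 h4)
    (logDeriv31_ne_zero hτ h1 h2 h3 h4) (logDeriv41_ne_zero hτ h1 h2 h3 h4) hP
    (pi_sq_mul_theta3D_ne_zero hτ) four_pi_I_ne_zero (pi_sq_mul_theta3D_pow_four hτ h1 h2 h3 h4)
    (modulus_mul_theta3D hτ hx h1 h2 h3 h4) (by linear_combination s3 - s2)
    (by linear_combination s3 - s4) (hasDerivAt_logDeriv21 hτ h1 h2 h3 h4)
    (hasDerivAt_logDeriv31 hτ h1 h2 h3 h4) (hasDerivAt_logDeriv41 hτ h1 h2 h3 h4)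
    (hasDerivAt_shiftedLogDeriv hτ h1 h2 h3 h4) (hasDerivAt_pi_sq_mul_theta3D hτ) rfl rfl

lemma hasDerivAt_hamiltonianU {a b τ x : ℂ} (hτ : 0 < τ.im)
    (hx : x * theta3D 0 0 τ ^ 4 = theta4D 0 0 τ ^ 4) (h : IsGeneric a (a * τ + b) τ) :
    HasDerivAt (fun τ => hamiltonianU a (a * τ + b) τ)
      (-(4 * (Real.pi ^ 2 * theta3D 0 0 τ ^ 4) / (4 * Real.pi * I)) * hamiltonianRHS₂ x
        (hamiltonianY a (a * τ + b) τ) (hamiltonianU a (a * τ + b) τ)) τ := by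
  obtain ⟨h1, h2, h3, h4, hP⟩ := h
  have s2 := second_log_deriv_theta2 hτ h1 h2 h3 h4
  have s3 := second_log_deriv_theta3 hτ h1 h2 h3 h4
  have s4 := second_log_deriv_theta4 hτ h1 h2 h3 h4
  exact hasDerivAt_hamiltonian_snd (F₂ := fun τ => logDeriv21 (a * τ + b) τ)
    (F₃ := fun τ => logDeriv31 (a * τ + b) τ) (F₄ := fun τ => logDeriv41 (a * τ + b) τ)
    (P := fun τ => shiftedLogDeriv a (a * τ + b) τ) (W := fun τ => Real.pi ^ 2 * theta3D 0 0 τ ^ 4)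
    rfl rfl rfl rfl rfl (logDeriv21_ne_zero hτ h1 h2 h3 h4)
    (logDeriv31_ne_zero hτ h1 h2 h3 h4) (logDeriv41_ne_zero hτ h1 h2 h3 h4) hP
    (pi_sq_mul_theta3D_ne_zero hτ) four_pi_I_ne_zero (pi_sq_mul_theta3D_pow_four hτ h1 h2 h3 h4)
    (modulus_mul_theta3D hτ hx h1 h2 h3 h4) (by linear_combination s3 - s2)
    (by linear_combination s3 - s4) (hasDerivAt_logDeriv21 hτ h1 h2 h3 h4)
    (hasDerivAt_logDeriv31 hτ h1 h2 h3 h4) (hasDerivAt_logDeriv41 hτ h1 h2 h3 h4)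
    (hasDerivAt_shiftedLogDeriv hτ h1 h2 h3 h4) (hasDerivAt_pi_sq_mul_theta3D hτ) rfl rfl

section
variable {a z τ x : ℂ} (hτ : 0 < τ.im) (hx : x * theta3D 0 0 τ ^ 4 = theta4D 0 0 τ ^ 4)
  (h : IsGeneric a z τ)

include hτ h in
/-- `u y - 1 = u q` with `q = -h₃ h₄ / ω²`. -/
lemma hamiltonianU_mul_hamiltonianY : hamiltonianU a z τ * hamiltonianY a z τ - 1 =
    shiftedLogDeriv a z τ / logDeriv21 z τ := by
  obtain ⟨h1, h2, h3, h4, hP⟩ := h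
  have := pi_sq_mul_theta3D_ne_zero hτ
  have := logDeriv21_ne_zero hτ h1 h2 h3 h4
  have := logDeriv31_ne_zero hτ h1 h2 h3 h4
  have := logDeriv41_ne_zero hτ h1 h2 h3 h4
  rw [hamiltonianU, hamiltonianY]
  generalize (Real.pi ^ 2 * theta3D 0 0 τ ^ 4 : ℂ) = w at *
  field_simp
  ring

include hτ h in
/-- `u (y - 1) - 1 = u (q - 1)` with `q - 1 = -h₂ h₃ / ω²`. -/
lemma hamiltonianU_mul_hamiltonianY_sub_one :
    hamiltonianU a z τ * (hamiltonianY a z τ - 1) - 1 =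
    shiftedLogDeriv a z τ / logDeriv41 z τ := by
  rw [mul_sub, sub_right_comm, hamiltonianU_mul_hamiltonianY hτ h, hamiltonianU]
  obtain ⟨h1, h2, h3, h4, hP⟩ := h
  have := logDeriv21_ne_zero hτ h1 h2 h3 h4
  have := logDeriv31_ne_zero hτ h1 h2 h3 h4
  have := logDeriv41_ne_zero hτ h1 h2 h3 h4
  rw [pi_sq_mul_theta3D_pow_four hτ h1 h2 h3 h4]
  field_simp
  ring

include hτ hx h in
/-- `u (y - x) - 1 = u (q - x)` with `q - x = -h₂ h₄ / ω²`. -/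
lemma hamiltonianU_mul_hamiltonianY_sub_self :
    hamiltonianU a z τ * (hamiltonianY a z τ - x) - 1 =
    shiftedLogDeriv a z τ / logDeriv31 z τ := by
  rw [mul_sub, sub_right_comm, hamiltonianU_mul_hamiltonianY hτ h, hamiltonianU]
  obtain ⟨h1, h2, h3, h4, hP⟩ := h
  have := logDeriv21_ne_zero hτ h1 h2 h3 h4
  have := logDeriv31_ne_zero hτ h1 h2 h3 h4
  have := logDeriv41_ne_zero hτ h1 h2 h3 h4
  have e := modulus_mul_theta3D hτ hx h1 h2 h3 h4
  generalize (Real.pi ^ 2 * theta3D 0 0 τ ^ 4 : ℂ) = w at *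
  field_simp
  linear_combination e

include hτ h in
lemma hamiltonianU_ne_zero : hamiltonianU a z τ ≠ 0 := by
  obtain ⟨h1, h2, h3, h4, hP⟩ := h
  have := pi_sq_mul_theta3D_ne_zero hτ
  have := logDeriv21_ne_zero hτ h1 h2 h3 h4
  have := logDeriv31_ne_zero hτ h1 h2 h3 h4
  have := logDeriv41_ne_zero hτ h1 h2 h3 h4
  rw [hamiltonianU]
  simp only [ne_eq, div_eq_zero_iff, neg_eq_zero, mul_eq_zero, not_or] at *
  tauto
end

/-- The argument `A K/K' + B` of the theta functions, as an affine function of `τ`. -/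
lemma theta_argument_eq (A B x : ℂ) :
    A * (ellK x / ellK' x) + B = -I * A * modulus x + B := by
  rw [modulus]
  linear_combination (A * (ellK x / ellK' x)) * I_mul_I

lemma hitchinFormula_eq_hamiltonianY {A B x : ℂ} (hx : x ∈ cutPlane)
    (h : IsGeneric (-I * A) (-I * A * modulus x + B) (modulus x)) :
    hitchinFormula A B x = hamiltonianY (-I * A) (-I * A * modulus x + B) (modulus x) := by
  have hτ := modulus_im_pos hx
  have hP := h.logDeriv_ne
  obtain ⟨h1, h2, h3, h4, -⟩ := h
  have c3 := theta3D_zero_ne_zero hτ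
  have hπ : (Real.pi : ℂ) ≠ 0 := by exact_mod_cast Real.pi_ne_zero
  have e : hitchinFormula A B x = theta4D 0 0 (modulus x) ^ 2 / theta3D 0 0 (modulus x) ^ 2
      / theta1D 0 (-I * A * modulus x + B) (modulus x) ^ 2 *
      (Real.pi * theta2D 0 0 (modulus x) ^ 2 * (theta2D 0 (-I * A * modulus x + B) (modulus x)
        * theta3D 0 (-I * A * modulus x + B) (modulus x)
        * theta4D 0 (-I * A * modulus x + B) (modulus x))
        / (theta1D 1 (-I * A * modulus x + B) (modulus x)
          + 2 * Real.pi * A * theta1D 0 (-I * A * modulus x + B) (modulus x))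
      - theta2D 0 (-I * A * modulus x + B) (modulus x) ^ 2) := by
    rw [← sqrt_eq_theta_quotient hx, ← theta_argument_eq]
    simp only [← theta1_eq, ← theta2_eq, ← theta3_eq, ← theta4_eq, ← dtheta1_eq]
    rfl
  rw [e]
  generalize -I * A * modulus x + B = z at *
  have e2 : theta1D 1 z (modulus x)
          + 2 * Real.pi * A * theta1D 0 z (modulus x)
      = shiftedLogDeriv (-I * A) z (modulus x)
        * theta1D 0 z (modulus x) := by
    rw [shiftedLogDeriv]
    field_simp
    linear_combination (2 * Real.pi * A * theta1D 0 z (modulus x)) * I_sq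
  rw [e2, hamiltonianY, logDeriv31_mul_logDeriv41 h1 h2 h3 h4, logDeriv21]
  generalize shiftedLogDeriv (-I * A) z (modulus x) = P at *
  field_simp
  ring

/-- The pair `(y, u)` satisfies the Hamiltonian system, with independent variable `x`, at the point
`x`. -/
structure IsHamiltonianSolutionAt (y u : ℂ → ℂ) (x : ℂ) : Prop where
  fst : HasDerivAt y (hamiltonianRHS₁ x (y x) (u x) / (x * (x - 1))) x
  snd : HasDerivAt u (hamiltonianRHS₂ x (y x) (u x) / (x * (x - 1))) x

lemma ne_zero_of_mem_cutPlane {x : ℂ} (hx : x ∈ cutPlane) : x ≠ 0 :=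
  slitPlane_ne_zero hx.1

lemma ne_one_of_mem_cutPlane {x : ℂ} (hx : x ∈ cutPlane) : x ≠ 1 := fun h =>
  slitPlane_ne_zero hx.2 (by rw [h, sub_self])

lemma isHamiltonianSolutionAt_modulus {a b x : ℂ} (hx : x ∈ cutPlane)
    (h : IsGeneric a (a * modulus x + b) (modulus x)) :
    IsHamiltonianSolutionAt (fun x => hamiltonianY a (a * modulus x + b) (modulus x))
      (fun x => hamiltonianU a (a * modulus x + b) (modulus x)) x := by
  have hτ := modulus_im_pos hx
  have hw := pi_sq_mul_theta3D_ne_zero hτ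
  have c3 := theta3D_zero_ne_zero hτ
  have hx0 := ne_zero_of_mem_cutPlane hx
  have hx1 : x - 1 ≠ 0 := sub_ne_zero.2 (ne_one_of_mem_cutPlane hx)
  have hx1' : 1 - x ≠ 0 := sub_ne_zero.2 (ne_one_of_mem_cutPlane hx).symm
  have hπ : (Real.pi : ℂ) ≠ 0 := by exact_mod_cast Real.pi_ne_zero
  have hq : x * theta3D 0 0 (modulus x) ^ 4 = theta4D 0 0 (modulus x) ^ 4 := by
    nth_rw 1 [eq_theta_quotient hx]
    field_simp
  -- `-4ω²/(4πi)` times `dτ/dx`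
  have key : -(4 * (Real.pi ^ 2 * theta3D 0 0 (modulus x) ^ 4 : ℂ) / (4 * Real.pi * I))
      * (Real.pi * I / (Real.pi ^ 2 * theta3D 0 0 (modulus x) ^ 4 * (x * (1 - x))))
      = 1 / (x * (x - 1)) := by
    have : (x * (x - 1) : ℂ) = -(x * (1 - x)) := by ring
    rw [this]
    field_simp
  constructor
  · refine ((hasDerivAt_hamiltonianY hτ hq h).comp x (hasDerivAt_modulus hx)).congr_deriv ?_
    rw [mul_right_comm, key]; ring
  · refine ((hasDerivAt_hamiltonianU hτ hq h).comp x (hasDerivAt_modulus hx)).congr_deriv ?_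
    rw [mul_right_comm, key]; ring

/-- Eliminating `u` from the Hamiltonian system gives the sixth Painlevé equation. -/
lemma deriv_deriv_eq_of_hamiltonian {y u : ℂ → ℂ} {x : ℂ}
    (h : ∀ᶠ t in 𝓝 x, IsHamiltonianSolutionAt y u t) (hx0 : x ≠ 0) (hx1 : x ≠ 1)
    (hy0 : y x ≠ 0) (hy1 : y x ≠ 1) (hyx : y x ≠ x) :
    deriv (deriv y) x = painleveSixRHS (1 / 8) (1 / 8) (1 / 8) (1 / 8) x (y x) (deriv y x) := by
  have hd : deriv y =ᶠ[𝓝 x] fun t => hamiltonianRHS₁ t (y t) (u t) / (t * (t - 1)) :=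
    h.mono fun t ht => ht.fst.deriv
  have h0 := h.self_of_nhds
  have hx1' : x - 1 ≠ 0 := sub_ne_zero.2 hx1
  have hy1' : y x - 1 ≠ 0 := sub_ne_zero.2 hy1
  have hyx' : y x - x ≠ 0 := sub_ne_zero.2 hyx
  have dy := h0.fst
  have du := h0.snd
  have did := hasDerivAt_id x
  have dd := ((((dy.pow 2).const_mul (-1 / 2)).add (did.mul dy)).sub (did.const_mul (1 / 2))).add
    (du.mul ((dy.mul (dy.sub_const 1)).mul (dy.sub did)))
  have dd2 := dd.div (did.mul (did.sub_const 1)) (mul_ne_zero hx0 hx1')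
  rw [hd.deriv_eq, hd.self_of_nhds]
  refine (HasDerivAt.deriv (f := fun t => hamiltonianRHS₁ t (y t) (u t) / (t * (t - 1))) dd2).trans ?_
  simp only [Pi.mul_apply, Pi.add_apply, Pi.sub_apply, Pi.pow_apply, id, hamiltonianRHS₁,
    hamiltonianRHS₂, painleveSixRHS]
  generalize y x = Y at *
  generalize u x = V at *
  push_cast
  field_simp
  ring

/-! ### Genericity and meromorphy -/

lemma eventually_eventually_nhdsNE {p : ℂ → Prop} {x : ℂ} (h : ∀ᶠ t in 𝓝[≠] x, p t) :
    ∀ᶠ t in 𝓝[≠] x, ∀ᶠ s in 𝓝 t, p s := by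
  filter_upwards [eventually_eventually_nhdsWithin.2 h, self_mem_nhdsWithin] with t ht htx
  rwa [isOpen_compl_singleton.nhdsWithin_eq htx] at ht

lemma eventually_mem_nhdsNE {U : Set ℂ} (hU : IsOpen U) {x : ℂ} (hx : x ∈ U) :
    ∀ᶠ t in 𝓝[≠] x, t ∈ U :=
  (hU.eventually_mem hx).filter_mono nhdsWithin_le_nhds

lemma analyticAt_of_differentiable_cutPlane {f : ℂ → ℂ} (hf : ∀ x ∈ cutPlane, DifferentiableAt ℂ f x)
    {x : ℂ} (hx : x ∈ cutPlane) : AnalyticAt ℂ f x :=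
  DifferentiableOn.analyticAt (fun t ht => (hf t ht).differentiableWithinAt)
    (isOpen_cutPlane.mem_nhds hx)

section
variable (a b : ℂ) {x : ℂ} (hx : x ∈ cutPlane)
include hx

lemma analyticAt_theta1D_modulus (k : ℕ) :
    AnalyticAt ℂ (fun x => theta1D k (a * modulus x + b) (modulus x)) x :=
  analyticAt_of_differentiable_cutPlane (fun x hx => ((hasDerivAt_theta1D_curve
    (modulus_im_pos hx) k).comp x (hasDerivAt_modulus hx)).differentiableAt) hx
lemma analyticAt_theta2D_modulus :
    AnalyticAt ℂ (fun x => theta2D 0 (a * modulus x + b) (modulus x)) x :=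
  analyticAt_of_differentiable_cutPlane (fun x hx => ((hasDerivAt_theta2D_curve
    (modulus_im_pos hx) 0).comp x (hasDerivAt_modulus hx)).differentiableAt) hx
lemma analyticAt_theta3D_modulus :
    AnalyticAt ℂ (fun x => theta3D 0 (a * modulus x + b) (modulus x)) x :=
  analyticAt_of_differentiable_cutPlane (fun x hx => ((hasDerivAt_theta3D_curve
    (modulus_im_pos hx) 0).comp x (hasDerivAt_modulus hx)).differentiableAt) hx
lemma analyticAt_theta4D_modulus :
    AnalyticAt ℂ (fun x => theta4D 0 (a * modulus x + b) (modulus x)) x :=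
  analyticAt_of_differentiable_cutPlane (fun x hx => ((hasDerivAt_theta4D_curve
    (modulus_im_pos hx) 0).comp x (hasDerivAt_modulus hx)).differentiableAt) hx

/-- The modulus is not locally constant, hence an open map. -/
lemma map_modulus_nhds : map modulus (𝓝 x) = 𝓝 (modulus x) := by
  have hd := hasDerivAt_modulus hx
  have hs : HasStrictDerivAt modulus (deriv modulus x) x :=
    ((analyticAt_of_differentiable_cutPlane (fun _ h => differentiableAt_modulus h)
      hx).contDiffAt (n := 1)).hasStrictDerivAt one_ne_zero
  refine hs.map_nhds_eq ?_
  have hw := pi_sq_mul_theta3D_ne_zero (modulus_im_pos hx)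
  have hπ : (Real.pi : ℂ) ≠ 0 := by exact_mod_cast Real.pi_ne_zero
  have h0 := ne_zero_of_mem_cutPlane hx
  have h1 : 1 - x ≠ 0 := sub_ne_zero.2 (ne_one_of_mem_cutPlane hx).symm
  rw [hd.deriv]
  exact div_ne_zero (mul_ne_zero hπ I_ne_zero) (mul_ne_zero hw (mul_ne_zero h0 h1))
end

/-- If `z = a τ + b` is a half-period for all `τ` in an open set, then it is the same one for
all `τ`, as there are only countably many. -/
lemma exists_int_of_eventually_half_period {a b τ₀ : ℂ}
    (h : ∀ᶠ τ in 𝓝 τ₀, ∃ m n : ℤ, 2 * (a * τ + b) = m * τ + n) :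
    ∃ m n : ℤ, 2 * a = m ∧ 2 * b = n := by
  by_contra! hc
  have hsub : {τ : ℂ | ∃ m n : ℤ, 2 * (a * τ + b) = m * τ + n} ⊆
      Set.range fun p : ℤ × ℤ => ((p.2 : ℂ) - 2 * b) / (2 * a - p.1) := by
    rintro τ ⟨m, n, hmn⟩
    refine ⟨(m, n), ?_⟩
    have hne : 2 * a - m ≠ 0 := by
      intro h0
      refine hc m n (sub_eq_zero.1 h0) ?_
      linear_combination hmn - τ * h0
    simp only
    rw [div_eq_iff hne]
    linear_combination -hmn
  have hcount := (Set.countable_range fun p : ℤ × ℤ =>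
    ((p.2 : ℂ) - 2 * b) / (2 * a - p.1)).mono hsub
  obtain ⟨τ, hτ⟩ := (hcount.dense_compl ℂ).inter_nhds_nonempty h
  exact hτ.1 hτ.2

/-- The excluded pairs are those for which all of the denominators vanish identically; for the
other pairs they vanish only at isolated points. -/
lemma eventually_isGeneric {A B x : ℂ} (hAB : ¬ IsExcludedPair A B) (hx : x ∈ cutPlane) :
    ∀ᶠ t in 𝓝[≠] x, IsGeneric (-I * A) (-I * A * modulus t + B) (modulus t) := by
  set a := -I * A with ha
  have han := (((analyticAt_theta1D_modulus a B hx 0).mul (analyticAt_theta2D_modulus a B hx)).mul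
    (analyticAt_theta3D_modulus a B hx)).mul (analyticAt_theta4D_modulus a B hx)
  have hprod : ∀ᶠ t in 𝓝[≠] x, theta1D 0 (a * modulus t + B) (modulus t)
      * theta2D 0 (a * modulus t + B) (modulus t) * theta3D 0 (a * modulus t + B) (modulus t)
      * theta4D 0 (a * modulus t + B) (modulus t) ≠ 0 := by
    refine han.eventually_eq_zero_or_eventually_ne_zero.resolve_left fun h => hAB ?_
    have h2 : ∀ᶠ τ in 𝓝 (modulus x), ∃ m n : ℤ, 2 * (a * τ + B) = m * τ + n := by
      rw [← map_modulus_nhds hx, eventually_map]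
      filter_upwards [h, isOpen_cutPlane.eventually_mem hx] with t ht htc
      exact (theta_prod_eq_zero_iff (modulus_im_pos htc)).1 ht
    obtain ⟨m, n, hm, hn⟩ := exists_int_of_eventually_half_period h2
    refine ⟨m, n, ?_, by linear_combination hn / 2⟩
    rw [← hm, ha]
    linear_combination A * I_mul_I
  have hlan := (analyticAt_theta1D_modulus a B hx 1).add
    (analyticAt_const (v := 2 * Real.pi * I * a) |>.mul (analyticAt_theta1D_modulus a B hx 0))
  have hlog : ∀ᶠ t in 𝓝[≠] x, theta1D 1 (a * modulus t + B) (modulus t)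
      + 2 * Real.pi * I * a * theta1D 0 (a * modulus t + B) (modulus t) ≠ 0 := by
    refine hlan.eventually_eq_zero_or_eventually_ne_zero.resolve_left fun h => ?_
    obtain ⟨t, ⟨hts, htp⟩, htc⟩ := ((eventually_eventually_nhdsNE
      (h.filter_mono nhdsWithin_le_nhds)).and (eventually_eventually_nhdsNE hprod)).and
        (eventually_mem_nhdsNE isOpen_cutPlane hx) |>.exists
    have hτ := modulus_im_pos htc
    have hne := htp.self_of_nhds
    simp only [ne_eq, mul_eq_zero, not_or] at hne
    obtain ⟨⟨⟨h1, h2⟩, h3⟩, h4⟩ := hne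
    have hP : ∀ᶠ s in 𝓝 t, shiftedLogDeriv a (a * modulus s + B) (modulus s) = 0 := by
      filter_upwards [hts, htp] with s hs hsp
      simp only [ne_eq, mul_eq_zero, not_or] at hsp
      have h1 := hsp.1.1.1
      rw [shiftedLogDeriv, div_add' _ _ _ h1, div_eq_zero_iff]
      exact Or.inl hs
    have hP' : shiftedLogDeriv a (a * modulus t + B) (modulus t) = 0 := hP.self_of_nhds
    -- if `P = 0` near `t` then `dP/dτ = -2 h₂ h₃ h₄ / (4πi)` vanishes, which it does not
    have hd := ((hasDerivAt_shiftedLogDeriv hτ h1 h2 h3 h4).comp t (hasDerivAt_modulus htc)).unique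
      ((hasDerivAt_const t (0 : ℂ)).congr_of_eventuallyEq hP)
    have hw := pi_sq_mul_theta3D_ne_zero hτ
    have hπ : (Real.pi : ℂ) ≠ 0 := by exact_mod_cast Real.pi_ne_zero
    have hx0 := ne_zero_of_mem_cutPlane htc
    have hx1 : 1 - t ≠ 0 := sub_ne_zero.2 (ne_one_of_mem_cutPlane htc).symm
    have l2 := logDeriv21_ne_zero hτ h1 h2 h3 h4
    have l3 := logDeriv31_ne_zero hτ h1 h2 h3 h4
    have l4 := logDeriv41_ne_zero hτ h1 h2 h3 h4
    have c3 := theta3D_zero_ne_zero hτ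
    rw [hP'] at hd
    simp [hπ, hx0, hx1, l2, l3, l4, c3] at hd
  filter_upwards [hprod, hlog] with t ht htl
  simp only [ne_eq, mul_eq_zero, not_or] at ht
  obtain ⟨⟨⟨h1, h2⟩, h3⟩, h4⟩ := ht
  refine ⟨h1, h2, h3, h4, ?_⟩
  rw [shiftedLogDeriv, div_add' _ _ _ h1]
  exact div_ne_zero htl h1

lemma meromorphicAt_hitchinFormula (A B : ℂ) {x : ℂ} (hx : x ∈ cutPlane) :
    MeromorphicAt (hitchinFormula A B) x := by
  have hs : AnalyticAt ℂ (fun x : ℂ => x ^ (1 / 2 : ℂ)) x :=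
    analyticAt_id.cpow analyticAt_const hx.1
  have h1 := analyticAt_theta1D_modulus (-I * A) B hx 0
  have h1' := analyticAt_theta1D_modulus (-I * A) B hx 1
  have h2 := analyticAt_theta2D_modulus (-I * A) B hx
  have h3 := analyticAt_theta3D_modulus (-I * A) B hx
  have h4 := analyticAt_theta4D_modulus (-I * A) B hx
  have c2 : AnalyticAt ℂ (fun x => theta2D 0 0 (modulus x)) x := by
    simpa using analyticAt_theta2D_modulus 0 0 hx
  have e : hitchinFormula A B = fun x => x ^ (1 / 2 : ℂ)
      / theta1D 0 (-I * A * modulus x + B) (modulus x) ^ 2 *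
      (Real.pi * theta2D 0 0 (modulus x) ^ 2 * (theta2D 0 (-I * A * modulus x + B) (modulus x)
        * theta3D 0 (-I * A * modulus x + B) (modulus x)
        * theta4D 0 (-I * A * modulus x + B) (modulus x))
        / (theta1D 1 (-I * A * modulus x + B) (modulus x)
          + 2 * Real.pi * A * theta1D 0 (-I * A * modulus x + B) (modulus x))
      - theta2D 0 (-I * A * modulus x + B) (modulus x) ^ 2) := by
    funext x
    rw [← theta_argument_eq]
    simp only [← theta1_eq, ← theta2_eq, ← theta3_eq, ← theta4_eq, ← dtheta1_eq]
    rfl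
  rw [e]
  have m1 := h1.meromorphicAt
  have m1' := h1'.meromorphicAt
  have m2 := h2.meromorphicAt
  have m3 := h3.meromorphicAt
  have m4 := h4.meromorphicAt
  have mc := c2.meromorphicAt
  have ms := hs.meromorphicAt
  exact (ms.div (m1.pow 2)).mul (((((MeromorphicAt.const _ _).mul (mc.pow 2)).mul
    ((m2.mul m3).mul m4)).div (m1'.add ((MeromorphicAt.const _ _).mul m1))).sub (m2.pow 2))

/-- Near almost every point, `y_{A,B}` is the first component of a solution of the Hamiltonian
system which lies on none of the Riccati curves. -/
lemma eventually_isHamiltonianSolutionAt {A B x : ℂ} (hAB : ¬ IsExcludedPair A B)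
    (hx : x ∈ cutPlane) : ∀ᶠ t in 𝓝[≠] x, ∃ u : ℂ → ℂ,
      (∀ᶠ s in 𝓝 t, IsHamiltonianSolutionAt (hitchinFormula A B) u s) ∧ u t ≠ 0 ∧
      u t * hitchinFormula A B t - 1 ≠ 0 ∧ u t * (hitchinFormula A B t - 1) - 1 ≠ 0 ∧
      u t * (hitchinFormula A B t - t) - 1 ≠ 0 := by
  filter_upwards [eventually_eventually_nhdsNE ((eventually_isGeneric hAB hx).and
    (eventually_mem_nhdsNE isOpen_cutPlane hx))] with t ht
  have hy : hitchinFormula A B =ᶠ[𝓝 t]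
      fun x => hamiltonianY (-I * A) (-I * A * modulus x + B) (modulus x) :=
    ht.mono fun s hs => hitchinFormula_eq_hamiltonianY hs.2 hs.1
  refine ⟨fun x => hamiltonianU (-I * A) (-I * A * modulus x + B) (modulus x), ?_, ?_⟩
  · filter_upwards [ht, eventually_eventually_nhds.2 hy] with s hs hys
    have hS := isHamiltonianSolutionAt_modulus hs.2 hs.1
    have hys' := hys.self_of_nhds
    refine ⟨?_, ?_⟩
    · rw [hys']; exact hS.fst.congr_of_eventuallyEq hys
    · rw [hys']; exact hS.snd
  · obtain ⟨hg, htc⟩ := ht.self_of_nhds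
    have hτ := modulus_im_pos htc
    have hq : t * theta3D 0 0 (modulus t) ^ 4 = theta4D 0 0 (modulus t) ^ 4 := by
      have c3 := theta3D_zero_ne_zero hτ
      nth_rw 1 [eq_theta_quotient htc]
      field_simp
    rw [hy.self_of_nhds]
    have e1 := hamiltonianU_mul_hamiltonianY hτ hg
    have e2 := hamiltonianU_mul_hamiltonianY_sub_one hτ hg
    have e3 := hamiltonianU_mul_hamiltonianY_sub_self hτ hq hg
    have e0 := hamiltonianU_ne_zero hτ hg
    obtain ⟨h1, h2, h3, h4, hP⟩ := hg
    refine ⟨e0, ?_, ?_, ?_⟩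
    · exact e1 ▸ div_ne_zero hP (logDeriv21_ne_zero hτ h1 h2 h3 h4)
    · exact e2 ▸ div_ne_zero hP (logDeriv41_ne_zero hτ h1 h2 h3 h4)
    · exact e3 ▸ div_ne_zero hP (logDeriv31_ne_zero hτ h1 h2 h3 h4)

/-! ### The closed formula solves the equation -/

/-- The first Hamiltonian equation is not solved by `y = 0`, `y = 1` or `y = x`. -/
lemma eventually_hitchinFormula_ne {A B x : ℂ} (hAB : ¬ IsExcludedPair A B) (hx : x ∈ cutPlane)
    {g : ℂ → ℂ} {g' : ℂ} (hg : AnalyticAt ℂ g x) (hg' : ∀ t, HasDerivAt g g' t)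
    (hne : ∀ t ∈ cutPlane, ∀ u, hamiltonianRHS₁ t (g t) u / (t * (t - 1)) ≠ g') :
    ∀ᶠ t in 𝓝[≠] x, hitchinFormula A B t ≠ g t := by
  have hm := (meromorphicAt_hitchinFormula A B hx).sub hg.meromorphicAt
  refine (hm.eventually_eq_zero_or_eventually_ne_zero.resolve_left fun h => ?_).mono
    fun t ht => sub_ne_zero.1 ht
  obtain ⟨t, ⟨⟨u, hu, -⟩, ht⟩, htc⟩ := ((eventually_isHamiltonianSolutionAt hAB hx).and
    (eventually_eventually_nhdsNE h)).and (eventually_mem_nhdsNE isOpen_cutPlane hx) |>.exists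
  have ht' : hitchinFormula A B =ᶠ[𝓝 t] g := ht.mono fun s hs => sub_eq_zero.1 hs
  have e := hu.self_of_nhds.fst.unique ((hg' t).congr_of_eventuallyEq ht')
  rw [ht'.self_of_nhds] at e
  exact hne t htc _ e

lemma isPainleveSixSolution_hitchinFormula {A B : ℂ} (hAB : ¬ IsExcludedPair A B) :
    IsPainleveSixSolution (1 / 8) (1 / 8) (1 / 8) (1 / 8) cutPlane (hitchinFormula A B) := by
  refine ⟨fun x hx => meromorphicAt_hitchinFormula A B hx, fun x hx => ?_,
    fun x hx ha h0 h1 h2 => ?_⟩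
  · have n0 := eventually_hitchinFormula_ne hAB hx (g := fun _ => 0) (g' := 0) analyticAt_const
      (fun t => hasDerivAt_const t _) fun t ht u => by
        have e0 := ne_zero_of_mem_cutPlane ht
        have e1 : t - 1 ≠ 0 := sub_ne_zero.2 (ne_one_of_mem_cutPlane ht)
        simp [hamiltonianRHS₁, e0, e1]
    have n1 := eventually_hitchinFormula_ne hAB hx (g := fun _ => 1) (g' := 0) analyticAt_const
      (fun t => hasDerivAt_const t _) fun t ht u => by
        have e0 := ne_zero_of_mem_cutPlane ht
        have e1 : t - 1 ≠ 0 := sub_ne_zero.2 (ne_one_of_mem_cutPlane ht)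
        rw [show hamiltonianRHS₁ t 1 u = (t - 1) / 2 by rw [hamiltonianRHS₁]; ring]
        exact div_ne_zero (div_ne_zero e1 two_ne_zero) (mul_ne_zero e0 e1)
    have n2 := eventually_hitchinFormula_ne hAB hx (g := fun t => t) (g' := 1) analyticAt_id
      (fun t => hasDerivAt_id t) fun t ht u => by
        have e0 := ne_zero_of_mem_cutPlane ht
        have e1 : t - 1 ≠ 0 := sub_ne_zero.2 (ne_one_of_mem_cutPlane ht)
        rw [show hamiltonianRHS₁ t t u = t * (t - 1) * (1 / 2) by rw [hamiltonianRHS₁]; ring]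
        rw [mul_div_cancel_left₀ _ (mul_ne_zero e0 e1)]
        norm_num
    filter_upwards [n0, n1, n2] with t t0 t1 t2 using ⟨t0, t1, t2⟩
  · set y := hitchinFormula A B
    have hx0 := ne_zero_of_mem_cutPlane hx
    have hx1 : x - 1 ≠ 0 := sub_ne_zero.2 (ne_one_of_mem_cutPlane hx)
    have hy1 : y x - 1 ≠ 0 := sub_ne_zero.2 h1
    have hyx : y x - x ≠ 0 := sub_ne_zero.2 h2
    have c := ha.continuousAt
    have c' := ha.deriv.continuousAt
    have c'' := ha.deriv.deriv.continuousAt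
    have cR : ContinuousAt
        (fun t => painleveSixRHS (1 / 8) (1 / 8) (1 / 8) (1 / 8) t (y t) (deriv y t)) x := by
      unfold painleveSixRHS
      fun_prop (disch := simp [*])
    -- the equation holds at generic points near `x`, and both sides are continuous at `x`
    refine ((c''.eventuallyEq_nhds_iff_eventuallyEq_nhdsNE cR).1 ?_).self_of_nhds
    have n0 := (c.eventually_ne h0).filter_mono (nhdsWithin_le_nhds (s := {x}ᶜ))
    have n1 := (c.eventually_ne h1).filter_mono (nhdsWithin_le_nhds (s := {x}ᶜ))
    have n2 := ((c.sub continuousAt_id).eventually_ne hyx).filter_mono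
      (nhdsWithin_le_nhds (s := {x}ᶜ))
    filter_upwards [eventually_isHamiltonianSolutionAt hAB hx, n0, n1, n2,
      eventually_mem_nhdsNE isOpen_cutPlane hx] with t ht t0 t1 t2 htc
    obtain ⟨u, hu, -⟩ := ht
    exact deriv_deriv_eq_of_hamiltonian hu (ne_zero_of_mem_cutPlane htc)
      (ne_one_of_mem_cutPlane htc) t0 t1 (sub_ne_zero.1 t2)

/-- On a Riccati curve the momentum `u` is `0`, `1/y`, `1/(y-1)` or `1/(y-x)`. -/
lemma not_isRiccatiSolution_of_eq_hitchinFormula {A B : ℂ} (hAB : ¬ IsExcludedPair A B)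
    {U : Set ℂ} (hU : U.Nonempty) (hUo : IsOpen U) (hUc : U ⊆ cutPlane) {y : ℂ → ℂ}
    (hy : ∀ x ∈ U, y =ᶠ[𝓝[≠] x] hitchinFormula A B) : ¬ IsRiccatiSolution U y := by
  obtain ⟨x, hx⟩ := hU
  obtain ⟨t, ⟨⟨⟨u, hu, u0, u1, u2, u3⟩, htU⟩, hyt⟩, y0, y1, y2⟩ :=
    (((eventually_isHamiltonianSolutionAt hAB (hUc hx)).and (eventually_mem_nhdsNE hUo hx)).and
      (eventually_eventually_nhdsNE (hy x hx))).and
      ((isPainleveSixSolution_hitchinFormula hAB).nondegenerate x (hUc hx)) |>.exists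
  have e : y t = hitchinFormula A B t := hyt.self_of_nhds
  have hyt' : y =ᶠ[𝓝 t] hitchinFormula A B := hyt
  have ha : AnalyticAt ℂ y t := by
    have hd : DifferentiableOn ℂ (hitchinFormula A B)
        {s | IsHamiltonianSolutionAt (hitchinFormula A B) u s} := fun s hs =>
      hs.fst.differentiableAt.differentiableWithinAt
    exact (hd.analyticAt hu).congr hyt'.symm
  have hd := hyt'.deriv_eq.trans hu.self_of_nhds.fst.deriv
  have hx0 := ne_zero_of_mem_cutPlane (hUc htU)
  have hx1 : t - 1 ≠ 0 := sub_ne_zero.2 (ne_one_of_mem_cutPlane (hUc htU))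
  have y1' := sub_ne_zero.2 y1
  have y2' := sub_ne_zero.2 y2
  have hd' : t * (t - 1) * deriv y t = hamiltonianRHS₁ t (hitchinFormula A B t) (u t) := by
    rw [hd]; field_simp
  rintro (h | h | h | h) <;> have h := h t htU ha <;> rw [hd', e, hamiltonianRHS₁] at h
  · exact mul_ne_zero u0 (mul_ne_zero (mul_ne_zero y0 y1') y2') (by linear_combination h)
  · exact mul_ne_zero u1 (mul_ne_zero y1' y2') (by linear_combination h)
  · exact mul_ne_zero u2 (mul_ne_zero y0 y2') (by linear_combination h)
  · exact mul_ne_zero u3 (mul_ne_zero y0 y1') (by linear_combination h)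

/-! ### Solutions of the Hamiltonian system with given initial data -/

/-- The Hamiltonian system as an autonomous system for `(x, y, u)`. -/
noncomputable def hamiltonianField (p : ℂ × ℂ × ℂ) : ℂ × ℂ × ℂ :=
  (1, hamiltonianRHS₁ p.1 p.2.1 p.2.2 / (p.1 * (p.1 - 1)),
    hamiltonianRHS₂ p.1 p.2.1 p.2.2 / (p.1 * (p.1 - 1)))

lemma contDiffAt_hamiltonianField {p : ℂ × ℂ × ℂ} (h0 : p.1 ≠ 0) (h1 : p.1 ≠ 1) :
    ContDiffAt ℂ 1 hamiltonianField p := by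
  have hne : p.1 * (p.1 - 1) ≠ 0 := mul_ne_zero h0 (sub_ne_zero.2 h1)
  unfold hamiltonianField hamiltonianRHS₁ hamiltonianRHS₂
  refine contDiffAt_const.prodMk (ContDiffAt.prodMk ?_ ?_)
  · exact ContDiffAt.div (by fun_prop) (by fun_prop) hne
  · exact ContDiffAt.div (by fun_prop) (by fun_prop) hne

lemma IsHamiltonianSolutionAt.hasDerivAt_real {y u : ℂ → ℂ} {x : ℂ} {s : ℝ}
    (h : IsHamiltonianSolutionAt y u (x + s)) :
    HasDerivAt (fun s : ℝ => (x + s, y (x + s), u (x + s)))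
      (hamiltonianField (x + s, y (x + s), u (x + s))) s := by
  refine HasDerivAt.prodMk ?_ (HasDerivAt.prodMk ?_ ?_)
  · exact ((hasDerivAt_id (s : ℂ)).const_add x).comp_ofReal
  · exact (HasDerivAt.comp_const_add x (s : ℂ) h.fst).comp_ofReal
  · exact (HasDerivAt.comp_const_add x (s : ℂ) h.snd).comp_ofReal

lemma analyticAt_of_isHamiltonianSolutionAt {y u : ℂ → ℂ} {x : ℂ}
    (h : ∀ᶠ t in 𝓝 x, IsHamiltonianSolutionAt y u t) : AnalyticAt ℂ y x := by
  have hd : DifferentiableOn ℂ y {s | IsHamiltonianSolutionAt y u s} := fun s hs =>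
    hs.fst.differentiableAt.differentiableWithinAt
  exact hd.analyticAt h

/-- Solutions agree along a real segment by the Picard–Lindelöf theorem, hence near `x` by the
identity theorem. -/
lemma eventuallyEq_of_isHamiltonianSolutionAt {y u Y V : ℂ → ℂ} {x : ℂ} (h0 : x ≠ 0) (h1 : x ≠ 1)
    (h : ∀ᶠ t in 𝓝 x, IsHamiltonianSolutionAt y u t)
    (H : ∀ᶠ t in 𝓝 x, IsHamiltonianSolutionAt Y V t) (hy : y x = Y x) (hu : u x = V x) :
    y =ᶠ[𝓝 x] Y := by
  obtain ⟨K, S, hS, hK⟩ := ((contDiffAt_hamiltonianField (p := (x, y x, u x)) h0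
    h1).restrict_scalars ℝ).exists_lipschitzOnWith
  have hline : Tendsto (fun s : ℝ => x + (s : ℂ)) (𝓝 0) (𝓝 x) := by
    have : Continuous fun s : ℝ => x + (s : ℂ) := by fun_prop
    simpa using this.tendsto 0
  have aux : ∀ f g : ℂ → ℂ, (∀ᶠ t in 𝓝 x, IsHamiltonianSolutionAt f g t) → f x = y x → g x = u x →
      ∀ᶠ s : ℝ in 𝓝 0, HasDerivAt (fun s : ℝ => (x + (s : ℂ), f (x + s), g (x + s)))
        (hamiltonianField (x + s, f (x + s), g (x + s))) s ∧
        (x + (s : ℂ), f (x + s), g (x + s)) ∈ S := by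
    intro f g hfg hf hg
    have hd := hline.eventually hfg
    have hc := (IsHamiltonianSolutionAt.hasDerivAt_real (s := 0)
      (by simpa using hfg.self_of_nhds)).continuousAt
    have hmem := hc.preimage_mem_nhds (t := S) (by simpa [hf, hg] using hS)
    filter_upwards [hd, hmem] with s hs hm using ⟨hs.hasDerivAt_real, hm⟩
  have heq := ODE_solution_unique_of_eventually (v := fun _ => hamiltonianField) (s := fun _ => S)
    (Eventually.of_forall fun _ => hK) (aux y u h rfl rfl) (aux Y V H hy.symm hu.symm)
    (by simp [hy, hu])
  refine ((analyticAt_of_isHamiltonianSolutionAt h).frequently_eq_iff_eventually_eq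
    (analyticAt_of_isHamiltonianSolutionAt H)).1 ?_
  have hline' : Tendsto (fun s : ℝ => x + (s : ℂ)) (𝓝[≠] 0) (𝓝[≠] x) := by
    refine tendsto_nhdsWithin_iff.2 ⟨hline.mono_left nhdsWithin_le_nhds, ?_⟩
    filter_upwards [self_mem_nhdsWithin] with s hs
    simpa using hs
  refine hline'.frequently (Eventually.frequently ?_)
  filter_upwards [heq.filter_mono nhdsWithin_le_nhds] with s hs
  exact congrArg (fun p => p.2.1) hs

/-- The momentum of a solution of the sixth Painlevé equation, obtained by solving the first
Hamiltonian equation for `u`. -/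
noncomputable def conjugateMomentum (y : ℂ → ℂ) (x : ℂ) : ℂ :=
  (x * (x - 1) * deriv y x + 1 / 2 * y x ^ 2 - x * y x + 1 / 2 * x)
    / (y x * (y x - 1) * (y x - x))

lemma isHamiltonianSolutionAt_conjugateMomentum {y : ℂ → ℂ} {x : ℂ} (ha : AnalyticAt ℂ y x)
    (hx0 : x ≠ 0) (hx1 : x ≠ 1) (hy0 : y x ≠ 0) (hy1 : y x ≠ 1) (hyx : y x ≠ x)
    (h : deriv (deriv y) x = painleveSixRHS (1 / 8) (1 / 8) (1 / 8) (1 / 8) x (y x) (deriv y x)) :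
    IsHamiltonianSolutionAt y (conjugateMomentum y) x := by
  have hx1' : x - 1 ≠ 0 := sub_ne_zero.2 hx1
  have hy1' : y x - 1 ≠ 0 := sub_ne_zero.2 hy1
  have hyx' : y x - x ≠ 0 := sub_ne_zero.2 hyx
  have dy := ha.differentiableAt.hasDerivAt
  have ddy := ha.deriv.differentiableAt.hasDerivAt
  have did := hasDerivAt_id x
  constructor
  · refine dy.congr_deriv ?_
    rw [hamiltonianRHS₁, conjugateMomentum]
    field_simp
    ring
  · have dn := ((((did.mul (did.sub_const 1)).mul ddy).add ((dy.pow 2).const_mul (1 / 2))).sub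
      (did.mul dy)).add (did.const_mul (1 / 2))
    have dd := dn.div ((dy.mul (dy.sub_const 1)).mul (dy.sub did))
      (mul_ne_zero (mul_ne_zero hy0 hy1') hyx')
    refine HasDerivAt.congr_deriv (f := conjugateMomentum y) dd ?_
    rw [h]
    simp only [Pi.mul_apply, Pi.add_apply, Pi.sub_apply, Pi.pow_apply, id, conjugateMomentum,
      hamiltonianRHS₂, painleveSixRHS]
    generalize y x = Y at *
    generalize deriv y x = p at *
    push_cast
    field_simp
    ring

/-- The theta quotients take all initial values off the Riccati curves: `z` is determined by
`θ₂(z)² / θ₁(z)²`, i.e. by `y - 1/u`, and then `a` by `u`. -/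
lemma exists_isGeneric_eq {x y₀ u₀ : ℂ} (hx : x ∈ cutPlane) (h0 : u₀ ≠ 0) (h1 : u₀ * y₀ - 1 ≠ 0)
    (h2 : u₀ * (y₀ - 1) - 1 ≠ 0) (h3 : u₀ * (y₀ - x) - 1 ≠ 0) :
    ∃ a b : ℂ, IsGeneric a (a * modulus x + b) (modulus x) ∧
      hamiltonianY a (a * modulus x + b) (modulus x) = y₀ ∧
      hamiltonianU a (a * modulus x + b) (modulus x) = u₀ := by
  have hτ := modulus_im_pos hx
  have hxq := eq_theta_quotient hx
  generalize modulus x = τ at *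
  have c2 := theta2D_zero_ne_zero hτ
  have c3 := theta3D_zero_ne_zero hτ
  have c4 := theta4D_zero_ne_zero hτ
  have hw := pi_sq_mul_theta3D_ne_zero hτ
  have hπ : (Real.pi : ℂ) ≠ 0 := by exact_mod_cast Real.pi_ne_zero
  obtain ⟨q, hq⟩ : ∃ q, q = y₀ - 1 / u₀ := ⟨_, rfl⟩
  have hqu : u₀ * q = u₀ * y₀ - 1 := by rw [hq]; field_simp
  have q0 : q ≠ 0 := fun h => h1 (by rw [← hqu, h, mul_zero])
  have q1 : 1 - q ≠ 0 := fun h => h2 (by linear_combination -hqu - u₀ * h)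
  have qx : x - q ≠ 0 := fun h => h3 (by linear_combination -hqu - u₀ * h)
  obtain ⟨z, t1, hz⟩ := exists_theta2D_sq_eq hτ (-q * theta3D 0 0 τ ^ 2 / theta4D 0 0 τ ^ 2)
  have t2 : theta2D 0 z τ ≠ 0 := by
    intro h
    rw [h, zero_pow two_ne_zero] at hz
    have : -q * theta3D 0 0 τ ^ 2 / theta4D 0 0 τ ^ 2 * theta1D 0 z τ ^ 2 ≠ 0 := by
      simp [q0, c3, c4, t1]
    exact this hz.symm
  have t4 : theta4D 0 z τ ≠ 0 := by
    intro h
    have e := theta4D_sq_relation z hτ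
    rw [h, hz] at e
    field_simp at e
    exact mul_ne_zero (mul_ne_zero (pow_ne_zero 2 c3) (pow_ne_zero 2 t1)) q1
      (by linear_combination -e)
  have t3 : theta3D 0 z τ ≠ 0 := by
    intro h
    have e := theta3D_sq_relation z hτ
    rw [h, hz] at e
    field_simp at e
    have hx3 : x * theta3D 0 0 τ ^ 4 = theta4D 0 0 τ ^ 4 := by rw [hxq]; field_simp
    exact mul_ne_zero (mul_ne_zero (pow_ne_zero 4 c3) (pow_ne_zero 2 t1)) qx
      (by linear_combination theta1D 0 z τ ^ 2 * hx3 - e)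
  have l2 := logDeriv21_ne_zero hτ t1 t2 t3 t4
  have l3 := logDeriv31_ne_zero hτ t1 t2 t3 t4
  have l4 := logDeriv41_ne_zero hτ t1 t2 t3 t4
  have l34 : logDeriv31 z τ * logDeriv41 z τ = -q * (Real.pi ^ 2 * theta3D 0 0 τ ^ 4) := by
    rw [logDeriv31_mul_logDeriv41 t1 t2 t3 t4, hz]
    field_simp
  obtain ⟨P, hP⟩ : ∃ P, P = -(u₀ * (logDeriv21 z τ * logDeriv31 z τ * logDeriv41 z τ))
    / (Real.pi ^ 2 * theta3D 0 0 τ ^ 4) := ⟨_, rfl⟩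
  have hP0 : P ≠ 0 := by
    rw [hP]
    exact div_ne_zero (neg_ne_zero.2 (mul_ne_zero h0 (mul_ne_zero (mul_ne_zero l2 l3) l4))) hw
  obtain ⟨a, ha⟩ : ∃ a, a = (P - theta1D 1 z τ / theta1D 0 z τ) / (2 * Real.pi * I) := ⟨_, rfl⟩
  have hshift : shiftedLogDeriv a z τ = P := by
    have : (2 * Real.pi * I : ℂ) ≠ 0 := by simp [hπ]
    rw [shiftedLogDeriv, ha, mul_div_cancel₀ _ this]
    ring
  have hg : IsGeneric a z τ := ⟨t1, t2, t3, t4, hshift ▸ hP0⟩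
  have hU : hamiltonianU a z τ = u₀ := by
    rw [hamiltonianU, hshift, hP]
    generalize (Real.pi ^ 2 * theta3D 0 0 τ ^ 4 : ℂ) = w at *
    field_simp
  refine ⟨a, z - a * τ, ?_⟩
  rw [add_sub_cancel]
  refine ⟨hg, ?_, hU⟩
  have e := hamiltonianU_mul_hamiltonianY hτ hg
  have e2 : P / logDeriv21 z τ = u₀ * q := by
    rw [hP, mul_assoc (logDeriv21 z τ), l34]
    generalize (Real.pi ^ 2 * theta3D 0 0 τ ^ 4 : ℂ) = w at *
    field_simp
  rw [hU, hshift, e2, hqu] at e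
  exact mul_left_cancel₀ h0 (by linear_combination e)

/-- For an excluded pair `z` is a half-period, where one of the theta functions vanishes. -/
lemma not_isExcludedPair_of_isGeneric {a b τ : ℂ} (hτ : 0 < τ.im) (h : IsGeneric a (a * τ + b) τ) :
    ¬ IsExcludedPair (I * a) b := by
  rintro ⟨m, n, hm, hn⟩
  have ha : a = m / 2 := mul_left_cancel₀ I_ne_zero (by rw [hm]; ring)
  have h0 := (theta_prod_eq_zero_iff (z := a * τ + b) hτ).2 ⟨m, n, by rw [ha, hn]; ring⟩
  simp [h.theta1_ne, h.theta2_ne, h.theta3_ne, h.theta4_ne] at h0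

/-! ### Solutions which are not Riccati solutions -/

/-- On a connected set, a Riccati equation that fails at one point of analyticity fails at all but
isolated points. -/
lemma eventually_riccati_ne {U : Set ℂ} (hU : IsPreconnected U) {y : ℂ → ℂ}
    (hy : MeromorphicOn y U) {a b c d : ℂ} (h : ¬ SatisfiesRiccati a b c d U y) {x : ℂ}
    (hx : x ∈ U) : ∀ᶠ t in 𝓝[≠] x,
      t * (t - 1) * deriv y t - (a * y t ^ 2 + (b * t + c) * y t + d * t) ≠ 0 := by
  have hm : ∀ x, MeromorphicAt y x → MeromorphicAt (fun t => t * (t - 1) * deriv y t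
      - (a * y t ^ 2 + (b * t + c) * y t + d * t)) x := by
    intro x hyx
    have hid : MeromorphicAt (fun t : ℂ => t) x := MeromorphicAt.id x
    have hc : ∀ e : ℂ, MeromorphicAt (fun _ : ℂ => e) x := fun e => MeromorphicAt.const e x
    exact ((hid.mul (hid.sub (hc 1))).mul hyx.deriv).sub ((((hc a).mul (hyx.pow 2)).add
      ((((hc b).mul hid).add (hc c)).mul hyx)).add ((hc d).mul hid))
  rw [SatisfiesRiccati] at h
  push Not at h
  obtain ⟨x₁, hx₁, han, hne⟩ := h
  have h1 : meromorphicOrderAt (fun t => t * (t - 1) * deriv y t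
      - (a * y t ^ 2 + (b * t + c) * y t + d * t)) x₁ ≠ ⊤ := by
    rw [meromorphicOrderAt_ne_top_iff_eventually_ne_zero (hm x₁ han.meromorphicAt)]
    have c0 := han.continuousAt
    have c1 := han.deriv.continuousAt
    have hc : ContinuousAt (fun t => t * (t - 1) * deriv y t
      - (a * y t ^ 2 + (b * t + c) * y t + d * t)) x₁ := by fun_prop
    exact (hc.eventually_ne (sub_ne_zero.2 hne)).filter_mono nhdsWithin_le_nhds
  exact (meromorphicOrderAt_ne_top_iff_eventually_ne_zero (hm x (hy x hx))).1
    (MeromorphicOn.meromorphicOrderAt_ne_top_of_isPreconnected (fun t ht => hm t (hy t ht)) hU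
      hx₁ hx h1)

/-- The identity theorem for meromorphic functions. -/
lemma eventuallyEq_of_meromorphicOn {U : Set ℂ} (hU : IsPreconnected U) {f g : ℂ → ℂ}
    (hf : MeromorphicOn f U) (hg : MeromorphicOn g U) {x₀ : ℂ} (hx₀ : x₀ ∈ U)
    (h : f =ᶠ[𝓝 x₀] g) : ∀ x ∈ U, f =ᶠ[𝓝[≠] x] g := by
  intro x hx
  have hfg : MeromorphicOn (f - g) U := hf.sub hg
  have h0 : meromorphicOrderAt (f - g) x₀ = ⊤ := by
    rw [meromorphicOrderAt_eq_top_iff]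
    exact (h.filter_mono nhdsWithin_le_nhds).mono fun t ht => sub_eq_zero.2 ht
  have h1 : meromorphicOrderAt (f - g) x = ⊤ := by
    by_contra hne
    exact hfg.meromorphicOrderAt_ne_top_of_isPreconnected hU hx hx₀ hne h0
  exact (meromorphicOrderAt_eq_top_iff.1 h1).mono fun t ht => sub_eq_zero.1 ht

lemma exists_eq_hitchinFormula {U : Set ℂ} (hUo : IsOpen U) (hU : IsConnected U)
    (hUc : U ⊆ cutPlane) {y : ℂ → ℂ}
    (hy : IsPainleveSixSolution (1 / 8) (1 / 8) (1 / 8) (1 / 8) U y)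
    (hR : ¬ IsRiccatiSolution U y) :
    ∃ A B : ℂ, ¬ IsExcludedPair A B ∧ ∀ x ∈ U, y =ᶠ[𝓝[≠] x] hitchinFormula A B := by
  simp only [IsRiccatiSolution, not_or] at hR
  obtain ⟨r0, r1, r2, r3⟩ := hR
  obtain ⟨x₁, hx₁⟩ := hU.nonempty
  have hm := hy.meromorphicOn
  obtain ⟨x, hE, e0, e1, e2, e3⟩ := ((eventually_eventually_nhdsNE
    (((hm x₁ hx₁).eventually_analyticAt.and (hy.nondegenerate x₁ hx₁)).and
      (eventually_mem_nhdsNE hUo hx₁))).and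
    ((eventually_riccati_ne hU.isPreconnected hm r0 hx₁).and
    ((eventually_riccati_ne hU.isPreconnected hm r1 hx₁).and
    ((eventually_riccati_ne hU.isPreconnected hm r2 hx₁).and
    (eventually_riccati_ne hU.isPreconnected hm r3 hx₁))))).exists
  -- at the point `x` the solution is analytic and lies on none of the Riccati curves
  obtain ⟨⟨ha, y0, y1, yx⟩, hxU⟩ := hE.self_of_nhds
  have hx := hUc hxU
  have hx0 := ne_zero_of_mem_cutPlane hx
  have hx1 := ne_one_of_mem_cutPlane hx
  have y1' := sub_ne_zero.2 y1
  have yx' := sub_ne_zero.2 yx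
  have hsol : ∀ᶠ t in 𝓝 x, IsHamiltonianSolutionAt y (conjugateMomentum y) t := by
    filter_upwards [hE] with t ht
    obtain ⟨⟨ha, y0, y1, yx⟩, htU⟩ := ht
    exact isHamiltonianSolutionAt_conjugateMomentum ha (ne_zero_of_mem_cutPlane (hUc htU))
      (ne_one_of_mem_cutPlane (hUc htU)) y0 y1 yx (hy.equation t htU ha y0 y1 yx)
  have hu : conjugateMomentum y x * (y x * (y x - 1) * (y x - x)) =
      x * (x - 1) * deriv y x + 1 / 2 * y x ^ 2 - x * y x + 1 / 2 * x :=
    div_mul_cancel₀ _ (mul_ne_zero (mul_ne_zero y0 y1') yx')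
  obtain ⟨a, b, hg, hY, hV⟩ := exists_isGeneric_eq (x := x) (y₀ := y x)
    (u₀ := conjugateMomentum y x) hx
    (fun h => e0 (by linear_combination (y x * (y x - 1) * (y x - x)) * h - hu))
    (fun h => e1 (by linear_combination ((y x - 1) * (y x - x)) * h - hu))
    (fun h => e2 (by linear_combination (y x * (y x - x)) * h - hu))
    (fun h => e3 (by linear_combination (y x * (y x - 1)) * h - hu))
  have hAB := not_isExcludedPair_of_isGeneric (modulus_im_pos hx) hg
  refine ⟨I * a, b, hAB, ?_⟩
  have haI : -I * (I * a) = a := by linear_combination (-a) * I_mul_I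
  have hgen : ∀ᶠ t in 𝓝 x, IsGeneric a (a * modulus t + b) (modulus t) ∧ t ∈ cutPlane := by
    have hc := isOpen_cutPlane.eventually_mem hx
    have hne := eventually_nhdsWithin_iff.1 (eventually_isGeneric hAB hx)
    filter_upwards [hc, hne] with t ht hgt
    refine ⟨?_, ht⟩
    by_cases htx : t = x
    · rw [htx]; exact hg
    · have := hgt htx
      rwa [haI] at this
  refine eventuallyEq_of_meromorphicOn hU.isPreconnected hm
    (fun t ht => meromorphicAt_hitchinFormula _ _ (hUc ht)) hxU ?_
  refine (eventuallyEq_of_isHamiltonianSolutionAt hx0 hx1 hsol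
    (hgen.mono fun t ht => isHamiltonianSolutionAt_modulus ht.2 ht.1) hY.symm hV.symm).trans ?_
  filter_upwards [hgen] with t ht
  have := hitchinFormula_eq_hamiltonianY (A := I * a) (B := b) ht.2 (by rw [haI]; exact ht.1)
  rw [haI] at this
  exact this.symm

theorem theorem1 :
    (∀ A B : ℂ, ¬ IsExcludedPair A B →
      IsPainleveSixSolution (1 / 8) (1 / 8) (1 / 8) (1 / 8) cutPlane (hitchinFormula A B)) ∧
    (∀ U : Set ℂ, IsOpen U → IsConnected U → U ⊆ cutPlane → ∀ y : ℂ → ℂ,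
      IsPainleveSixSolution (1 / 8) (1 / 8) (1 / 8) (1 / 8) U y →
      ((∃ A B : ℂ, ¬ IsExcludedPair A B ∧ ∀ x ∈ U, y =ᶠ[𝓝[≠] x] hitchinFormula A B) ↔
        ¬ IsRiccatiSolution U y)) := by
  refine ⟨fun A B hAB => isPainleveSixSolution_hitchinFormula hAB, fun U hUo hU hUc y hy => ⟨?_, ?_⟩⟩
  · rintro ⟨A, B, hAB, h⟩
    exact not_isRiccatiSolution_of_eq_hitchinFormula hAB hU.nonempty hUo hUc h
  · exact exists_eq_hitchinFormula hUo hU hUc hy
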